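/- Let $q\ge 5$ be a prime power, $K=\mathbb F_{q^2}$, and let $F_0=K(x_0)$ be the rational function field, $F_1=F_0(x_1)$, $F_2=F_1(x_2)$ the first steps of the Garcia–Stichtenoth tower, where $$x_{1}^q+x_{1}=\frac{x_0^q}{x_0^{q-1}+1},\qquad x_{2}^q+x_{2}=\frac{x_1^q}{x_1^{q-1}+1}.$$ Let $P_\infty$ be the pole of $x_0$ in $F_0$, let $D=qP_\infty$ with Riemann–Roch space $\mathcal L(D)\subseteq F_0$, let $$S=\{P_\alpha : \alpha\in K,\ \alpha^q+\alpha\ne 0\},$$ where $P_\alpha$ is the zero of $x_0-\alpha$ in $F_0$, and let $\mathcal B$ be the set of places of $F_2$ lying over a place in $S$. Let $V\subseteq F_2$ be the $K$-linear span of the functions $$f\,x_1^{e_1}x_2^{e_2},\qquad f\in\mathcal L(D),\quad 0\le e_1\le q-1,\quad 0\le e_2\le q-2.$$ Then every $f\in V$ has at every $Q\in\mathcal B$ a residue class $f(Q)\in K$, so that the code $$C_2(S,qP_\infty)=\{(f(Q))_{Q\in\mathcal B} : f\in V\}\subseteq K^{\mathcal B}$$ is well defined, and it is a locally recoverable code with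 locality $q-1$ (every coordinate of a codeword can be recovered from at most $q-1$ other coordinates), whose length, dimension and minimum distance are exactly $$n=q^2(q^2-q),\qquad k=(q+1)q(q-1)=q^3-q,\qquad d=q^2(q^2-4q+3).$$ -/

import Mathlib

/-! ## Places, divisors and Riemann-Roch spaces of a function field -/

/-- A place of `F / K`, given by its valuation ring `O` with `K ⊆ O ⊊ F`; the place itself is the
maximal ideal of `O`, which is the set `O.nonunits` of elements of `F`. -/
@[ext]
structure FFPlace (K F : Type*) [Field K] [Field F] [Algebra K F] where
  /-- the valuation ring of the place -/
  ring : ValuationSubring F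
  algebraMap_mem : ∀ a : K, algebraMap K F a ∈ ring
  ne_top : ring ≠ ⊤

namespace FFPlace

variable {K F : Type*} [Field K] [Field F] [Algebra K F]

/-- `t` is a local parameter at `P`: it generates the maximal ideal of the valuation ring. -/
def IsUniformizer (P : FFPlace K F) (t : F) : Prop :=
  t ∈ P.ring.nonunits ∧ ∀ z ∈ P.ring.nonunits, ∃ w ∈ P.ring, z = t * w

/-- `f = t ^ n * u` for a local parameter `t` at `P` and a unit `u` of the valuation ring. -/
def HasOrd (P : FFPlace K F) (f : F) (n : ℤ) : Prop :=
  ∃ t u : F, P.IsUniformizer t ∧ u ∈ P.ring ∧ u⁻¹ ∈ P.ring ∧ u ≠ 0 ∧ f = t ^ n * u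

/-- `f` lies in the Riemann-Roch space of the divisor `D`: `f = 0`, or the order of `f` at every
place `P` is at least `-D(P)`. -/
def MemRiemannRoch (D : FFPlace K F →₀ ℤ) (f : F) : Prop :=
  f = 0 ∨ ∀ P : FFPlace K F, ∃ n : ℤ, P.HasOrd f n ∧ -D P ≤ n

/-- The Riemann-Roch space `L(D)` of the divisor `D`, as a set of functions. -/
def riemannRoch (D : FFPlace K F →₀ ℤ) : Set F := {f | MemRiemannRoch D f}

/-- The residue class of `f` modulo the place `Q` is the constant `c`. -/
def HasValue (Q : FFPlace K F) (f : F) (c : K) : Prop :=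
  f - algebraMap K F c ∈ Q.ring.nonunits

/-- The place `Q` of `F` lies over the place `P` of the subfield `F₀`: the valuation ring of `P`
is the intersection of `F₀` with the valuation ring of `Q`. -/
def LiesOver {F₀ : Type*} [Field F₀] [Algebra K F₀] [Algebra F₀ F]
    (Q : FFPlace K F) (P : FFPlace K F₀) : Prop :=
  Q.ring.comap (algebraMap F₀ F) = P.ring

theorem hasValue_zero (Q : FFPlace K F) : Q.HasValue 0 0 := by
  simp [HasValue]

theorem HasValue.add {Q : FFPlace K F} {f g : F} {a b : K} (hf : Q.HasValue f a)
    (hg : Q.HasValue g b) : Q.HasValue (f + g) (a + b) := by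
  unfold HasValue at *
  rw [ValuationSubring.mem_nonunits_iff] at *
  have h : f + g - algebraMap K F (a + b)
      = (f - algebraMap K F a) + (g - algebraMap K F b) := by
    rw [map_add]; ring
  rw [h]
  exact Valuation.map_add_lt _ hf hg

theorem HasValue.smul {Q : FFPlace K F} {f : F} {a : K} (c : K) (hf : Q.HasValue f a) :
    Q.HasValue (c • f) (c * a) := by
  unfold HasValue at *
  rw [ValuationSubring.mem_nonunits_iff] at *
  have h : c • f - algebraMap K F (c * a) = algebraMap K F c * (f - algebraMap K F a) := by
    rw [map_mul, Algebra.smul_def]; ring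
  rw [h, map_mul]
  exact lt_of_le_of_lt (mul_le_of_le_one_left'
    ((ValuationSubring.valuation_le_one_iff _ _).2 (Q.algebraMap_mem c))) hf

end FFPlace

/-! ## Linear codes -/

section Codes

variable {K ι : Type*} [Field K]

/-- `C` is a locally recoverable code with locality `r`: every coordinate `i` of a codeword can be
recovered, by a function `φ`, from at most `r` other coordinates. -/
def IsLocallyRecoverable (C : Submodule K (ι → K)) (r : ℕ) : Prop :=
  ∀ i : ι, ∃ R : Finset ι, i ∉ R ∧ R.card ≤ r ∧
    ∃ φ : (R → K) → K, ∀ c ∈ C, c i = φ fun j => c j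

/-- `d` is the minimum distance of `C`: the least number of nonzero entries of a nonzero
codeword. -/
def IsMinDistance (C : Submodule K (ι → K)) (d : ℕ) : Prop :=
  IsLeast {m : ℕ | ∃ c ∈ C, c ≠ 0 ∧ m = {i : ι | c i ≠ 0}.ncard} d

/-- The code with coordinates indexed by a set `B` of places, obtained by evaluating the functions
in `V` at the places in `B`. -/
def evalCode {F : Type*} [Field F] [Algebra K F] (B : Set (FFPlace K F)) (V : Submodule K F) :
    Submodule K (B → K) where
  carrier := {c | ∃ f ∈ V, ∀ Q : B, (Q : FFPlace K F).HasValue f (c Q)}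
  zero_mem' := ⟨0, V.zero_mem, fun Q => Q.1.hasValue_zero⟩
  add_mem' := by
    rintro a b ⟨f, hf, hfa⟩ ⟨g, hg, hgb⟩
    exact ⟨f + g, V.add_mem hf hg, fun Q => (hfa Q).add (hgb Q)⟩
  smul_mem' := by
    rintro c a ⟨f, hf, hfa⟩
    exact ⟨c • f, V.smul_mem c hf, fun Q => (hfa Q).smul c⟩

end Codes

/-! ## The code `C₂(S, D)` on the tower `F₀ = K(x₀) ⊆ F₁ = F₀(x₁) ⊆ F₂ = F₁(x₂) = F` -/

section Tower

variable {K : Type*} [Field K]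

open Classical in
/-- The place `P_∞` of the rational function field `K(x₀)`: the pole of `x₀`. -/
noncomputable def placeInfty (K : Type*) [Field K] : FFPlace K (RatFunc K) where
  ring := (RatFunc.inftyValuation K).valuationSubring
  algebraMap_mem a := by
    rw [Valuation.mem_valuationSubring_iff]
    by_cases ha : a = 0
    · simp [ha]
    · exact (RatFunc.inftyValuation.C K ha).le
  ne_top h := by
    have hX : (RatFunc.X : RatFunc K) ∈ (RatFunc.inftyValuation K).valuationSubring :=
      h ▸ ValuationSubring.mem_top _
    rw [Valuation.mem_valuationSubring_iff, RatFunc.inftyValuation.X] at hX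
    exact absurd hX (by decide)

/-- The set `S` of the places `P_α` of `K(x₀)` (the zero of `x₀ - α`), over all `α` in `K` with
`α ^ q + α ≠ 0`. -/
def placesS (K : Type*) [Field K] (q : ℕ) : Set (FFPlace K (RatFunc K)) :=
  {P | ∃ α : K, α ^ q + α ≠ 0 ∧ RatFunc.X - RatFunc.C α ∈ P.ring.nonunits}

/-- The evaluation set: all places of `F` that lie over a place in `S`. -/
def placesAbove {F : Type*} [Field F] [Algebra K F] [Algebra (RatFunc K) F]
    (S : Set (FFPlace K (RatFunc K))) : Set (FFPlace K F) :=
  {Q | ∃ P ∈ S, Q.LiesOver P}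

/-- The space `V` spanned by the functions `f * x₁ ^ e₁ * x₂ ^ e₂` with `f` in `L(D)`,
`0 ≤ e₁ ≤ m₁ - 1` and `0 ≤ e₂ ≤ m₂ - 2`. -/
def spaceV {F : Type*} [Field F] [Algebra K F] [Algebra (RatFunc K) F]
    (D : FFPlace K (RatFunc K) →₀ ℤ) (m₁ m₂ : ℕ) (x₁ x₂ : F) : Submodule K F :=
  Submodule.span K {g | ∃ f ∈ FFPlace.riemannRoch D, ∃ e₁ e₂ : ℕ, e₁ + 1 ≤ m₁ ∧ e₂ + 2 ≤ m₂ ∧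
    g = algebraMap (RatFunc K) F f * x₁ ^ e₁ * x₂ ^ e₂}

/-- The code `C₂(S, D)`: the functions in `V` evaluated at the places of `F` above `S`. -/
def codeC2 {F : Type*} [Field F] [Algebra K F] [Algebra (RatFunc K) F]
    (S : Set (FFPlace K (RatFunc K))) (D : FFPlace K (RatFunc K) →₀ ℤ) (m₁ m₂ : ℕ) (x₁ x₂ : F) :
    Submodule K (↥(placesAbove S : Set (FFPlace K F)) → K) :=
  evalCode (placesAbove S) (spaceV D m₁ m₂ x₁ x₂)

end Tower

/-! The places above `S` are the points `(α₀, α₁, α₂)` of `K³` satisfying the tower equations with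
`α₀` of nonzero trace. The reason is that `gsMap` takes values in 𝔽_q, and for `c` in 𝔽_q the
polynomial `T ^ q + T - c` has `q` roots, all in `K`; so every place of `S` splits completely. By
`mem_riemannRoch_iff`, 𝓛(qP_∞) consists of the polynomials in `x₀` of degree at most `q`, hence `V`
consists of the polynomials `towerFun q a` of degree at most `q`, `q - 1`, `q - 2` in `x₀`, `x₁`,
`x₂` (`spaceV_eq_range`), and the code is evaluation of these at the points.

Everything rests on a sharp bound for the number of zeros of such a function (`ncard_zeros_le`). Its
norm to `K(x₀)` has poles only at infinity, at the roots of `x₀ ^ (q - 1) + 1` and at `x₀ = 0`.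
Multiplying by suitable powers of the last two polynomials gives a polynomial `G` in `x₀` of degree
at most `q³ + q²(q - 1) + q²(q - 2)`, and each zero above `α` contributes at least one to the
multiplicity of `α` in `G` (`exists_polynomial_of_norm`). The norm is handled as the product over
the embeddings of `F` into an algebraic closure, and pole orders are read off from arbitrary
valuation rings there. Total ramification at infinity makes the monomials `x₁ ^ i * x₂ ^ j` with `i,
j < q` independent over `K(x₀)`; so there are exactly `q²` embeddings, and each solution of the
tower equations comes from one (`card_algHom_and_exists`).

The bound is attained by a product of polynomials in single coordinates with disjoint zero sets
(`exists_towerFun_many_zeros`), which gives the distance. Since the bound is below the length,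
evaluation is injective, which gives the dimension. Locality is interpolation: on a fibre with `x₀`,
`x₁` fixed there are `q` points, and the degree in `x₂` is at most `q - 2`.

That places and points correspond bijectively (`exists_equiv_towerPoints`) needs that a point
carries only one place. The curve is smooth there with local parameter `x₀ - α₀`, so the order of a
function is determined by the point (`place_le_of_atPoint`). -/

/-! ## The trace map `z ↦ z ^ q + z` and the right-hand side of the tower equation -/

/-- The additive polynomial `z ^ q + z`. -/
def trq {E : Type*} [Field E] (q : ℕ) (z : E) : E := z ^ q + z

/-- The right-hand side `z ^ q / (z ^ (q - 1) + 1)` of the tower equation. -/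
def gsMap {E : Type*} [Field E] (q : ℕ) (z : E) : E := z ^ q / (z ^ (q - 1) + 1)

theorem map_trq {E E' : Type*} [Field E] [Field E'] (φ : E →+* E') (q : ℕ) (z : E) :
    φ (trq q z) = trq q (φ z) := by simp [trq]

theorem map_gsMap {E E' : Type*} [Field E] [Field E'] (φ : E →+* E') (q : ℕ) (z : E) :
    φ (gsMap q z) = gsMap q (φ z) := by simp [gsMap]

/-! ### Trace and `gsMap` on the field with `q ^ 2` elements. -/

section FiniteFieldOfSquareOrder

variable {K : Type*} [Field K] {q : ℕ}

theorem exists_charP_of_card_eq_sq (hq : 2 ≤ q) [Finite K] (hK : Nat.card K = q ^ 2) :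
    ∃ p m : ℕ, p.Prime ∧ CharP K p ∧ m ≠ 0 ∧ q = p ^ m := by
  have := Fintype.ofFinite K
  obtain ⟨p, hp⟩ := CharP.exists K
  obtain ⟨n, hpp, hn⟩ := FiniteField.card K p
  rw [← Nat.card_eq_fintype_card, hK] at hn
  obtain ⟨m, -, hm⟩ := (Nat.dvd_prime_pow hpp).1 (hn ▸ dvd_pow_self q two_ne_zero)
  refine ⟨p, m, hpp, hp, ?_, hm⟩
  rintro rfl
  simp at hm
  omega

theorem add_pow_of_card_eq_sq (hq : 2 ≤ q) [Finite K] (hK : Nat.card K = q ^ 2)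
    {E : Type*} [Field E] [Algebra K E] (a b : E) : (a + b) ^ q = a ^ q + b ^ q := by
  obtain ⟨p, m, hp, hc, -, rfl⟩ := exists_charP_of_card_eq_sq hq hK
  have := Fact.mk hp
  have : CharP E p := charP_of_injective_algebraMap (algebraMap K E).injective p
  exact add_pow_char_pow a b p m

theorem sub_pow_of_card_eq_sq (hq : 2 ≤ q) [Finite K] (hK : Nat.card K = q ^ 2)
    {E : Type*} [Field E] [Algebra K E] (a b : E) : (a - b) ^ q = a ^ q - b ^ q := by
  have h := add_pow_of_card_eq_sq hq hK (a - b) b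
  rw [sub_add_cancel] at h
  rw [h, add_sub_cancel_right]

theorem trq_add (hq : 2 ≤ q) [Finite K] (hK : Nat.card K = q ^ 2)
    {E : Type*} [Field E] [Algebra K E] (a b : E) : trq q (a + b) = trq q a + trq q b := by
  simp only [trq, add_pow_of_card_eq_sq hq hK]; ring

theorem trq_sub (hq : 2 ≤ q) [Finite K] (hK : Nat.card K = q ^ 2)
    {E : Type*} [Field E] [Algebra K E] (a b : E) : trq q (a - b) = trq q a - trq q b := by
  simp only [trq, sub_pow_of_card_eq_sq hq hK]; ring

theorem pow_pow_of_card_eq_sq [Finite K] (hK : Nat.card K = q ^ 2) (a : K) :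
    (a ^ q) ^ q = a := by
  have := Fintype.ofFinite K
  have h := FiniteField.pow_card a
  rwa [← Nat.card_eq_fintype_card, hK, sq, pow_mul] at h

/-- Frobenius `z ↦ z ^ q` is an involution of `K`, so it swaps the two summands of the trace. -/
theorem trq_pow (hq : 2 ≤ q) [Finite K] (hK : Nat.card K = q ^ 2) (a : K) :
    trq q a ^ q = trq q a := by
  rw [trq, add_pow_of_card_eq_sq hq hK, pow_pow_of_card_eq_sq hK, add_comm]

open Polynomial in
theorem natDegree_X_pow_add_X_sub_C {E : Type*} [Field E] (hq : 2 ≤ q) (c : E) :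
    (X ^ q + X - C c : E[X]).natDegree = q ∧ (X ^ q + X - C c : E[X]).Monic := by
  have h : (X ^ q + X - C c : E[X]) = X ^ q + (X - C c) := by ring
  have hd : (X - C c : E[X]).degree < q := by
    rw [degree_X_sub_C]; exact_mod_cast hq
  rw [h]
  exact ⟨natDegree_eq_of_degree_eq_some (by
    rw [degree_add_eq_left_of_degree_lt (by rwa [degree_X_pow]), degree_X_pow]),
    monic_X_pow_add hd⟩

open Polynomial in
theorem ncard_trq_eq_le {E : Type*} [Field E] (hq : 2 ≤ q) (c : E) :
    {z : E | trq q z = c}.Finite ∧ {z : E | trq q z = c}.ncard ≤ q := by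
  classical
  obtain ⟨hd, hm⟩ := natDegree_X_pow_add_X_sub_C hq c
  have h : {z : E | trq q z = c} = ((X ^ q + X - C c : E[X]).roots.toFinset : Set E) := by
    ext z
    simp [trq, mem_roots hm.ne_zero, IsRoot, sub_eq_zero]
  rw [h, Set.ncard_coe_finset]
  exact ⟨Finset.finite_toSet _, (Multiset.toFinset_card_le _).trans ((card_roots' _).trans hd.le)⟩

open Polynomial in
theorem ncard_pow_eq_self_le {E : Type*} [Field E] (hq : 2 ≤ q) :
    {z : E | z ^ q = z}.Finite ∧ {z : E | z ^ q = z}.ncard ≤ q := by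
  classical
  have hd : (X : E[X]).degree < (q : ℕ) := by rw [degree_X]; exact_mod_cast hq
  have hm : (X ^ q - X : E[X]).Monic := monic_X_pow_sub hd
  have h : {z : E | z ^ q = z} = ((X ^ q - X : E[X]).roots.toFinset : Set E) := by
    ext z
    simp [mem_roots hm.ne_zero, IsRoot, sub_eq_zero]
  rw [h, Set.ncard_coe_finset]
  refine ⟨Finset.finite_toSet _, (Multiset.toFinset_card_le _).trans ((card_roots' _).trans ?_)⟩
  refine natDegree_le_of_degree_le ((degree_sub_le _ _).trans (max_le (degree_X_pow_le _) ?_))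
  exact hd.le

/-- The counting facts behind the trace map `K → 𝔽_q`: its range is all of `𝔽_q`, which has `q`
elements, and so has its kernel. -/
theorem trq_range_and_ker (hq : 2 ≤ q) [Finite K] (hK : Nat.card K = q ^ 2) :
    (∀ c : K, c ^ q = c → ∃ z : K, trq q z = c) ∧ {z : K | z ^ q = z}.ncard = q ∧
      {z : K | trq q z = 0}.ncard = q := by
  let Φ : K →+ K := AddMonoidHom.mk' (trq q) (trq_add hq hK)
  have hsub : Set.range (trq q : K → K) ⊆ {z : K | z ^ q = z} := by
    rintro _ ⟨z, rfl⟩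
    exact trq_pow hq hK z
  have hker : Nat.card Φ.ker = {z : K | trq q z = 0}.ncard := rfl
  have hran : Nat.card Φ.range = (Set.range (trq q : K → K)).ncard := rfl
  have hmul : Nat.card Φ.ker * Nat.card Φ.range = q ^ 2 := by
    rw [← hK, ← AddSubgroup.card_mul_index Φ.ker, AddSubgroup.index_ker]
  have h1 := (ncard_trq_eq_le hq (0 : K)).2
  have h2 := (ncard_pow_eq_self_le (E := K) hq).2
  have h3 := Set.ncard_le_ncard hsub (Set.toFinite _)
  rw [hker, hran] at hmul
  -- Kernel and range each have at most `q` elements and the product of their orders is `q ^ 2`, so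
  -- both bounds are equalities.
  have h4 : {z : K | trq q z = 0}.ncard = q := by nlinarith
  have h5 : (Set.range (trq q : K → K)).ncard = q := by
    rw [h4, sq] at hmul
    exact Nat.eq_of_mul_eq_mul_left (by omega) hmul
  have h6 : {z : K | z ^ q = z}.ncard = q := by omega
  refine ⟨fun c hc => ?_, h6, h4⟩
  have h7 := Set.eq_of_subset_of_ncard_le hsub (by omega) (Set.toFinite _)
  exact (h7 ▸ hc : c ∈ Set.range (trq q : K → K))

/-- A nonempty fibre is a translate of the kernel of the trace, and already `K` contains `q`
elements of that kernel. -/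
theorem ncard_trq_eq_of_mem (hq : 2 ≤ q) [Finite K] (hK : Nat.card K = q ^ 2)
    {E : Type*} [Field E] [Algebra K E] (z : E) : {y : E | trq q y = trq q z}.ncard = q := by
  apply le_antisymm (ncard_trq_eq_le hq _).2
  refine (trq_range_and_ker hq hK).2.2.ge.trans ?_
  refine Set.ncard_le_ncard_of_injOn (fun w : K => z + algebraMap K E w) ?_ ?_
    (ncard_trq_eq_le hq _).1
  · intro w hw
    simp only [Set.mem_ofPred_eq] at hw ⊢
    rw [trq_add hq hK, ← map_trq, hw, map_zero, add_zero]
  · intro a _ b _ h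
    exact (algebraMap K E).injective (add_left_cancel h)

theorem ncard_trq_eq (hq : 2 ≤ q) [Finite K] (hK : Nat.card K = q ^ 2) {c : K} (hc : c ^ q = c) :
    {y : K | trq q y = c}.ncard = q := by
  obtain ⟨z, rfl⟩ := (trq_range_and_ker hq hK).1 c hc
  exact ncard_trq_eq_of_mem hq hK z

open Polynomial in
/-- The polynomial `T ^ q + T - c` splits over `K` when `c` lies in `𝔽_q`. -/
theorem prod_sub_eq_trq_sub (hq : 2 ≤ q) [Finite K] (hK : Nat.card K = q ^ 2) {c : K}
    (hc : c ^ q = c) {E : Type*} [Field E] [Algebra K E] (y : E) :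
    ∏ b ∈ (Set.toFinite {z : K | trq q z = c}).toFinset, (y - algebraMap K E b)
      = trq q y - algebraMap K E c := by
  classical
  obtain ⟨hd, hm⟩ := natDegree_X_pow_add_X_sub_C hq c
  have hr : (X ^ q + X - C c : K[X]).roots.toFinset
      = (Set.toFinite {z : K | trq q z = c}).toFinset := by
    ext z
    simp [trq, mem_roots hm.ne_zero, IsRoot, sub_eq_zero]
  have hcard : (X ^ q + X - C c : K[X]).roots.toFinset.card = q := by
    rw [hr, ← Set.ncard_eq_toFinset_card, ncard_trq_eq hq hK hc]
  have hle := (card_roots' (X ^ q + X - C c : K[X])).trans hd.le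
  have hle' := Multiset.toFinset_card_le (X ^ q + X - C c : K[X]).roots
  have hroots : Multiset.card (X ^ q + X - C c : K[X]).roots = q := by omega
  have hnd : (X ^ q + X - C c : K[X]).roots.Nodup := by
    rw [← Multiset.dedup_eq_self]
    exact Multiset.eq_of_le_of_card_le (Multiset.dedup_le _) (by
      rw [hroots]; exact hcard.ge)
  have hp := prod_multiset_X_sub_C_of_monic_of_roots_card_eq hm (hroots.trans hd.symm)
  have := congrArg (aeval y) hp
  rw [map_multiset_prod, Multiset.map_map] at this
  rw [← hr, Finset.prod, Multiset.toFinset_val, hnd.dedup]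
  simpa [trq, Function.comp_def] using this

theorem gsMap_ne_zero {z : K} (hq : 2 ≤ q) (hz : trq q z ≠ 0) :
    z ≠ 0 ∧ z ^ (q - 1) + 1 ≠ 0 ∧ gsMap q z ≠ 0 := by
  have h : trq q z = z * (z ^ (q - 1) + 1) := by
    rw [trq, mul_add, mul_one, ← pow_succ', Nat.sub_add_cancel (by omega)]
  rw [h] at hz
  have h0 := left_ne_zero_of_mul hz
  have h1 := right_ne_zero_of_mul hz
  exact ⟨h0, h1, div_ne_zero (pow_ne_zero _ h0) h1⟩

/-- Inversion turns the right-hand side of the tower equation into a trace; this is why `gsMap`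
lands in 𝔽_q and why its nonzero fibres there have `q` elements. -/
theorem inv_gsMap (hq : 2 ≤ q) {z : K} (hz : z ≠ 0) : (gsMap q z)⁻¹ = trq q z⁻¹ := by
  rw [gsMap, trq, inv_div, inv_pow, add_div, one_div, add_comm]
  congr 1
  rw [div_eq_iff (pow_ne_zero _ hz), ← Nat.sub_add_cancel (by omega : 1 ≤ q), pow_succ',
    Nat.add_sub_cancel, inv_mul_cancel_left₀ hz]

theorem gsMap_pow (hq : 2 ≤ q) [Finite K] (hK : Nat.card K = q ^ 2) (z : K) :
    gsMap q z ^ q = gsMap q z := by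
  have hq0 : q ≠ 0 := by omega
  by_cases hz : z = 0
  · simp [hz, gsMap, hq0]
  · rw [← inv_inj, ← inv_pow, inv_gsMap hq hz, trq_pow hq hK]

/-- For `c ≠ 0` in `𝔽_q` there are exactly `q` elements with `gsMap q z = c`. -/
theorem ncard_gsMap_eq (hq : 2 ≤ q) [Finite K] (hK : Nat.card K = q ^ 2) {c : K} (hc : c ^ q = c)
    (hc0 : c ≠ 0) : {z : K | gsMap q z = c}.ncard = q := by
  refine Eq.trans ?_ (ncard_trq_eq hq hK (c := c⁻¹) (by rw [inv_pow, hc]))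
  rw [← Set.ncard_image_of_injective {z : K | gsMap q z = c} inv_injective]
  congr 1
  ext z
  simp only [Set.image_inv_eq_inv, Set.mem_inv, Set.mem_ofPred_eq]
  by_cases hz : z = 0
  · have hq0 : q ≠ 0 := by omega
    simp [hz, gsMap, trq, hq0, eq_comm, hc0]
  · rw [← inv_inj, inv_gsMap hq (inv_ne_zero hz), inv_inv]

theorem trq_ne_zero_of_gsMap_ne_zero (hq : 2 ≤ q) {z : K} (hz : gsMap q z ≠ 0) : trq q z ≠ 0 := by
  intro h
  apply hz
  have hq0 : q ≠ 0 := by omega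
  have h' : z * (z ^ (q - 1) + 1) = 0 := by
    rw [← h, trq, mul_add, mul_one, ← pow_succ', Nat.sub_add_cancel (by omega)]
  rcases mul_eq_zero.1 h' with h0 | h0
  · simp [gsMap, h0, hq0]
  · simp [gsMap, h0]

/-- There is `c ≠ 0` in `𝔽_q` such that no element has both trace `c` and `gsMap q z = 1`. -/
theorem exists_trq_ne_of_gsMap_eq_one (hq : 4 ≤ q) [Finite K] (hK : Nat.card K = q ^ 2) :
    ∃ c : K, c ^ q = c ∧ c ≠ 0 ∧ ∀ z : K, gsMap q z = 1 → trq q z ≠ c := by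
  classical
  have hq2 : 2 ≤ q := by omega
  -- A fourth element of 𝔽_q: `a ≠ 1` makes `b` below meaningful, `a ≠ 0` makes `a * b` nonzero, and
  -- `a ≠ 2` makes `a ≠ b`.
  have h1 : ({0, 1, 2} : Finset K).card < (Set.toFinite {z : K | z ^ q = z}).toFinset.card := by
    rw [← Set.ncard_eq_toFinset_card, (trq_range_and_ker hq2 hK).2.1]
    exact lt_of_le_of_lt Finset.card_le_three (by omega)
  obtain ⟨a, ha, ha'⟩ := Finset.exists_mem_notMem_of_card_lt_card h1
  simp only [Set.Finite.mem_toFinset, Set.mem_ofPred_eq] at ha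
  simp only [Finset.mem_insert, Finset.mem_singleton, not_or] at ha'
  obtain ⟨h0, h1, h2⟩ := ha'
  have ha1 : a - 1 ≠ 0 := sub_ne_zero.2 h1
  have ha1q : (a - 1) ^ q = a - 1 := by
    rw [sub_pow_of_card_eq_sq hq2 hK, ha, one_pow]
  -- If `gsMap q z = 1` then `z + z ^ q = z * z ^ q`, so trace and norm of `z` agree and `z` is a
  -- root of `T² - cT + c` with `c` its trace. Here `b` is chosen with `a + b = a * b`; for `c = a *
  -- b` the quadratic is `(T - a)(T - b)`, so `z` lies in 𝔽_q and `2z = a + b`, which forces `a =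
  -- b`.
  set b := a / (a - 1) with hb
  have hbq : b ^ q = b := by rw [hb, div_pow, ha, ha1q]
  have hab : a + b = a * b := by rw [hb]; field_simp; ring
  have hne : a ≠ b := by
    intro h
    rw [hb, eq_div_iff ha1] at h
    apply h2
    have : a - 1 = 1 := mul_left_cancel₀ h0 (by rw [h, mul_one])
    linear_combination this
  refine ⟨a * b, by rw [mul_pow, ha, hbq], mul_ne_zero h0 (div_ne_zero h0 ha1), ?_⟩
  intro z hz ht
  have hz0 : z ≠ 0 := by
    rintro rfl
    have hq0 : q ≠ 0 := by omega
    simp [gsMap, hq0] at hz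
  have h3 := inv_gsMap hq2 hz0
  rw [hz, inv_one, trq, inv_pow] at h3
  have hzq : z ^ q ≠ 0 := pow_ne_zero _ hz0
  have h4 : z + z ^ q = z * z ^ q := by
    field_simp at h3
    linear_combination -h3
  rw [trq] at ht
  have h5 : (z - a) * (z - b) = 0 := by linear_combination z * ht + h4 - ht - z * hab
  have h6 : z ^ q = z := by
    rcases mul_eq_zero.1 h5 with h | h
    · rw [sub_eq_zero.1 h, ha]
    · rw [sub_eq_zero.1 h, hbq]
  rw [h6] at ht
  apply hne
  rcases mul_eq_zero.1 h5 with h | h <;> rw [sub_eq_zero.1 h] at ht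
  · linear_combination ht - hab
  · linear_combination hab - ht

end FiniteFieldOfSquareOrder

/-! ## Valuations of the tower generators -/

section TowerValuations

variable {K : Type*} [Field K] {q : ℕ} {E : Type*} [Field E]
  {Γ₀ : Type*} [LinearOrderedCommGroupWithZero Γ₀] (v : Valuation E Γ₀)

theorem trq_eq_mul (hq : 2 ≤ q) (z : E) : trq q z = z * (z ^ (q - 1) + 1) := by
  rw [trq, mul_add, mul_one, ← pow_succ', Nat.sub_add_cancel (by omega)]

theorem valuation_trq_of_one_lt (hq : 2 ≤ q) {y : E} (hy : 1 < v y) :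
    v (trq q y) = v y ^ q := by
  rw [trq, Valuation.map_add_eq_of_lt_left, map_pow]
  rw [map_pow]
  exact lt_self_pow₀ hy (by omega)

theorem valuation_trq_le_one {y : E} (hy : v y ≤ 1) : v (trq q y) ≤ 1 :=
  v.map_add_le (by rw [map_pow]; exact pow_le_one₀ zero_le hy) hy

theorem valuation_le_one_of_trq (hq : 2 ≤ q) {y : E} (hy : v (trq q y) ≤ 1) : v y ≤ 1 := by
  by_contra! h
  rw [valuation_trq_of_one_lt v hq h] at hy
  exact absurd hy (not_le.2 (one_lt_pow₀ h (by omega)))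

theorem valuation_pow_eq_of_one_lt_trq (hq : 2 ≤ q) {y : E} (hy : 1 < v (trq q y)) :
    1 < v y ∧ v y ^ q = v (trq q y) := by
  have h : 1 < v y := by
    by_contra! h
    exact absurd hy (not_lt.2 (valuation_trq_le_one v h))
  exact ⟨h, (valuation_trq_of_one_lt v hq h).symm⟩

/-- At a pole, numerator and denominator behave like `z ^ q` and `z ^ (q - 1)`, so the pole order is
unchanged; this lets ramification propagate up the tower. -/
theorem valuation_gsMap_of_one_lt (hq : 2 ≤ q) {z : E} (hz : 1 < v z) :
    v (gsMap q z) = v z := by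
  have h0 : v z ≠ 0 := (zero_lt_one.trans hz).ne'
  have hu : v (z ^ (q - 1) + 1) = v z ^ (q - 1) := by
    rw [Valuation.map_add_eq_of_lt_left, map_pow]
    rw [map_pow, map_one]
    exact one_lt_pow₀ hz (by omega)
  rw [gsMap, map_div₀, hu, map_pow, div_eq_iff (pow_ne_zero _ h0), ← pow_succ',
    Nat.sub_add_cancel (by omega)]

theorem valuation_eq_one_of_lt (hq : 2 ≤ q) {z : E} (hz : v (z ^ (q - 1) + 1) < 1) : v z = 1 := by
  have h : v (z ^ (q - 1)) = 1 := by
    have h1 : z ^ (q - 1) = (z ^ (q - 1) + 1) - 1 := by ring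
    rw [h1, Valuation.map_sub_eq_of_lt_right, map_one]
    rwa [map_one]
  rw [map_pow] at h
  exact (pow_eq_one_iff_of_nonneg zero_le (by omega)).1 h

theorem valuation_gsMap_of_lt (hq : 2 ≤ q) {z : E} (hz : v (z ^ (q - 1) + 1) < 1) :
    v (gsMap q z) = (v (z ^ (q - 1) + 1))⁻¹ := by
  rw [gsMap, map_div₀, map_pow, valuation_eq_one_of_lt v hq hz, one_pow, one_div]

theorem valuation_pow_add_one_of_lt (hq : 2 ≤ q) {z : E} (hz : v z < 1) :
    v (z ^ (q - 1) + 1) = 1 := by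
  rw [Valuation.map_add_eq_of_lt_right, map_one]
  rw [map_pow, map_one]
  exact pow_lt_one₀ zero_le hz (by omega)

theorem valuation_gsMap_of_pow_add_one {z : E} (hz : v (z ^ (q - 1) + 1) = 1) :
    v (gsMap q z) = v z ^ q := by
  rw [gsMap, map_div₀, map_pow, hz, div_one]

theorem valuation_pow_add_one_le {z : E} (hz : v z ≤ 1) : v (z ^ (q - 1) + 1) ≤ 1 :=
  v.map_add_le (by rw [map_pow]; exact pow_le_one₀ zero_le hz) (by rw [map_one])

/-! ### Ramification behaviour of the generators. -/

variable {x₀ x₁ x₂ : E}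

/-- Total ramification: a pole of `gsMap` on the right forces a pole of the next generator whose
`q`-th power has the same value, twice over. -/
theorem valuation_at_infinity (hq : 2 ≤ q) (h₁ : trq q x₁ = gsMap q x₀)
    (h₂ : trq q x₂ = gsMap q x₁) (hv : 1 < v x₀) :
    1 < v x₂ ∧ v x₁ = v x₂ ^ q ∧ v x₀ = v x₂ ^ (q * q) := by
  have h := valuation_pow_eq_of_one_lt_trq v hq (y := x₁) (by
    rwa [h₁, valuation_gsMap_of_one_lt v hq hv])
  rw [h₁, valuation_gsMap_of_one_lt v hq hv] at h
  have h' := valuation_pow_eq_of_one_lt_trq v hq (y := x₂) (by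
    rw [h₂, valuation_gsMap_of_one_lt v hq h.1]; exact h.1)
  rw [h₂, valuation_gsMap_of_one_lt v hq h.1] at h'
  exact ⟨h'.1, h'.2.symm, by rw [pow_mul, h'.2, h.2]⟩

/-- Here `x₀` is a unit but the denominator of `gsMap q x₀` vanishes, so the ramification is as at
infinity, with `(x₀ ^ (q - 1) + 1)⁻¹` in the role of `x₀`. -/
theorem valuation_at_root (hq : 2 ≤ q) (h₁ : trq q x₁ = gsMap q x₀)
    (h₂ : trq q x₂ = gsMap q x₁) (hx : x₀ ^ (q - 1) + 1 ≠ 0) (hv : v (x₀ ^ (q - 1) + 1) < 1) :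
    1 < v x₂ ∧ v x₁ = v x₂ ^ q ∧ (v (x₀ ^ (q - 1) + 1))⁻¹ = v x₂ ^ (q * q) := by
  have h0 : v (x₀ ^ (q - 1) + 1) ≠ 0 := (Valuation.ne_zero_iff _).2 hx
  have h := valuation_pow_eq_of_one_lt_trq v hq (y := x₁) (by
    rw [h₁, valuation_gsMap_of_lt v hq hv]; exact (one_lt_inv₀ (zero_lt_iff.2 h0)).2 hv)
  rw [h₁, valuation_gsMap_of_lt v hq hv] at h
  have h' := valuation_pow_eq_of_one_lt_trq v hq (y := x₂) (by
    rw [h₂, valuation_gsMap_of_one_lt v hq h.1]; exact h.1)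
  rw [h₂, valuation_gsMap_of_one_lt v hq h.1] at h'
  exact ⟨h'.1, h'.2.symm, by rw [pow_mul, h'.2, h.2]⟩

/-- Since `x₁ * (x₁ ^ (q - 1) + 1)` has the value of `x₀ ^ q`, there is a dichotomy. Either `x₁ ^ (q
- 1) + 1` is a unit and `x₂` is integral, or it vanishes, `x₁` is a unit, and `x₂ ^ q` has the value
of `x₀ ^ (-q)`. -/
theorem valuation_at_zero (hq : 2 ≤ q) (h₁ : trq q x₁ = gsMap q x₀)
    (h₂ : trq q x₂ = gsMap q x₁) (hx : x₀ ≠ 0) (hv : v x₀ < 1) :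
    v x₁ ≤ 1 ∧ (v x₁ < 1 → v x₂ ≤ 1) ∧ v x₂ * v x₀ ≤ 1 := by
  have h0 : v x₀ ≠ 0 := (Valuation.ne_zero_iff _).2 hx
  have ht : v (trq q x₁) = v x₀ ^ q := by
    rw [h₁, valuation_gsMap_of_pow_add_one v (valuation_pow_add_one_of_lt v hq hv)]
  have h1 : v x₁ ≤ 1 := valuation_le_one_of_trq v hq (by
    rw [ht]; exact pow_le_one₀ zero_le hv.le)
  have h2 : v (x₁ ^ (q - 1) + 1) = 1 → v x₂ ≤ 1 := fun h => valuation_le_one_of_trq v hq (by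
    rw [h₂, valuation_gsMap_of_pow_add_one v h]; exact pow_le_one₀ zero_le h1)
  refine ⟨h1, fun h => h2 (valuation_pow_add_one_of_lt v hq h), ?_⟩
  rcases (valuation_pow_add_one_le v (q := q) h1).eq_or_lt with h | h
  · exact mul_le_one₀ (h2 h) zero_le hv.le
  · have h3 := valuation_eq_one_of_lt v hq h
    rw [trq_eq_mul hq, map_mul, h3, one_mul] at ht
    have h4 := valuation_gsMap_of_lt v hq h
    have h5 := valuation_pow_eq_of_one_lt_trq v hq (y := x₂) (by
      rw [h₂, h4, ht]
      exact (one_lt_inv₀ (zero_lt_iff.2 (pow_ne_zero _ h0))).2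
        (pow_lt_one₀ zero_le hv (by omega)))
    rw [h₂, h4, ht] at h5
    have h6 : (v x₂ * v x₀) ^ q = 1 := by
      rw [mul_pow, h5.2, inv_mul_cancel₀ (pow_ne_zero _ h0)]
    exact ((pow_eq_one_iff_of_nonneg zero_le (by omega)).1 h6).le

/-- The trace of `x₁` is a unit and the product of two integral factors `x₁` and `x₁ ^ (q - 1) + 1`,
so the denominator in the second equation is a unit. -/
theorem valuation_at_regular (hq : 2 ≤ q) (h₁ : trq q x₁ = gsMap q x₀)
    (h₂ : trq q x₂ = gsMap q x₁) (hv : v x₀ = 1) (hu : v (x₀ ^ (q - 1) + 1) = 1) :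
    v x₁ ≤ 1 ∧ v x₂ ≤ 1 := by
  have ht : v (trq q x₁) = 1 := by
    rw [h₁, valuation_gsMap_of_pow_add_one v hu, hv, one_pow]
  have h1 : v x₁ ≤ 1 := valuation_le_one_of_trq v hq ht.le
  refine ⟨h1, valuation_le_one_of_trq v hq ?_⟩
  have h2 := valuation_pow_add_one_le v (q := q) h1
  rw [trq_eq_mul hq, map_mul] at ht
  have h3 : v (x₁ ^ (q - 1) + 1) = 1 := by
    refine h2.antisymm ?_
    rw [← ht]
    exact mul_le_of_le_one_left' h1
  rw [h₂, valuation_gsMap_of_pow_add_one v h3]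
  exact pow_le_one₀ zero_le h1

/-! ### Polynomials in the tower generators -/

variable [Algebra K E]

/-- The function with coefficients `a` in the monomials `x₀ ^ i * x₁ ^ j * x₂ ^ k` with `i ≤ q`,
`j ≤ q - 1` and `k ≤ q - 2`. -/
def towerFun (q : ℕ) (a : Fin (q + 1) × Fin q × Fin (q - 1) → K) (x₀ x₁ x₂ : E) : E :=
  ∑ i, algebraMap K E (a i) * (x₀ ^ (i.1 : ℕ) * x₁ ^ (i.2.1 : ℕ) * x₂ ^ (i.2.2 : ℕ))

theorem map_towerFun {E' : Type*} [Field E'] [Algebra K E'] (φ : E →ₐ[K] E')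
    (a : Fin (q + 1) × Fin q × Fin (q - 1) → K) (x₀ x₁ x₂ : E) :
    φ (towerFun q a x₀ x₁ x₂) = towerFun q a (φ x₀) (φ x₁) (φ x₂) := by
  simp [towerFun]

variable (a : Fin (q + 1) × Fin q × Fin (q - 1) → K)

theorem valuation_towerFun_le (hK : ∀ c : K, v (algebraMap K E c) ≤ 1) {g : Γ₀}
    (h : ∀ i j k : ℕ, i ≤ q → j ≤ q - 1 → k ≤ q - 2 → v x₀ ^ i * v x₁ ^ j * v x₂ ^ k ≤ g) :
    v (towerFun q a x₀ x₁ x₂) ≤ g := by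
  refine v.map_sum_le fun i _ => ?_
  simp only [map_mul, map_pow]
  refine (mul_le_of_le_one_left' (hK _)).trans (h _ _ _ ?_ ?_ ?_) <;> omega

/-- In terms of `v x₂` the worst monomial is `x₀ ^ q * x₁ ^ (q - 1) * x₂ ^ (q - 2)`. The power `q *
q` expresses the bound through `v x₀`, avoiding roots in the value group. -/
theorem valuation_towerFun_at_infinity (hK : ∀ c : K, v (algebraMap K E c) ≤ 1)
    (hq : 2 ≤ q) (h₁ : trq q x₁ = gsMap q x₀)
    (h₂ : trq q x₂ = gsMap q x₁) (hv : 1 < v x₀) :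
    v (towerFun q a x₀ x₁ x₂) ^ (q * q) ≤ v x₀ ^ (q * q * q + q * (q - 1) + (q - 2)) := by
  obtain ⟨ht, hx₁, hx₀⟩ := valuation_at_infinity v hq h₁ h₂ hv
  have h : v (towerFun q a x₀ x₁ x₂) ≤ v x₂ ^ (q * q * q + q * (q - 1) + (q - 2)) := by
    refine valuation_towerFun_le v a hK fun i j k hi hj hk => ?_
    rw [hx₁, hx₀, ← pow_mul, ← pow_mul, ← pow_add, ← pow_add]
    exact pow_le_pow_right₀ ht.le (by gcongr)
  calc _ ≤ (v x₂ ^ (q * q * q + q * (q - 1) + (q - 2))) ^ (q * q) := pow_le_pow_left₀ zero_le h _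
    _ = _ := by rw [hx₀, ← pow_mul, ← pow_mul, mul_comm]

theorem valuation_towerFun_at_root (hK : ∀ c : K, v (algebraMap K E c) ≤ 1)
    (hq : 2 ≤ q) (h₁ : trq q x₁ = gsMap q x₀)
    (h₂ : trq q x₂ = gsMap q x₁) (hx : x₀ ^ (q - 1) + 1 ≠ 0) (hv : v (x₀ ^ (q - 1) + 1) < 1) :
    v (towerFun q a x₀ x₁ x₂) ^ (q * q) * v (x₀ ^ (q - 1) + 1) ^ (q * (q - 1) + (q - 2)) ≤ 1 := by
  have h0 : v (x₀ ^ (q - 1) + 1) ≠ 0 := (Valuation.ne_zero_iff _).2 hx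
  obtain ⟨ht, hx₁, hx₀⟩ := valuation_at_root v hq h₁ h₂ hx hv
  have h : v (towerFun q a x₀ x₁ x₂) ≤ v x₂ ^ (q * (q - 1) + (q - 2)) := by
    refine valuation_towerFun_le v a hK fun i j k hi hj hk => ?_
    rw [hx₁, valuation_eq_one_of_lt v hq hv, one_pow, one_mul, ← pow_mul, ← pow_add]
    exact pow_le_pow_right₀ ht.le (by gcongr)
  have h' : v (towerFun q a x₀ x₁ x₂) ^ (q * q)
      ≤ ((v (x₀ ^ (q - 1) + 1))⁻¹) ^ (q * (q - 1) + (q - 2)) :=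
    calc _ ≤ (v x₂ ^ (q * (q - 1) + (q - 2))) ^ (q * q) := pow_le_pow_left₀ zero_le h _
      _ = _ := by rw [hx₀, ← pow_mul, ← pow_mul, mul_comm]
  refine (mul_le_mul_left h' _).trans ?_
  rw [inv_pow, inv_mul_cancel₀ (pow_ne_zero _ h0)]

/-- Only `x₂` can have a pole here, of size at most `(v x₀)⁻¹` and with exponent at most `q - 2`; it
has none when `x₁` vanishes. -/
theorem valuation_towerFun_at_zero (hK : ∀ c : K, v (algebraMap K E c) ≤ 1)
    (hq : 2 ≤ q) (h₁ : trq q x₁ = gsMap q x₀)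
    (h₂ : trq q x₂ = gsMap q x₁) (hx : x₀ ≠ 0) (hv : v x₀ < 1) :
    (v x₁ < 1 → v (towerFun q a x₀ x₁ x₂) ≤ 1) ∧
      v (towerFun q a x₀ x₁ x₂) * v x₀ ^ (q - 2) ≤ 1 := by
  have h0 : v x₀ ≠ 0 := (Valuation.ne_zero_iff _).2 hx
  obtain ⟨hx₁, h, hx₂⟩ := valuation_at_zero v hq h₁ h₂ hx hv
  constructor
  · intro hlt
    refine valuation_towerFun_le v a hK fun i j k hi hj hk => ?_
    exact mul_le_one₀ (mul_le_one₀ (pow_le_one₀ zero_le hv.le) zero_le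
      (pow_le_one₀ zero_le hx₁)) zero_le (pow_le_one₀ zero_le (h hlt))
  · have h' : v (towerFun q a x₀ x₁ x₂) ≤ (v x₀ ^ (q - 2))⁻¹ := by
      refine valuation_towerFun_le v a hK fun i j k hi hj hk => ?_
      refine (mul_le_of_le_one_left' (mul_le_one₀ (pow_le_one₀ zero_le hv.le) zero_le
        (pow_le_one₀ zero_le hx₁))).trans ?_
      have h1 : v x₂ ≤ (v x₀)⁻¹ := (le_mul_inv_iff₀ (zero_lt_iff.2 h0)).2 hx₂ |>.trans_eq
        (one_mul _)
      rw [← inv_pow]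
      exact (pow_le_pow_left₀ zero_le h1 _).trans
        (pow_le_pow_right₀ ((one_le_inv₀ (zero_lt_iff.2 h0)).2 hv.le) hk)
    refine (mul_le_mul_left h' _).trans ?_
    rw [inv_mul_cancel₀ (pow_ne_zero _ h0)]

theorem valuation_towerFun_le_one (hK : ∀ c : K, v (algebraMap K E c) ≤ 1)
    (hx₀ : v x₀ ≤ 1) (hx₁ : v x₁ ≤ 1) (hx₂ : v x₂ ≤ 1) :
    v (towerFun q a x₀ x₁ x₂) ≤ 1 :=
  valuation_towerFun_le v a hK fun _ _ _ _ _ _ =>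
    mul_le_one₀ (mul_le_one₀ (pow_le_one₀ zero_le hx₀) zero_le
      (pow_le_one₀ zero_le hx₁)) zero_le (pow_le_one₀ zero_le hx₂)

/-! ### Constants, residue classes and congruences along the tower. -/

theorem valuation_algebraMap_eq_one (hK : ∀ c : K, v (algebraMap K E c) ≤ 1)
    {c : K} (hc : c ≠ 0) : v (algebraMap K E c) = 1 := by
  refine (hK c).antisymm ?_
  have h := hK c⁻¹
  rw [map_inv₀, map_inv₀] at h
  have h0 : v (algebraMap K E c) ≠ 0 := by
    rw [Valuation.ne_zero_iff]; exact (map_ne_zero _).2 hc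
  exact (inv_le_one₀ (zero_lt_iff.2 h0)).1 h

theorem eq_of_valuation_sub_lt_one (hK : ∀ c : K, v (algebraMap K E c) ≤ 1)
    {c d : K} {y : E} (hc : v (y - algebraMap K E c) < 1)
    (hd : v (y - algebraMap K E d) < 1) : c = d := by
  by_contra h
  have h1 := valuation_algebraMap_eq_one v hK (sub_ne_zero.2 h)
  have h2 : algebraMap K E (c - d) = (y - algebraMap K E d) - (y - algebraMap K E c) := by
    rw [map_sub]; ring
  rw [h2] at h1
  exact absurd h1 (v.map_sub_lt hd hc).ne

theorem valuation_le_one_of_sub (hK : ∀ c : K, v (algebraMap K E c) ≤ 1)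
    {c : K} {y : E} (hc : v (y - algebraMap K E c) ≤ 1) :
    v y ≤ 1 := by
  have h := v.map_add_le hc (hK c)
  rwa [sub_add_cancel] at h

/-- The valuation of a difference of products. -/
theorem valuation_mul_sub_mul_le (hK : ∀ c : K, v (algebraMap K E c) ≤ 1)
    {g : Γ₀} {y z : E} {c d : K}
    (hz : v z ≤ 1) (hy : v (y - algebraMap K E c) ≤ g)
    (hzd : v (z - algebraMap K E d) ≤ g) : v (y * z - algebraMap K E (c * d)) ≤ g := by
  have h : y * z - algebraMap K E (c * d)
      = (y - algebraMap K E c) * z + algebraMap K E c * (z - algebraMap K E d) := by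
    rw [map_mul]; ring
  rw [h]
  refine v.map_add_le ?_ ?_
  · rw [map_mul]
    exact (mul_le_of_le_one_right' hz).trans hy
  · rw [map_mul]
    exact (mul_le_of_le_one_left' (hK c)).trans hzd

theorem valuation_pow_sub_pow_le (hK : ∀ c : K, v (algebraMap K E c) ≤ 1)
    {g : Γ₀} {y : E} {c : K} (hy1 : v y ≤ 1)
    (hy : v (y - algebraMap K E c) ≤ g) (n : ℕ) : v (y ^ n - algebraMap K E (c ^ n)) ≤ g := by
  induction n with
  | zero => simp
  | succ n ih =>
    rw [pow_succ, pow_succ]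
    exact valuation_mul_sub_mul_le v hK hy1 ih hy

/-- A polynomial in the tower generators is congruent to its value. -/
theorem valuation_towerFun_sub_le (hK : ∀ c : K, v (algebraMap K E c) ≤ 1) {g : Γ₀} {c₀ c₁ c₂ : K}
    (hg : g ≤ 1) (h₀ : v (x₀ - algebraMap K E c₀) ≤ g) (h₁ : v (x₁ - algebraMap K E c₁) ≤ g)
    (h₂ : v (x₂ - algebraMap K E c₂) ≤ g) :
    v (towerFun q a x₀ x₁ x₂ - algebraMap K E (towerFun q a c₀ c₁ c₂)) ≤ g := by
  have h₀' := valuation_le_one_of_sub v hK (h₀.trans hg)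
  have h₁' := valuation_le_one_of_sub v hK (h₁.trans hg)
  have h₂' := valuation_le_one_of_sub v hK (h₂.trans hg)
  rw [towerFun, towerFun, map_sum, ← Finset.sum_sub_distrib]
  refine v.map_sum_le fun i _ => ?_
  rw [map_mul, Algebra.algebraMap_self_apply, ← mul_sub, map_mul]
  refine (mul_le_of_le_one_left' (hK _)).trans ?_
  refine valuation_mul_sub_mul_le v hK ?_ (valuation_mul_sub_mul_le v hK ?_ ?_ ?_) ?_
  · rw [map_pow]; exact pow_le_one₀ zero_le h₂'
  · rw [map_pow]; exact pow_le_one₀ zero_le h₁'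
  all_goals exact valuation_pow_sub_pow_le v hK (by assumption) (by assumption) _

/-- If `trq q y` has a residue class in `𝔽_q`, then `y` has a residue class in `K`. -/
theorem exists_residue_of_trq (hq : 2 ≤ q) [Finite K] (hcard : Nat.card K = q ^ 2) {c : K}
    (hc : c ^ q = c) {y : E} (hy : v (trq q y - algebraMap K E c) < 1) :
    ∃ b : K, trq q b = c ∧ v (y - algebraMap K E b) < 1 := by
  -- `T ^ q + T - c` splits over `K`; a product of value below one has a factor of value below one.
  rw [← prod_sub_eq_trq_sub hq hcard hc, map_prod] at hy
  by_contra! h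
  refine absurd hy (not_lt.2 (Finset.one_le_prod' fun b hb => h b ?_))
  simpa using hb

/-- For `w = y - b` of value below one, `trq q w = w * (w ^ (q - 1) + 1)` and the second factor is a
unit: the trace polynomial is étale. -/
theorem valuation_sub_eq_trq_sub (hq : 2 ≤ q) [Finite K] (hcard : Nat.card K = q ^ 2) {b : K}
    {y : E} (hy : v (y - algebraMap K E b) < 1) :
    v (y - algebraMap K E b) = v (trq q y - algebraMap K E (trq q b)) := by
  rw [map_trq, ← trq_sub hq hcard, trq_eq_mul hq, map_mul,
    valuation_pow_add_one_of_lt v hq hy, mul_one]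

/-- `gsMap` is a rational function without a pole at `c`: its denominator is nonzero there because
the trace of `c` is. -/
theorem valuation_gsMap_sub_le (hK : ∀ c : K, v (algebraMap K E c) ≤ 1)
    (hq : 2 ≤ q) {c : K} (hc : trq q c ≠ 0) {y : E}
    (hy : v (y - algebraMap K E c) < 1) :
    v (gsMap q y - algebraMap K E (gsMap q c)) ≤ v (y - algebraMap K E c) := by
  obtain ⟨-, hu, -⟩ := gsMap_ne_zero hq hc
  have hy1 := valuation_le_one_of_sub v hK hy.le
  have hp := fun n => valuation_pow_sub_pow_le v hK hy1 (le_refl (v (y - algebraMap K E c))) n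
  have hu1 := valuation_algebraMap_eq_one v hK hu
  have hu2 : v (y ^ (q - 1) + 1) = 1 := by
    have : y ^ (q - 1) + 1 = (y ^ (q - 1) - algebraMap K E (c ^ (q - 1)))
      + algebraMap K E (c ^ (q - 1) + 1) := by rw [map_add, map_one]; ring
    rw [this, Valuation.map_add_eq_of_lt_right, hu1]
    rw [hu1]
    exact (hp _).trans_lt hy
  have hu0 : y ^ (q - 1) + 1 ≠ 0 := by
    rw [← Valuation.ne_zero_iff v, hu2]; exact one_ne_zero
  have hu0' : algebraMap K E (c ^ (q - 1) + 1) ≠ 0 := (map_ne_zero _).2 hu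
  have : gsMap q y - algebraMap K E (gsMap q c)
      = ((y ^ q - algebraMap K E (c ^ q)) * algebraMap K E (c ^ (q - 1) + 1)
        - algebraMap K E (c ^ q) * (y ^ (q - 1) - algebraMap K E (c ^ (q - 1))))
        / ((y ^ (q - 1) + 1) * algebraMap K E (c ^ (q - 1) + 1)) := by
    rw [gsMap, gsMap, map_div₀, div_sub_div _ _ hu0 hu0']
    congr 1
    simp only [map_add, map_one]
    ring
  rw [this, map_div₀, map_mul, hu1, hu2, one_mul, div_one]
  refine v.map_sub_le ?_ ?_
  · rw [map_mul]; exact (mul_le_of_le_one_right' (hK _)).trans (hp _)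
  · rw [map_mul]; exact (mul_le_of_le_one_left' (hK _)).trans (hp _)

/-- If `y` is congruent to `b` and `x` to `c` with `trq q y = gsMap q x`, then the first
congruence is at least as good as the second one. -/
theorem valuation_sub_le_of_tower_eq (hK : ∀ c : K, v (algebraMap K E c) ≤ 1)
    (hq : 2 ≤ q) [Finite K] (hcard : Nat.card K = q ^ 2)
    {b c : K} (hc : trq q c ≠ 0) (hbc : trq q b = gsMap q c) {x y : E} (hxy : trq q y = gsMap q x)
    (hx : v (x - algebraMap K E c) < 1) (hy : v (y - algebraMap K E b) < 1) :
    v (y - algebraMap K E b) ≤ v (x - algebraMap K E c) := by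
  rw [valuation_sub_eq_trq_sub v hq hcard hy, hbc, hxy]
  exact valuation_gsMap_sub_le v hK hq hc hx

theorem exists_residue_of_tower_eq (hK : ∀ c : K, v (algebraMap K E c) ≤ 1)
    (hq : 2 ≤ q) [Finite K] (hcard : Nat.card K = q ^ 2)
    {c : K} (hc : trq q c ≠ 0) {x y : E} (hxy : trq q y = gsMap q x)
    (hx : v (x - algebraMap K E c) < 1) :
    ∃ b : K, trq q b = gsMap q c ∧ v (y - algebraMap K E b) < 1 :=
  exists_residue_of_trq v hq hcard (gsMap_pow hq hcard c) (by
    rw [hxy]; exact (valuation_gsMap_sub_le v hK hq hc hx).trans_lt hx)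

end TowerValuations

/-! ## Valuation rings over places of the rational function field -/

section RationalPlaces

open Polynomial

variable {K : Type*} [Field K] {E : Type*} [Field E] [Algebra K E]

/-- A non-unit polynomial in a transcendental element `t` is a non-unit of some valuation ring
containing `K` and `t`. -/
theorem exists_valuationSubring_of_not_isUnit {t : E} (ht : Transcendental K t) {p : K[X]}
    (hp : ¬IsUnit p) : ∃ W : ValuationSubring E, (∀ c : K, W.valuation (algebraMap K E c) ≤ 1) ∧
      W.valuation t ≤ 1 ∧ W.valuation (aeval t p) < 1 := by
  let A : Subring E := (aeval t : K[X] →ₐ[K] E).range.toSubring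
  have hA : ∀ r : K[X], aeval t r ∈ A := fun r => ⟨r, rfl⟩
  -- The ideal generated by `p(t)` in `K[t]` is proper, as `t` is transcendental and `p` is not a
  -- unit; a valuation ring of `E` therefore contains `K[t]` and has the ideal among its nonunits.
  obtain ⟨W, hW, hI⟩ := Ideal.image_subset_nonunits_valuationSubring
    (Ideal.span {(⟨aeval t p, hA p⟩ : A)}) (by
      rw [Ne, Ideal.span_singleton_eq_top]
      intro h
      obtain ⟨⟨_, r, rfl⟩, hr⟩ := isUnit_iff_exists_inv.1 h
      have hr' : aeval t p * aeval t r = 1 := congrArg Subtype.val hr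
      rw [← map_mul, ← map_one (aeval (R := K) t)] at hr'
      exact hp (IsUnit.of_mul_eq_one _ (transcendental_iff_injective.1 ht hr')))
  refine ⟨W, fun c => ?_, ?_, ?_⟩
  · rw [ValuationSubring.valuation_le_one_iff]
    simpa using hW (hA (C c))
  · rw [ValuationSubring.valuation_le_one_iff]
    simpa using hW (hA X)
  · rw [← ValuationSubring.mem_nonunits_iff]
    exact hI ⟨_, Ideal.subset_span rfl, rfl⟩

variable [Algebra (RatFunc K) E] [IsScalarTower K (RatFunc K) E]

theorem aeval_algebraMap_ratFunc_X (p : K[X]) :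
    aeval (algebraMap (RatFunc K) E RatFunc.X) p
      = algebraMap (RatFunc K) E (algebraMap K[X] (RatFunc K) p) := by
  rw [aeval_algebraMap_apply, ← RatFunc.algebraMap_X, aeval_algebraMap_apply, aeval_X_left_apply]

theorem transcendental_algebraMap_ratFunc_X :
    Transcendental K (algebraMap (RatFunc K) E RatFunc.X) := by
  rw [transcendental_iff]
  intro p hp
  rw [aeval_algebraMap_ratFunc_X, map_eq_zero] at hp
  exact (map_eq_zero_iff _ (RatFunc.algebraMap_injective K)).1 hp

/-- A pole of `x₀` is a zero of the transcendental element `x₀⁻¹`. -/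
theorem exists_valuationSubring_infty (K : Type*) [Field K] (E : Type*) [Field E] [Algebra K E]
    [Algebra (RatFunc K) E] [IsScalarTower K (RatFunc K) E] :
    ∃ W : ValuationSubring E, (∀ c : K, W.valuation (algebraMap K E c) ≤ 1) ∧
      1 < W.valuation (algebraMap (RatFunc K) E RatFunc.X) := by
  have ht : Transcendental K (algebraMap (RatFunc K) E RatFunc.X)⁻¹ := fun h =>
    transcendental_algebraMap_ratFunc_X (K := K) (E := E) (by simpa using h.inv)
  obtain ⟨W, h1, -, h2⟩ := exists_valuationSubring_of_not_isUnit ht (p := X) not_isUnit_X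
  refine ⟨W, h1, ?_⟩
  rw [aeval_X, map_inv₀] at h2
  refine (inv_lt_one₀ (zero_lt_iff.2 ?_)).1 h2
  rw [Valuation.ne_zero_iff, _root_.map_ne_zero]
  exact RatFunc.X_ne_zero

variable {Γ₀ : Type*} [LinearOrderedCommGroupWithZero Γ₀] (v : Valuation E Γ₀)

omit [Algebra (RatFunc K) E] [IsScalarTower K (RatFunc K) E] in
theorem valuation_aeval_le_one (hK : ∀ c : K, v (algebraMap K E c) ≤ 1) {x : E} (hx : v x ≤ 1)
    (p : K[X]) : v (aeval x p) ≤ 1 := by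
  rw [aeval_eq_sum_range]
  refine v.map_sum_le fun i _ => ?_
  rw [Algebra.smul_def, map_mul, map_pow]
  exact mul_le_one₀ (hK _) zero_le (pow_le_one₀ zero_le hx)

omit [Algebra (RatFunc K) E] [IsScalarTower K (RatFunc K) E] in
theorem valuation_aeval_of_one_lt (hK : ∀ c : K, v (algebraMap K E c) ≤ 1) {x : E} (hx : 1 < v x)
    {p : K[X]} (hp : p ≠ 0) : v (aeval x p) = v x ^ p.natDegree := by
  have hlc : v (algebraMap K E p.leadingCoeff * x ^ p.natDegree) = v x ^ p.natDegree := by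
    rw [map_mul, valuation_algebraMap_eq_one v hK (leadingCoeff_ne_zero.2 hp), one_mul, map_pow]
  rw [aeval_eq_sum_range, Finset.sum_range_succ, Algebra.smul_def (p.coeff p.natDegree),
    coeff_natDegree, Valuation.map_add_eq_of_lt_right, hlc]
  rw [hlc]
  refine v.map_sum_lt (pow_ne_zero _ (zero_lt_one.trans hx).ne') fun i hi => ?_
  rw [Algebra.smul_def, map_mul, map_pow]
  exact (mul_le_of_le_one_left' (hK _)).trans_lt (pow_lt_pow_right₀ hx (Finset.mem_range.1 hi))

omit [Algebra (RatFunc K) E] [IsScalarTower K (RatFunc K) E] in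
theorem valuation_aeval_eq_one_of_isCoprime (hK : ∀ c : K, v (algebraMap K E c) ≤ 1) {x : E}
    (hx : v x ≤ 1) {p r : K[X]} (hpr : IsCoprime p r) (hp : v (aeval x p) < 1) :
    v (aeval x r) = 1 := by
  obtain ⟨a, b, hab⟩ := hpr
  refine (valuation_aeval_le_one v hK hx r).antisymm ?_
  by_contra! h
  have h1 := congrArg (fun z => v (aeval x z)) hab
  simp only [map_add, map_mul, map_one] at h1
  refine absurd h1 (ne_of_lt (v.map_add_lt ?_ ?_))
  · rw [map_mul]
    exact (mul_le_of_le_one_left' (valuation_aeval_le_one v hK hx _)).trans_lt hp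
  · rw [map_mul]
    exact (mul_le_of_le_one_left' (valuation_aeval_le_one v hK hx _)).trans_lt h

/-- A rational function that is integral at all finite places is a polynomial. -/
theorem ratFunc_eq_polynomial_of_valuation_le_one (f : RatFunc K)
    (hf : ∀ W : ValuationSubring E, (∀ c : K, W.valuation (algebraMap K E c) ≤ 1) →
      W.valuation (algebraMap (RatFunc K) E RatFunc.X) ≤ 1 →
      W.valuation (algebraMap (RatFunc K) E f) ≤ 1) :
    ∃ p : K[X], f = algebraMap K[X] (RatFunc K) p := by
  by_cases hd : IsUnit f.denom
  · have h1 : f.denom = 1 := (RatFunc.monic_denom f).eq_one_of_isUnit hd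
    refine ⟨f.num, ?_⟩
    conv_lhs => rw [← RatFunc.num_div_denom f, h1, map_one, div_one]
  · exfalso
    -- A nonconstant denominator vanishes at some `W`, where by coprimality the numerator is a unit;
    -- so `f` would have a pole there.
    obtain ⟨W, hK, hx, hlt⟩ := exists_valuationSubring_of_not_isUnit
      (transcendental_algebraMap_ratFunc_X (K := K) (E := E)) hd
    have h1 := valuation_aeval_eq_one_of_isCoprime W.valuation hK hx
      (RatFunc.isCoprime_num_denom f).symm hlt
    have h2 := hf W hK hx
    have h3 : algebraMap (RatFunc K) E f * aeval (algebraMap (RatFunc K) E RatFunc.X) f.denom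
        = aeval (algebraMap (RatFunc K) E RatFunc.X) f.num := by
      rw [aeval_algebraMap_ratFunc_X, aeval_algebraMap_ratFunc_X, ← map_mul]
      congr 1
      have h0 := (map_ne_zero_iff _ (RatFunc.algebraMap_injective K)).2 (RatFunc.denom_ne_zero f)
      rw [← eq_div_iff h0, RatFunc.num_div_denom f]
    have h4 := congrArg W.valuation h3
    rw [map_mul, h1] at h4
    exact absurd h4 (ne_of_lt ((mul_le_of_le_one_left' h2).trans_lt hlt))

-- If the nonzero terms have pairwise distinct values, the largest one cannot be cancelled.
omit [Algebra K E] [Algebra (RatFunc K) E] [IsScalarTower K (RatFunc K) E] in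
theorem eq_zero_of_sum_eq_zero_of_valuation {ι : Type*} [Fintype ι] (f : ι → E)
    (hf : ∀ i j, f i ≠ 0 → f j ≠ 0 → v (f i) = v (f j) → i = j) (h : ∑ i, f i = 0) (i : ι) :
    f i = 0 := by
  classical
  by_contra hi
  obtain ⟨j, hj, hmax⟩ := Finset.exists_max_image (Finset.univ.filter fun j => f j ≠ 0)
    (fun j => v (f j)) ⟨i, by simpa using hi⟩
  simp only [Finset.mem_filter, Finset.mem_univ, true_and] at hj hmax
  have hvj : v (f j) ≠ 0 := (Valuation.ne_zero_iff v).2 hj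
  rw [← Finset.add_sum_erase _ _ (Finset.mem_univ j)] at h
  have hlt : v (∑ k ∈ Finset.univ.erase j, f k) < v (f j) := by
    refine v.map_sum_lt hvj fun k hk => ?_
    by_cases hk0 : f k = 0
    · rw [hk0, map_zero]; exact zero_lt_iff.2 hvj
    · exact (hmax k hk0).lt_of_ne fun h' => (Finset.mem_erase.1 hk).1 (hf _ _ hk0 hj h')
  have := Valuation.map_add_eq_of_lt_left v hlt
  rw [h, map_zero] at this
  exact hvj this.symm

end RationalPlaces

/-! ## The field `F₂` over the rational function field -/

/-- `F` is the field `K(x₀, x₁, x₂)` of the Garcia-Stichtenoth tower. -/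
structure IsGSTower (K : Type*) [Field K] (q : ℕ) {F : Type*} [Field F] [Algebra (RatFunc K) F]
    (x₁ x₂ : F) : Prop where
  two_le : 2 ≤ q
  card_eq : Nat.card K = q ^ 2
  eq₁ : trq q x₁ = gsMap q (algebraMap (RatFunc K) F RatFunc.X)
  eq₂ : trq q x₂ = gsMap q x₁
  adjoin_eq : IntermediateField.adjoin (RatFunc K) {x₁, x₂} = ⊤

namespace IsGSTower

open Polynomial

variable {K : Type*} [Field K] {q : ℕ} {F : Type*} [Field F] [Algebra K F]
  [Algebra (RatFunc K) F] [IsScalarTower K (RatFunc K) F] {x₁ x₂ : F}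

/-- At a pole of `x₀`, with `t` the value of `x₂`, a nonzero coefficient has value a power of `t ^
(q * q)`, while `x₁ ^ i * x₂ ^ j` has value `t ^ (q * i + j)` with `q * i + j < q * q`. Nonzero
terms thus have different exponents modulo `q * q`. -/
theorem eq_zero_of_sum_eq_zero (H : IsGSTower K q x₁ x₂) (c : Fin q × Fin q → RatFunc K)
    (hc : ∑ i, algebraMap (RatFunc K) F (c i) * (x₁ ^ (i.1 : ℕ) * x₂ ^ (i.2 : ℕ)) = 0)
    (i : Fin q × Fin q) : c i = 0 := by
  obtain ⟨W, hK, hx⟩ := exists_valuationSubring_infty K F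
  set v := W.valuation
  obtain ⟨ht, h₁, h₀⟩ := valuation_at_infinity v H.two_le H.eq₁ H.eq₂ hx
  set t := v x₂
  have ht0 : t ≠ 0 := (zero_lt_one.trans ht).ne'
  -- The denominator is kept on the left so that all exponents are natural numbers.
  have hv : ∀ j : Fin q × Fin q, c j ≠ 0 →
      v (algebraMap (RatFunc K) F (c j) * (x₁ ^ (j.1 : ℕ) * x₂ ^ (j.2 : ℕ)))
        * t ^ (q * q * (c j).denom.natDegree)
        = t ^ (q * q * (c j).num.natDegree + (q * j.1 + j.2)) := by
    intro j hj
    have h3 : algebraMap (RatFunc K) F (c j)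
        * aeval (algebraMap (RatFunc K) F RatFunc.X) (c j).denom
        = aeval (algebraMap (RatFunc K) F RatFunc.X) (c j).num := by
      rw [aeval_algebraMap_ratFunc_X, aeval_algebraMap_ratFunc_X, ← map_mul]
      congr 1
      rw [← eq_div_iff ((map_ne_zero_iff _ (RatFunc.algebraMap_injective K)).2
        (RatFunc.denom_ne_zero (c j))), RatFunc.num_div_denom]
    have h4 := congrArg v h3
    rw [map_mul, valuation_aeval_of_one_lt v hK hx (RatFunc.denom_ne_zero _),
      valuation_aeval_of_one_lt v hK hx (RatFunc.num_ne_zero hj), h₀, ← pow_mul, ← pow_mul] at h4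
    rw [pow_add, ← h4, map_mul, map_mul, map_pow, map_pow, h₁, ← pow_mul, ← pow_add]
    exact mul_right_comm _ _ _
  have hxx : ∀ j : Fin q × Fin q, x₁ ^ (j.1 : ℕ) * x₂ ^ (j.2 : ℕ) ≠ 0 := by
    intro j
    refine mul_ne_zero (pow_ne_zero _ ?_) (pow_ne_zero _ ?_)
    · rw [← Valuation.ne_zero_iff v, h₁]; exact pow_ne_zero _ ht0
    · rw [← Valuation.ne_zero_iff v]; exact ht0
  have h := eq_zero_of_sum_eq_zero_of_valuation v _ (fun j k hj hk hjk => ?_) hc i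
  · exact (map_eq_zero _).1 ((mul_eq_zero.1 h).resolve_right (hxx i))
  · have hj' : c j ≠ 0 := fun h => hj (by rw [h, map_zero, zero_mul])
    have hk' : c k ≠ 0 := fun h => hk (by rw [h, map_zero, zero_mul])
    have h1 := hv j hj'
    have h2 := hv k hk'
    rw [← hjk] at h2
    have h3 : t ^ (q * q * (c j).num.natDegree + (q * j.1 + j.2) + q * q * (c k).denom.natDegree)
        = t ^ (q * q * (c k).num.natDegree + (q * k.1 + k.2)
          + q * q * (c j).denom.natDegree) := by
      rw [pow_add, ← h1, pow_add _ (_ + _) (q * q * (c j).denom.natDegree), ← h2]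
      exact mul_right_comm _ _ _
    have h4 := pow_right_injective₀ (zero_lt_one.trans ht) ht.ne' h3
    have hq := H.two_le
    have e : ∀ n j k m : ℕ, q * q * n + (q * j + k) + q * q * m = q * (q * n + j + q * m) + k := by
      intros; ring
    simp only [e] at h4
    -- The exponents of `x₂` and then of `x₁` are recovered as successive base `q` digits.
    have h5 := congrArg (· % q) h4
    simp only [Nat.mul_add_mod, Nat.mod_eq_of_lt j.2.2, Nat.mod_eq_of_lt k.2.2] at h5
    rw [h5] at h4
    have h6 := Nat.eq_of_mul_eq_mul_left (by omega) (Nat.add_right_cancel h4)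
    have e' : ∀ n j m : ℕ, q * n + j + q * m = q * (n + m) + j := by intros; ring
    simp only [e'] at h6
    have h7 := congrArg (· % q) h6
    simp only [Nat.mul_add_mod, Nat.mod_eq_of_lt j.1.2, Nat.mod_eq_of_lt k.1.2] at h7
    exact Prod.ext (Fin.ext h7) (Fin.ext h5)

omit [Algebra K F] [IsScalarTower K (RatFunc K) F] in
theorem finiteDimensional (H : IsGSTower K q x₁ x₂) : FiniteDimensional (RatFunc K) F := by
  have hint : ∀ y : F, IsIntegral (RatFunc K) (trq q y) → IsIntegral (RatFunc K) y := by
    intro y hy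
    obtain ⟨hd, hm⟩ := natDegree_X_pow_add_X_sub_C H.two_le (0 : RatFunc K)
    refine IsIntegral.of_aeval_monic hm (by rw [hd]; have := H.two_le; omega) ?_
    simpa [trq] using hy
  have h1 : IsIntegral (RatFunc K) x₁ := by
    refine hint _ ?_
    rw [H.eq₁, ← map_gsMap]
    exact isIntegral_algebraMap
  have h2 : IsIntegral (RatFunc K) x₂ := by
    refine hint _ ?_
    rw [H.eq₂]
    refine IsAlgebraic.isIntegral ?_
    rw [gsMap, div_eq_mul_inv]
    exact (h1.isAlgebraic.pow _).mul ((h1.isAlgebraic.pow _).add isAlgebraic_one).inv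
  have := IntermediateField.finiteDimensional_adjoin (K := RatFunc K) (S := {x₁, x₂}) (by
    rintro y (rfl | rfl) <;> assumption)
  rw [H.adjoin_eq] at this
  exact Module.Finite.equiv (IntermediateField.topEquiv (F := RatFunc K) (E := F)).toLinearEquiv

/-- In characteristic `p` the polynomial `X ^ q + X - a` has derivative `1`. -/
theorem isSeparable_of_trq_eq [Finite K] (hq : 2 ≤ q) (hcard : Nat.card K = q ^ 2) {M N : Type*}
    [Field M] [Field N] [Algebra K M] [Algebra M N] {a : M} {y : N}
    (hy : trq q y = algebraMap M N a) : IsSeparable M y := by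
  obtain ⟨p, m, hp, hc, hm, rfl⟩ := exists_charP_of_card_eq_sq hq hcard
  have : CharP M p := charP_of_injective_algebraMap (algebraMap K M).injective p
  have hsep : (X ^ p ^ m + X - C a : M[X]).Separable := by
    have : derivative (X ^ p ^ m + X - C a : M[X]) = 1 := by
      have h0 : ((p ^ m : ℕ) : M[X]) = 0 := by
        rw [Nat.cast_pow, CharP.cast_eq_zero, zero_pow hm]
      simp only [derivative_sub, derivative_add, derivative_X_pow, derivative_X, derivative_C,
        map_natCast, h0]
      ring
    rw [Polynomial.Separable, this]
    exact isCoprime_one_right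
  refine hsep.of_dvd (minpoly.dvd _ _ ?_)
  simpa [trq, sub_eq_zero] using hy

theorem isSeparable [Finite K] (H : IsGSTower K q x₁ x₂) : Algebra.IsSeparable (RatFunc K) F := by
  have h1 : x₁ ∈ separableClosure (RatFunc K) F := by
    rw [mem_separableClosure_iff]
    exact isSeparable_of_trq_eq H.two_le H.card_eq (H.eq₁.trans (map_gsMap _ _ _).symm)
  have h2 : x₂ ∈ separableClosure (RatFunc K) F := by
    rw [mem_separableClosure_iff]
    have : IsSeparable (separableClosure (RatFunc K) F) x₂ :=
      isSeparable_of_trq_eq (K := K) (a := gsMap q ⟨x₁, h1⟩) H.two_le H.card_eq (by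
        rw [map_gsMap, H.eq₂]; rfl)
    exact IsSeparable.of_algebra_isSeparable_of_isSeparable _ this
  rw [← separableClosure.eq_top_iff, eq_top_iff, ← H.adjoin_eq, IntermediateField.adjoin_le_iff]
  rintro y (rfl | rfl) <;> assumption

theorem q_mul_q_le_finrank (H : IsGSTower K q x₁ x₂) :
    q * q ≤ Module.finrank (RatFunc K) F := by
  have := H.finiteDimensional
  have hli : LinearIndependent (RatFunc K)
      (fun i : Fin q × Fin q => x₁ ^ (i.1 : ℕ) * x₂ ^ (i.2 : ℕ)) := by
    rw [Fintype.linearIndependent_iff]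
    intro c hc
    exact H.eq_zero_of_sum_eq_zero c (by simpa only [Algebra.smul_def] using hc)
  simpa using hli.fintype_card_le_finrank

variable {L : Type*} [Field L] [Algebra (RatFunc K) L]

omit [Algebra K F] [IsScalarTower K (RatFunc K) F] in
theorem algHom_ext (H : IsGSTower K q x₁ x₂) {σ τ : F →ₐ[RatFunc K] L} (h₁ : σ x₁ = τ x₁)
    (h₂ : σ x₂ = τ x₂) : σ = τ := by
  ext y
  have hy : y ∈ IntermediateField.adjoin (RatFunc K) {x₁, x₂} := by
    rw [H.adjoin_eq]; exact IntermediateField.mem_top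
  induction hy using IntermediateField.adjoin_induction with
  | mem x hx => rcases hx with rfl | rfl <;> assumption
  | algebraMap x => simp
  | add x y _ _ hx hy => rw [map_add, map_add, hx, hy]
  | inv x _ hx => rw [map_inv₀, map_inv₀, hx]
  | mul x y _ _ hx hy => rw [map_mul, map_mul, hx, hy]

/-- The embeddings of `F` into an algebraically closed field correspond to the solutions of the
tower equations. -/
theorem card_algHom_and_exists [Finite K] [IsAlgClosed L] (H : IsGSTower K q x₁ x₂) :
    Nat.card (F →ₐ[RatFunc K] L) = q * q ∧
      ∀ y₁ y₂ : L, trq q y₁ = gsMap q (algebraMap (RatFunc K) L RatFunc.X) →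
        trq q y₂ = gsMap q y₁ → ∃ σ : F →ₐ[RatFunc K] L, σ x₁ = y₁ ∧ σ x₂ = y₂ := by
  classical
  have := H.finiteDimensional
  have := H.isSeparable
  have hq := H.two_le
  let R : L → Finset L := fun c => (ncard_trq_eq_le hq c).1.toFinset
  have hmem : ∀ c y : L, y ∈ R c ↔ trq q y = c := fun c y => by simp [R]
  have hR : ∀ c, (R c).card ≤ q := fun c => by
    rw [← Set.ncard_eq_toFinset_card _ (ncard_trq_eq_le hq c).1]; exact (ncard_trq_eq_le hq c).2
  -- `T` collects all solutions of the tower equations, at most `q * q` of them. Embeddings inject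
  -- into `T`, and by separability their number is the degree, which is at least `q * q`; so the
  -- injection is onto.
  let T : Finset (Σ _ : L, L) :=
    (R (gsMap q (algebraMap (RatFunc K) L RatFunc.X))).sigma fun y => R (gsMap q y)
  have hT : T.card ≤ q * q := by
    rw [Finset.card_sigma]
    refine (Finset.sum_le_card_nsmul _ _ q fun _ _ => hR _).trans ?_
    exact Nat.mul_le_mul_right _ (hR _)
  let e : (F →ₐ[RatFunc K] L) → Σ _ : L, L := fun σ => ⟨σ x₁, σ x₂⟩
  have he : Function.Injective e := by
    intro σ τ h
    obtain ⟨h1, h2⟩ := Sigma.mk.inj_iff.1 h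
    exact H.algHom_ext h1 (eq_of_heq h2)
  have hsub : Finset.univ.image e ⊆ T := by
    intro z hz
    obtain ⟨σ, -, rfl⟩ := Finset.mem_image.1 hz
    refine Finset.mem_sigma.2 ⟨(hmem _ _).2 ?_, (hmem _ _).2 ?_⟩
    · have := congrArg σ H.eq₁
      rwa [← AlgHom.coe_toRingHom, map_trq, map_gsMap, AlgHom.coe_toRingHom,
        AlgHom.commutes] at this
    · have := congrArg σ H.eq₂
      rwa [← AlgHom.coe_toRingHom, map_trq, map_gsMap] at this
  have hcard : Fintype.card (F →ₐ[RatFunc K] L) = Module.finrank (RatFunc K) F :=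
    AlgHom.card _ _ _
  have hle := H.q_mul_q_le_finrank
  have himg : (Finset.univ.image e).card = Fintype.card (F →ₐ[RatFunc K] L) := by
    rw [Finset.card_image_of_injective _ he, Finset.card_univ]
  have hle' := Finset.card_le_card hsub
  refine ⟨by rw [Nat.card_eq_fintype_card]; omega, fun y₁ y₂ h₁ h₂ => ?_⟩
  have heq := Finset.eq_of_subset_of_card_le hsub (by omega)
  have hy : (⟨y₁, y₂⟩ : Σ _ : L, L) ∈ T :=
    Finset.mem_sigma.2 ⟨(hmem _ _).2 h₁, (hmem _ _).2 h₂⟩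
  rw [← heq] at hy
  obtain ⟨σ, -, hσ⟩ := Finset.mem_image.1 hy
  obtain ⟨h1, h2⟩ := Sigma.mk.inj_iff.1 hσ
  exact ⟨σ, h1, eq_of_heq h2⟩

end IsGSTower

/-! ## The number of zeros of a function on the evaluation set -/

/-- The points `(α₀, α₁, α₂)` with `trq q α₀ ≠ 0` that satisfy the tower equations. -/
def towerPoints (K : Type*) [Field K] (q : ℕ) : Set (K × K × K) :=
  {p | trq q p.1 ≠ 0 ∧ trq q p.2.1 = gsMap q p.1 ∧ trq q p.2.2 = gsMap q p.2.1}

theorem trq_ne_zero_of_tower_eq {K : Type*} [Field K] {q : ℕ} (hq : 2 ≤ q) {b c : K}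
    (hc : trq q c ≠ 0) (h : trq q b = gsMap q c) : trq q b ≠ 0 :=
  h ▸ (gsMap_ne_zero hq hc).2.2

/-! ### Lifting points to solutions over an algebraically closed field. -/

section Lifting

open Polynomial

variable {K : Type*} [Field K] [Finite K] {q : ℕ} {L : Type*} [Field L] [IsAlgClosed L]
  [Algebra K L] {Γ₀ : Type*} [LinearOrderedCommGroupWithZero Γ₀] (v : Valuation L Γ₀)

omit [Finite K] [Algebra K L] in
theorem exists_trq_eq (hq : 2 ≤ q) (c : L) : ∃ y : L, trq q y = c := by
  obtain ⟨hd, hm⟩ := natDegree_X_pow_add_X_sub_C hq c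
  obtain ⟨y, hy⟩ := IsAlgClosed.exists_root (X ^ q + X - C c) (by
    rw [degree_eq_natDegree hm.ne_zero, hd]
    exact_mod_cast (by omega : q ≠ 0))
  exact ⟨y, by simpa [IsRoot, trq, sub_eq_zero] using hy⟩

/-- Any solution reduces to some `b'` with the same trace as `b`; adding the trace-zero constant `b
- b'` gives another solution with the prescribed residue. -/
theorem exists_solution_near (hq : 2 ≤ q) (hcard : Nat.card K = q ^ 2)
    (hK : ∀ c : K, v (algebraMap K L c) ≤ 1) {b c : K} (hc : trq q c ≠ 0)
    (hbc : trq q b = gsMap q c) {x : L} (hx : v (x - algebraMap K L c) < 1) :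
    ∃ y : L, trq q y = gsMap q x ∧ v (y - algebraMap K L b) < 1 := by
  obtain ⟨y, hy⟩ := exists_trq_eq hq (gsMap q x)
  obtain ⟨b', hb', hyb⟩ := exists_residue_of_tower_eq v hK hq hcard hc hy hx
  refine ⟨y + algebraMap K L (b - b'), ?_, ?_⟩
  · rw [trq_add hq hcard, ← map_trq, trq_sub hq hcard, hbc, hb', sub_self, map_zero, add_zero, hy]
  · have : y + algebraMap K L (b - b') - algebraMap K L b = y - algebraMap K L b' := by
      rw [map_sub]; ring
    rwa [this]

theorem exists_solution_small (hq : 2 ≤ q) (hcard : Nat.card K = q ^ 2) {x : L} (hx : v x < 1) :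
    ∃ y : L, trq q y = gsMap q x ∧ v y < 1 := by
  obtain ⟨y, hy⟩ := exists_trq_eq hq (gsMap q x)
  obtain ⟨b, hb, hyb⟩ := exists_residue_of_trq v (K := K) hq hcard (c := 0) (y := y)
    (zero_pow (by omega)) (by
      rw [map_zero, sub_zero, hy,
        valuation_gsMap_of_pow_add_one v (valuation_pow_add_one_of_lt v hq hx)]
      exact pow_lt_one₀ zero_le hx (by omega))
  refine ⟨_, ?_, hyb⟩
  rw [trq_sub hq hcard, ← map_trq, hb, map_zero, sub_zero, hy]

end Lifting

/-! ### The norm to the rational function field and its orders. -/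

namespace IsGSTower

variable {K : Type*} [Field K] {q : ℕ} {F : Type*} [Field F] [Algebra K F]
  [Algebra (RatFunc K) F] [IsScalarTower K (RatFunc K) F] {x₁ x₂ : F}
  {L : Type*} [Field L] [Algebra K L] [Algebra (RatFunc K) L] [IsScalarTower K (RatFunc K) L]

omit [Algebra K F] [IsScalarTower K (RatFunc K) F] [Algebra K L]
  [IsScalarTower K (RatFunc K) L] in
theorem map_eq₁ (H : IsGSTower K q x₁ x₂) (σ : F →ₐ[RatFunc K] L) :
    trq q (σ x₁) = gsMap q (algebraMap (RatFunc K) L RatFunc.X) := by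
  have := congrArg σ H.eq₁
  rwa [← AlgHom.coe_toRingHom, map_trq, map_gsMap, AlgHom.coe_toRingHom, AlgHom.commutes] at this

omit [Algebra K F] [IsScalarTower K (RatFunc K) F] [Algebra K L]
  [IsScalarTower K (RatFunc K) L] in
theorem map_eq₂ (H : IsGSTower K q x₁ x₂) (σ : F →ₐ[RatFunc K] L) :
    trq q (σ x₂) = gsMap q (σ x₁) := by
  have := congrArg σ H.eq₂
  rwa [← AlgHom.coe_toRingHom, map_trq, map_gsMap] at this

theorem map_towerFun_algHom (σ : F →ₐ[RatFunc K] L)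
    (a : Fin (q + 1) × Fin q × Fin (q - 1) → K) :
    σ (towerFun q a (algebraMap (RatFunc K) F RatFunc.X) x₁ x₂)
      = towerFun q a (algebraMap (RatFunc K) L RatFunc.X) (σ x₁) (σ x₂) := by
  have := map_towerFun (σ.restrictScalars K) a (algebraMap (RatFunc K) F RatFunc.X) x₁ x₂
  simpa using this

variable [Finite K] [IsAlgClosed L]
  {Γ₀ : Type*} [LinearOrderedCommGroupWithZero Γ₀] (v : Valuation L Γ₀)
  (a : Fin (q + 1) × Fin q × Fin (q - 1) → K)

omit [IsScalarTower K (RatFunc K) L] in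
/-- Every point over `α₀` is the reduction of an embedding. -/
theorem exists_algHom_near (H : IsGSTower K q x₁ x₂) (hK : ∀ c : K, v (algebraMap K L c) ≤ 1)
    {p : K × K × K} (hp : p ∈ towerPoints K q)
    (hx : v (algebraMap (RatFunc K) L RatFunc.X - algebraMap K L p.1) < 1) :
    ∃ σ : F →ₐ[RatFunc K] L,
      v (σ x₁ - algebraMap K L p.2.1) < 1 ∧ v (σ x₂ - algebraMap K L p.2.2) < 1 := by
  obtain ⟨h0, h1, h2⟩ := hp
  obtain ⟨y₁, hy₁, hn₁⟩ := exists_solution_near v H.two_le H.card_eq hK h0 h1 hx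
  obtain ⟨y₂, hy₂, hn₂⟩ := exists_solution_near v H.two_le H.card_eq hK
    (trq_ne_zero_of_tower_eq H.two_le h0 h1) h2 hn₁
  obtain ⟨σ, rfl, rfl⟩ := (H.card_algHom_and_exists (L := L)).2 y₁ y₂ hy₁ hy₂
  exact ⟨σ, hn₁, hn₂⟩

/-- The norm is a product of `q * q` conjugates, each with `q * q`-th power bounded by the
right-hand side; comparing `q * q`-th powers of both sides avoids roots. -/
theorem valuation_norm_at_infinity (H : IsGSTower K q x₁ x₂)
    (hK : ∀ c : K, v (algebraMap K L c) ≤ 1) (hv : 1 < v (algebraMap (RatFunc K) L RatFunc.X)) :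
    v (algebraMap (RatFunc K) L (Algebra.norm (RatFunc K)
        (towerFun q a (algebraMap (RatFunc K) F RatFunc.X) x₁ x₂)))
      ≤ v (algebraMap (RatFunc K) L RatFunc.X) ^ (q * q * q + q * (q - 1) + (q - 2)) := by
  have := H.finiteDimensional
  have := H.isSeparable
  have hq := H.two_le
  have hcard := (H.card_algHom_and_exists (L := L)).1
  rw [Nat.card_eq_fintype_card] at hcard
  refine le_of_pow_le_pow_left₀ (mul_ne_zero (by omega : q ≠ 0) (by omega : q ≠ 0)) zero_le ?_
  rw [Algebra.norm_eq_prod_embeddings, map_prod, ← Finset.prod_pow]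
  refine (Finset.prod_le_pow_card _ _ _ fun σ _ => ?_).trans_eq (by
    rw [Finset.card_univ, hcard])
  rw [map_towerFun_algHom]
  exact valuation_towerFun_at_infinity v a hK hq (H.map_eq₁ σ) (H.map_eq₂ σ) hv

theorem valuation_norm_at_root (H : IsGSTower K q x₁ x₂)
    (hK : ∀ c : K, v (algebraMap K L c) ≤ 1)
    (hx : algebraMap (RatFunc K) L RatFunc.X ^ (q - 1) + 1 ≠ 0)
    (hv : v (algebraMap (RatFunc K) L RatFunc.X ^ (q - 1) + 1) < 1) :
    v (algebraMap (RatFunc K) L (Algebra.norm (RatFunc K)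
        (towerFun q a (algebraMap (RatFunc K) F RatFunc.X) x₁ x₂)))
      * v (algebraMap (RatFunc K) L RatFunc.X ^ (q - 1) + 1) ^ (q * (q - 1) + (q - 2)) ≤ 1 := by
  have := H.finiteDimensional
  have := H.isSeparable
  have hq := H.two_le
  have hcard := (H.card_algHom_and_exists (L := L)).1
  rw [Nat.card_eq_fintype_card] at hcard
  refine le_of_pow_le_pow_left₀ (mul_ne_zero (by omega : q ≠ 0) (by omega : q ≠ 0)) zero_le ?_
  rw [Algebra.norm_eq_prod_embeddings, map_prod, mul_pow, ← Finset.prod_pow, one_pow]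
  -- The `q * q` copies of the second factor are distributed, one to each embedding.
  conv_lhs => rw [← hcard, ← Finset.card_univ, ← Finset.prod_const, ← Finset.prod_mul_distrib]
  refine Finset.prod_le_one' fun σ _ => ?_
  rw [map_towerFun_algHom, Finset.card_univ, hcard]
  exact valuation_towerFun_at_root v a hK hq (H.map_eq₁ σ) (H.map_eq₂ σ) hx hv

theorem valuation_norm_at_regular (H : IsGSTower K q x₁ x₂)
    (hK : ∀ c : K, v (algebraMap K L c) ≤ 1) (hx : v (algebraMap (RatFunc K) L RatFunc.X) = 1)
    (hv : v (algebraMap (RatFunc K) L RatFunc.X ^ (q - 1) + 1) = 1) :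
    v (algebraMap (RatFunc K) L (Algebra.norm (RatFunc K)
        (towerFun q a (algebraMap (RatFunc K) F RatFunc.X) x₁ x₂))) ≤ 1 := by
  have := H.finiteDimensional
  have := H.isSeparable
  rw [Algebra.norm_eq_prod_embeddings, map_prod]
  refine Finset.prod_le_one' fun σ _ => ?_
  rw [map_towerFun_algHom]
  obtain ⟨h₁, h₂⟩ := valuation_at_regular v H.two_le (H.map_eq₁ σ) (H.map_eq₂ σ) hx hv
  exact valuation_towerFun_le_one v a hK hx.le h₁ h₂

omit [IsScalarTower K (RatFunc K) L] in
/-- Over the zero of `x₀` at least `q` embeddings send `x₁` to a non-unit. -/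
theorem q_le_ncard_small (H : IsGSTower K q x₁ x₂)
    (hv : v (algebraMap (RatFunc K) L RatFunc.X) < 1) :
    q ≤ {σ : F →ₐ[RatFunc K] L | v (σ x₁) < 1}.ncard := by
  have := H.finiteDimensional
  have hq := H.two_le
  obtain ⟨y₁, hy₁, hlt⟩ := exists_solution_small v hq H.card_eq hv
  obtain ⟨y₂, hy₂⟩ := exists_trq_eq hq (gsMap q y₁)
  -- With the small value `y₁` fixed, the trace-zero constants translate `y₂` and yield `q`
  -- embeddings.
  have hex : ∀ w : K, trq q w = 0 → ∃ σ : F →ₐ[RatFunc K] L,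
      σ x₁ = y₁ ∧ σ x₂ = y₂ + algebraMap K L w := fun w hw => by
    refine (H.card_algHom_and_exists (L := L)).2 _ _ hy₁ ?_
    rw [trq_add hq H.card_eq, ← map_trq, hw, map_zero, add_zero, hy₂]
  have : Nonempty (F →ₐ[RatFunc K] L) := ⟨IsAlgClosed.lift⟩
  choose! s hs using hex
  refine (trq_range_and_ker hq H.card_eq).2.2.ge.trans ?_
  refine Set.ncard_le_ncard_of_injOn s ?_ ?_ (Set.toFinite _)
  · intro w hw
    simpa [(hs w hw).1] using hlt
  · intro w hw w' hw' h
    have h1 := (hs w hw).2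
    rw [h, (hs w' hw').2] at h1
    exact (algebraMap K L).injective (add_left_cancel h1).symm

/-- At least `q` of the `q * q` conjugates have `x₁` vanishing and contribute no pole; this leaves
at most `q * (q - 1)` poles of order at most `q - 2`. Without the saving the final zero bound would
not be sharp. -/
theorem valuation_norm_at_zero (H : IsGSTower K q x₁ x₂)
    (hK : ∀ c : K, v (algebraMap K L c) ≤ 1) (hx : algebraMap (RatFunc K) L RatFunc.X ≠ 0)
    (hv : v (algebraMap (RatFunc K) L RatFunc.X) < 1) :
    v (algebraMap (RatFunc K) L (Algebra.norm (RatFunc K)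
        (towerFun q a (algebraMap (RatFunc K) F RatFunc.X) x₁ x₂)))
      * v (algebraMap (RatFunc K) L RatFunc.X) ^ (q * (q - 1) * (q - 2)) ≤ 1 := by
  classical
  have := H.finiteDimensional
  have := H.isSeparable
  have hq := H.two_le
  have hcard := (H.card_algHom_and_exists (L := L)).1
  rw [Nat.card_eq_fintype_card] at hcard
  have hsmall := H.q_le_ncard_small v hv
  rw [Set.ncard_eq_toFinset_card', Set.toFinset_ofPred] at hsmall
  set π := v (algebraMap (RatFunc K) L RatFunc.X) with hπ
  have hπ0 : π ≠ 0 := (Valuation.ne_zero_iff v).2 hx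
  have hsplit := Finset.card_filter_add_card_filter_not (s := Finset.univ)
    (fun σ : F →ₐ[RatFunc K] L => v (σ x₁) < 1)
  rw [Finset.card_univ, hcard] at hsplit
  have hb : ∀ σ : F →ₐ[RatFunc K] L,
      v (σ (towerFun q a (algebraMap (RatFunc K) F RatFunc.X) x₁ x₂))
        ≤ if v (σ x₁) < 1 then 1 else (π ^ (q - 2))⁻¹ := by
    intro σ
    obtain ⟨h1, h2⟩ :=
      valuation_towerFun_at_zero v a hK hq (H.map_eq₁ σ) (H.map_eq₂ σ) hx hv
    rw [map_towerFun_algHom]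
    split_ifs with h
    · exact h1 h
    · exact (le_mul_inv_iff₀ (zero_lt_iff.2 (pow_ne_zero _ hπ0))).2 h2 |>.trans_eq (one_mul _)
  rw [Algebra.norm_eq_prod_embeddings, map_prod]
  have hprod := Finset.prod_le_prod' (s := Finset.univ) fun σ _ => hb σ
  rw [Finset.prod_ite, Finset.prod_const_one, one_mul, Finset.prod_const] at hprod
  refine (mul_le_mul_left hprod _).trans ?_
  rw [inv_pow, ← pow_mul, inv_mul_le_one₀ (zero_lt_iff.2 (pow_ne_zero _ hπ0))]
  refine _root_.pow_le_pow_of_le_one zero_le hv.le ?_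
  rw [mul_comm (q - 2)]
  refine Nat.mul_le_mul_right _ ?_
  rw [Nat.mul_sub, mul_one]
  omega

/-- The zeros over `α₀` contribute to the order of the norm at `x₀ = α₀`. -/
theorem valuation_norm_at_point (H : IsGSTower K q x₁ x₂)
    (hK : ∀ c : K, v (algebraMap K L c) ≤ 1) (c : K)
    (hv : v (algebraMap (RatFunc K) L RatFunc.X - algebraMap K L c) < 1) (hc : trq q c ≠ 0) :
    v (algebraMap (RatFunc K) L (Algebra.norm (RatFunc K)
        (towerFun q a (algebraMap (RatFunc K) F RatFunc.X) x₁ x₂)))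
      ≤ v (algebraMap (RatFunc K) L RatFunc.X - algebraMap K L c) ^
        {p ∈ towerPoints K q | p.1 = c ∧ towerFun q a p.1 p.2.1 p.2.2 = 0}.ncard := by
  classical
  have := H.finiteDimensional
  have := H.isSeparable
  have hq := H.two_le
  set Z := {p ∈ towerPoints K q | p.1 = c ∧ towerFun q a p.1 p.2.1 p.2.2 = 0}
  set π := v (algebraMap (RatFunc K) L RatFunc.X - algebraMap K L c)
  have hex : ∀ p ∈ Z, ∃ σ : F →ₐ[RatFunc K] L,
      v (σ x₁ - algebraMap K L p.2.1) < 1 ∧ v (σ x₂ - algebraMap K L p.2.2) < 1 := by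
    rintro p ⟨hp, rfl, -⟩
    exact H.exists_algHom_near v hK hp hv
  have : Nonempty (F →ₐ[RatFunc K] L) := ⟨IsAlgClosed.lift⟩
  choose! s hs using hex
  -- An embedding determines the residues of `x₁` and `x₂`, hence the point it reduces to.
  have hinj : Set.InjOn s Z := by
    intro p hp p' hp' h
    have h1 := hs p hp
    have h2 := hs p' hp'
    rw [h] at h1
    exact Prod.ext (hp.2.1.trans hp'.2.1.symm) (Prod.ext
      (eq_of_valuation_sub_lt_one v hK h1.1 h2.1) (eq_of_valuation_sub_lt_one v hK h1.2 h2.2))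
  have hx1 := valuation_le_one_of_sub v hK hv.le
  have hb : ∀ σ : F →ₐ[RatFunc K] L,
      v (σ (towerFun q a (algebraMap (RatFunc K) F RatFunc.X) x₁ x₂))
        ≤ if σ ∈ s '' Z then π else 1 := by
    intro σ
    rw [map_towerFun_algHom]
    split_ifs with h
    · obtain ⟨⟨c₀, c₁, c₂⟩, hp, rfl⟩ := h
      obtain ⟨h1, h2⟩ := hs _ hp
      obtain ⟨⟨g0, g1, g2⟩, hc0, hz⟩ := hp
      simp only at h1 h2 g0 g1 g2 hc0 hz
      subst hc0
      -- All coordinates agree with the point to within `π`, so the function is within `π` of its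
      -- value there, which is zero.
      have hle1 := valuation_sub_le_of_tower_eq v hK hq H.card_eq g0 g1 (H.map_eq₁ _) hv h1
      have hle2 := (valuation_sub_le_of_tower_eq v hK hq H.card_eq
        (trq_ne_zero_of_tower_eq hq g0 g1) g2 (H.map_eq₂ _) h1 h2).trans hle1
      have h3 := valuation_towerFun_sub_le v a hK hv.le le_rfl hle1 hle2
      rwa [hz, map_zero, sub_zero] at h3
    · obtain ⟨b₁, hb₁, h1⟩ :=
        exists_residue_of_tower_eq v hK hq H.card_eq hc (H.map_eq₁ σ) hv
      obtain ⟨b₂, hb₂, h2⟩ := exists_residue_of_tower_eq v hK hq H.card_eq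
        (trq_ne_zero_of_tower_eq hq hc hb₁) (H.map_eq₂ σ) h1
      exact valuation_towerFun_le_one v a hK hx1 (valuation_le_one_of_sub v hK h1.le)
        (valuation_le_one_of_sub v hK h2.le)
  rw [Algebra.norm_eq_prod_embeddings, map_prod]
  have hprod := Finset.prod_le_prod' (s := Finset.univ) fun σ _ => hb σ
  refine hprod.trans_eq ?_
  rw [Finset.prod_ite, Finset.prod_const_one, mul_one, Finset.prod_const,
    ← hinj.ncard_image, Set.ncard_eq_toFinset_card']
  congr 2
  ext σ
  simp

-- `G` is the norm cleared of its finite poles. The clearing factors are integral at each `c` of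
-- nonzero trace, so they can only increase the multiplicity there, and the behaviour at infinity
-- bounds the degree.
open Polynomial in
theorem exists_polynomial_of_norm (H : IsGSTower K q x₁ x₂)
    (ha : towerFun q a (algebraMap (RatFunc K) F RatFunc.X) x₁ x₂ ≠ 0) :
    ∃ G : K[X], G ≠ 0 ∧
      G.natDegree ≤ q * q * q + q * q * (q - 1) + q * q * (q - 2) ∧
      ∀ c : K, trq q c ≠ 0 →
        {p ∈ towerPoints K q | p.1 = c ∧ towerFun q a p.1 p.2.1 p.2.2 = 0}.ncard
          ≤ G.rootMultiplicity c := by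
  have := H.finiteDimensional
  have hq := H.two_le
  let L := AlgebraicClosure (RatFunc K)
  set x : L := algebraMap (RatFunc K) L RatFunc.X with hxdef
  have hxt : Transcendental K x := transcendental_algebraMap_ratFunc_X
  set N := Algebra.norm (RatFunc K) (towerFun q a (algebraMap (RatFunc K) F RatFunc.X) x₁ x₂)
    with hN
  have hN0 : N ≠ 0 := Algebra.norm_ne_zero_iff.2 ha
  set A := q * (q - 1) * (q - 2) with hA
  set B := q * (q - 1) + (q - 2) with hB
  have hu : (X ^ (q - 1) + 1 : K[X]).Monic := monic_X_pow_add_C (1 : K) (by omega)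
  have hudeg : (X ^ (q - 1) + 1 : K[X]).natDegree = q - 1 := natDegree_X_pow_add_C (r := (1 : K))
  have hux : aeval x (X ^ (q - 1) + 1 : K[X]) = x ^ (q - 1) + 1 := by simp
  have hu0 : x ^ (q - 1) + 1 ≠ 0 := by
    rw [← hux]
    exact fun h => hu.ne_zero ((transcendental_iff.1 hxt) _ h)
  have hx0 : x ≠ 0 := fun h => hxt (h ▸ isAlgebraic_zero)
  -- `A` and `B` are the pole bounds of the norm at `x₀ = 0` and at the roots of `x₀ ^ (q - 1) + 1`.
  set U : K[X] := X ^ A * (X ^ (q - 1) + 1) ^ B with hU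
  have hUx : aeval x U = x ^ A * (x ^ (q - 1) + 1) ^ B := by simp [hU]
  obtain ⟨G, hG⟩ := ratFunc_eq_polynomial_of_valuation_le_one (E := L)
    (N * algebraMap K[X] (RatFunc K) U) (by
      intro W hK hle
      rw [map_mul, ← aeval_algebraMap_ratFunc_X, hUx, map_mul, map_mul, map_pow, map_pow]
      rcases hle.lt_or_eq with h | h
      · rw [valuation_pow_add_one_of_lt _ hq h, one_pow, mul_one]
        exact H.valuation_norm_at_zero _ a hK hx0 h
      · have h' : W.valuation x = 1 := h
        rw [h', one_pow, one_mul]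
        rcases (valuation_pow_add_one_le W.valuation (q := q) hle).lt_or_eq with h2 | h2
        · exact H.valuation_norm_at_root _ a hK hu0 h2
        · rw [h2, one_pow, mul_one]
          exact H.valuation_norm_at_regular _ a hK h h2)
  have hGx : aeval x G = algebraMap (RatFunc K) L N * (x ^ A * (x ^ (q - 1) + 1) ^ B) := by
    rw [aeval_algebraMap_ratFunc_X, ← hG, map_mul, ← aeval_algebraMap_ratFunc_X, hUx]
  have hG0 : G ≠ 0 := by
    rintro rfl
    rw [map_zero] at hGx
    exact mul_ne_zero ((map_ne_zero_iff _ (algebraMap (RatFunc K) L).injective).2 hN0)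
      (mul_ne_zero (pow_ne_zero _ hx0) (pow_ne_zero _ hu0)) hGx.symm
  refine ⟨G, hG0, ?_, ?_⟩
  · obtain ⟨W, hK, hx⟩ := exists_valuationSubring_infty K L
    have h1 := congrArg W.valuation hGx
    rw [valuation_aeval_of_one_lt _ hK hx hG0, map_mul, map_mul, map_pow, map_pow, ← hux,
      valuation_aeval_of_one_lt _ hK hx hu.ne_zero, hudeg] at h1
    have h2 := H.valuation_norm_at_infinity W.valuation a hK hx
    have h3 : W.valuation x ^ G.natDegree
        ≤ W.valuation x ^ (q * q * q + q * (q - 1) + (q - 2) + (A + (q - 1) * B)) := by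
      rw [h1, pow_add _ _ (A + (q - 1) * B), pow_add _ A,
        pow_mul (W.valuation x) (q - 1) B]
      exact mul_le_mul_left h2 _
    have h4 := (pow_le_pow_iff_right₀ hx).1 h3
    refine h4.trans_eq ?_
    obtain ⟨m, rfl⟩ := Nat.exists_eq_add_of_le' hq
    simp only [hA, hB, Nat.add_sub_cancel, show m + 2 - 1 = m + 1 by omega]
    ring
  · intro c hc
    obtain ⟨W, hK, hx, hlt⟩ := exists_valuationSubring_of_not_isUnit hxt
      (p := X - C c) (not_isUnit_X_sub_C c)
    have hlt' : W.valuation (x - algebraMap K L c) < 1 := by simpa using hlt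
    have hxc := hlt'
    obtain ⟨P, hP, hdvd⟩ := exists_eq_pow_rootMultiplicity_mul_and_not_dvd G hG0 c
    have hcop : IsCoprime (X - C c) P :=
      ((irreducible_X_sub_C c).coprime_iff_not_dvd).2 hdvd
    have h1 := congrArg (fun r => W.valuation (aeval x r)) hP
    simp only [map_mul, map_pow] at h1
    rw [valuation_aeval_eq_one_of_isCoprime _ hK hx hcop hlt, mul_one, hGx, map_mul] at h1
    have h2 := H.valuation_norm_at_point W.valuation a hK c hlt' hc
    have h3 : W.valuation (x ^ A * (x ^ (q - 1) + 1) ^ B) ≤ 1 := by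
      rw [map_mul, map_pow, map_pow]
      exact mul_le_one₀ (pow_le_one₀ zero_le hx) zero_le
        (pow_le_one₀ zero_le (valuation_pow_add_one_le _ hx))
    have h4 : aeval x (X - C c) = x - algebraMap K L c := by simp
    rw [h4] at h1
    have h5 := h1.symm.le.trans ((mul_le_of_le_one_right' h3).trans h2)
    have h6 : 0 < W.valuation (x - algebraMap K L c) := by
      rw [zero_lt_iff, Valuation.ne_zero_iff, ← h4]
      exact fun h => X_sub_C_ne_zero c ((transcendental_iff.1 hxt) _ h)
    exact (pow_le_pow_iff_right_of_lt_one₀ h6 hlt').1 h5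

open Polynomial in
/-- A nonzero function of the space `V` has at most `q ^ 3 + q ^ 2 (q - 1) + q ^ 2 (q - 2)` zeros
on the evaluation set. -/
theorem ncard_zeros_le (H : IsGSTower K q x₁ x₂)
    (ha : towerFun q a (algebraMap (RatFunc K) F RatFunc.X) x₁ x₂ ≠ 0) :
    {p ∈ towerPoints K q | towerFun q a p.1 p.2.1 p.2.2 = 0}.ncard
      ≤ q * q * q + q * q * (q - 1) + q * q * (q - 2) := by
  classical
  have := Fintype.ofFinite K
  obtain ⟨G, hG0, hdeg, hG⟩ := H.exists_polynomial_of_norm a ha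
  refine le_trans ?_ hdeg
  rw [Set.ncard_eq_toFinset_card']
  rw [Finset.card_eq_sum_card_fiberwise (f := fun p : K × K × K => p.1) (t := Finset.univ)
    (fun _ _ => Finset.mem_coe.2 (Finset.mem_univ _))]
  -- Zeros are counted by first coordinate; fibres over trace-zero `c` are empty.
  calc _ ≤ ∑ c : K, G.rootMultiplicity c := by
        refine Finset.sum_le_sum fun c _ => ?_
        by_cases hc : trq q c = 0
        · rw [Finset.card_eq_zero.2]
          · exact Nat.zero_le _
          · refine Finset.filter_eq_empty_iff.2 ?_
            rintro p hp rfl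
            simp only [Set.mem_toFinset] at hp
            exact hp.1.1 hc
        · refine le_trans (le_of_eq ?_) (hG c hc)
          rw [Set.ncard_eq_toFinset_card']
          congr 1
          ext p
          simp only [Finset.mem_filter, Set.mem_toFinset, Set.mem_ofPred_eq]
          tauto
    _ = Multiset.card G.roots := by
        simp_rw [← count_roots]
        exact Multiset.sum_count_eq_card fun _ _ => Finset.mem_univ _
    _ ≤ G.natDegree := card_roots' _

end IsGSTower

/-! ## The places of the evaluation set -/

theorem ValuationSubring.mem_nonunits_comap {E L : Type*} [Field E] [Field L]
    (W : ValuationSubring L) (φ : E →+* L) (z : E) :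
    z ∈ (W.comap φ).nonunits ↔ φ z ∈ W.nonunits := by
  rw [ValuationSubring.mem_nonunits_iff_or, ValuationSubring.mem_nonunits_iff_or,
    ValuationSubring.mem_comap, map_inv₀, map_eq_zero]

namespace FFPlace

variable {K F : Type*} [Field K] [Field F] [Algebra K F]

theorem hasValue_iff (Q : FFPlace K F) (f : F) (c : K) :
    Q.HasValue f c ↔ Q.ring.valuation (f - algebraMap K F c) < 1 :=
  ValuationSubring.mem_nonunits_iff _

theorem valuation_algebraMap_le_one (Q : FFPlace K F) (c : K) :
    Q.ring.valuation (algebraMap K F c) ≤ 1 :=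
  (ValuationSubring.valuation_le_one_iff _ _).2 (Q.algebraMap_mem c)

theorem HasValue.unique {Q : FFPlace K F} {f : F} {c d : K} (hc : Q.HasValue f c)
    (hd : Q.HasValue f d) : c = d :=
  eq_of_valuation_sub_lt_one Q.ring.valuation Q.valuation_algebraMap_le_one
    ((Q.hasValue_iff f c).1 hc) ((Q.hasValue_iff f d).1 hd)

theorem HasValue.mul {Q : FFPlace K F} {f g : F} {c d : K} (hf : Q.HasValue f c)
    (hg : Q.HasValue g d) : Q.HasValue (f * g) (c * d) := by
  rw [hasValue_iff] at *
  have hK := Q.valuation_algebraMap_le_one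
  refine (valuation_mul_sub_mul_le Q.ring.valuation hK (valuation_le_one_of_sub _ hK hg.le)
    (le_max_left _ _) (le_max_right _ _)).trans_lt (max_lt hf hg)

theorem hasValue_algebraMap (Q : FFPlace K F) (c : K) : Q.HasValue (algebraMap K F c) c := by
  simp [hasValue_iff]

theorem HasValue.aeval {Q : FFPlace K F} {ι : Type*} {x : ι → F} {p : ι → K}
    (h : ∀ i, Q.HasValue (x i) (p i)) (g : MvPolynomial ι K) :
    Q.HasValue (MvPolynomial.aeval x g) (MvPolynomial.eval p g) := by
  induction g using MvPolynomial.induction_on with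
  | C c => simpa using Q.hasValue_algebraMap c
  | add g g' hg hg' => simpa using hg.add hg'
  | mul_X g i hg => simpa using hg.mul (h i)

theorem HasValue.valuation_le_one {Q : FFPlace K F} {f : F} {c : K} (hf : Q.HasValue f c) :
    Q.ring.valuation f ≤ 1 :=
  valuation_le_one_of_sub _ Q.valuation_algebraMap_le_one ((Q.hasValue_iff _ _).1 hf).le

theorem HasValue.valuation_eq_one {Q : FFPlace K F} {f : F} {c : K} (hf : Q.HasValue f c)
    (hc : c ≠ 0) : Q.ring.valuation f = 1 := by
  refine hf.valuation_le_one.antisymm ?_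
  by_contra! h
  refine hc (hf.unique ?_)
  rwa [hasValue_iff, map_zero, sub_zero]

variable [Algebra (RatFunc K) F] [IsScalarTower K (RatFunc K) F]

theorem mem_placesAbove_iff {q : ℕ} (Q : FFPlace K F) :
    Q ∈ (placesAbove (placesS K q) : Set (FFPlace K F)) ↔
      ∃ c : K, trq q c ≠ 0 ∧ Q.HasValue (algebraMap (RatFunc K) F RatFunc.X) c := by
  have hmap : ∀ c : K, algebraMap (RatFunc K) F (RatFunc.X - RatFunc.C c)
      = algebraMap (RatFunc K) F RatFunc.X - algebraMap K F c := fun c => by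
    rw [map_sub, IsScalarTower.algebraMap_apply K (RatFunc K) F, RatFunc.algebraMap_eq_C]
  have hne : ∀ c : K, (RatFunc.X - RatFunc.C c : RatFunc K) ≠ 0 := fun c h => by
    have h1 := Polynomial.X_sub_C_ne_zero c
    rw [← map_ne_zero_iff _ (RatFunc.algebraMap_injective K), map_sub, RatFunc.algebraMap_X,
      RatFunc.algebraMap_C] at h1
    exact h1 h
  constructor
  · rintro ⟨P, ⟨c, hc, hP⟩, hQ⟩
    refine ⟨c, hc, ?_⟩
    rw [HasValue, ← hmap, ← ValuationSubring.mem_nonunits_comap, hQ]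
    exact hP
  · rintro ⟨c, hc, hQ⟩
    rw [HasValue, ← hmap, ← ValuationSubring.mem_nonunits_comap] at hQ
    refine ⟨⟨Q.ring.comap (algebraMap (RatFunc K) F), fun a => ?_, fun h => ?_⟩,
      ⟨c, hc, hQ⟩, rfl⟩
    · rw [ValuationSubring.mem_comap, ← IsScalarTower.algebraMap_apply]
      exact Q.algebraMap_mem a
    · rw [h, ValuationSubring.mem_nonunits_iff_or] at hQ
      exact hQ.elim (hne c) fun h' => h' (ValuationSubring.mem_top _)

end FFPlace

/-- The place `Q` reduces the coordinates `x` to the point `p`. -/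
def FFPlace.AtPoint {K F : Type*} [Field K] [Field F] [Algebra K F] (x : Fin 3 → F)
    (Q : FFPlace K F) (p : K × K × K) : Prop :=
  ∀ i, Q.HasValue (x i) (![p.1, p.2.1, p.2.2] i)

/-! ### The local ring at a point -/

section LocalRing

variable {K : Type*} [Field K] {q : ℕ} {F : Type*} [Field F] [Algebra K F]

theorem exists_pow_sub_pow_eq {R : Type*} [CommRing R] (a c : R) (n : ℕ) :
    ∃ d, a ^ n - c ^ n = (a - c) * d :=
  sub_dvd_pow_sub_pow a c n

/-- Subtracting the equation at `p` from the one for `x` gives `w * (w ^ (q - 1) + 1)`, with `w = x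
j - p j`, as a difference of values of `gsMap`; cleared of denominators, that difference is
divisible by `x i - p i`. The cofactor `h` is nonzero at `p`, so it is a unit at every place over
`p`. -/
theorem exists_mul_sub_eq_of_tower_eq [Finite K] (hq : 2 ≤ q) (hcard : Nat.card K = q ^ 2)
    {ι : Type*} {x : ι → F} {p : ι → K} {i j : ι}
    (hu : x i ^ (q - 1) + 1 ≠ 0) (hp : trq q (p i) ≠ 0) (hij : trq q (x j) = gsMap q (x i))
    (hpij : trq q (p j) = gsMap q (p i)) :
    ∃ h g : MvPolynomial ι K, MvPolynomial.eval p h ≠ 0 ∧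
      MvPolynomial.aeval x h * (x j - algebraMap K F (p j))
        = (x i - algebraMap K F (p i)) * MvPolynomial.aeval x g := by
  have hup := (gsMap_ne_zero hq hp).2.1
  obtain ⟨d, hd⟩ := exists_pow_sub_pow_eq (MvPolynomial.X i : MvPolynomial ι K)
    (MvPolynomial.C (p i)) q
  obtain ⟨e, he⟩ := exists_pow_sub_pow_eq (MvPolynomial.X i : MvPolynomial ι K)
    (MvPolynomial.C (p i)) (q - 1)
  refine ⟨((MvPolynomial.X j - MvPolynomial.C (p j)) ^ (q - 1) + 1) *
      (MvPolynomial.X i ^ (q - 1) + 1) * MvPolynomial.C (p i ^ (q - 1) + 1),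
    d * MvPolynomial.C (p i ^ (q - 1) + 1) - MvPolynomial.C (p i ^ q) * e, ?_, ?_⟩
  · have h0 : (0 : K) ^ (q - 1) = 0 := zero_pow (by omega)
    simp [h0, hup]
  · have hd' := congrArg (MvPolynomial.aeval x) hd
    have he' := congrArg (MvPolynomial.aeval x) he
    simp only [map_sub, map_pow, MvPolynomial.aeval_X, MvPolynomial.aeval_C, map_mul] at hd' he'
    have hup' : algebraMap K F (p i) ^ (q - 1) + 1 ≠ 0 := by
      rw [← map_one (algebraMap K F), ← map_pow, ← map_add]
      exact (map_ne_zero _).2 hup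
    have h1 : (x j - algebraMap K F (p j)) * ((x j - algebraMap K F (p j)) ^ (q - 1) + 1)
        = x i ^ q / (x i ^ (q - 1) + 1)
          - algebraMap K F (p i) ^ q / (algebraMap K F (p i) ^ (q - 1) + 1) := by
      rw [← trq_eq_mul hq, trq_sub hq hcard, hij, ← map_trq, hpij, map_gsMap]
      rfl
    rw [div_sub_div _ _ hu hup', eq_div_iff (mul_ne_zero hu hup')] at h1
    simp only [map_sub, map_pow, MvPolynomial.aeval_X, MvPolynomial.aeval_C, map_mul, map_add,
      map_one]
    linear_combination h1 + (algebraMap K F (p i) ^ (q - 1) + 1) * hd'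
      - algebraMap K F (p i) ^ q * he'

/-- The maximal ideal of the local ring at the point `p` is generated by `x₀ - p₀`. -/
theorem exists_mul_sub_eval_eq {x : Fin 3 → F} {p : Fin 3 → K}
    (hX : ∀ i, ∃ h g : MvPolynomial (Fin 3) K, MvPolynomial.eval p h ≠ 0 ∧
      MvPolynomial.aeval x h * (x i - algebraMap K F (p i))
        = (x 0 - algebraMap K F (p 0)) * MvPolynomial.aeval x g) (f : MvPolynomial (Fin 3) K) :
    ∃ h g : MvPolynomial (Fin 3) K, MvPolynomial.eval p h ≠ 0 ∧
      MvPolynomial.aeval x h * (MvPolynomial.aeval x f - algebraMap K F (MvPolynomial.eval p f))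
        = (x 0 - algebraMap K F (p 0)) * MvPolynomial.aeval x g := by
  induction f using MvPolynomial.induction_on with
  | C c => exact ⟨1, 0, by simp, by simp⟩
  | add f f' hf hf' =>
    obtain ⟨h, g, hh, hg⟩ := hf
    obtain ⟨h', g', hh', hg'⟩ := hf'
    refine ⟨h * h', h' * g + h * g', by simp [hh, hh'], ?_⟩
    simp only [map_add, map_mul]
    linear_combination MvPolynomial.aeval x h' * hg + MvPolynomial.aeval x h * hg'
  | mul_X f i hf =>
    obtain ⟨h, g, hh, hg⟩ := hf
    obtain ⟨h', g', hh', hg'⟩ := hX i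
    refine ⟨h * h', h' * g * MvPolynomial.X i + h * MvPolynomial.C (MvPolynomial.eval p f) * g',
      by simp [hh, hh'], ?_⟩
    simp only [map_add, map_mul, MvPolynomial.aeval_X, MvPolynomial.eval_X, MvPolynomial.aeval_C]
    linear_combination MvPolynomial.aeval x h' * x i * hg
      + MvPolynomial.aeval x h * algebraMap K F (MvPolynomial.eval p f) * hg'

/-- As long as the cofactor vanishes at `p`, another factor `x 0 - p 0` can be extracted. The bound
`n` makes this finite without knowing yet that the process stops. -/
theorem exists_eq_pow_mul_or {x : Fin 3 → F} {p : Fin 3 → K}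
    (hX : ∀ i, ∃ h g : MvPolynomial (Fin 3) K, MvPolynomial.eval p h ≠ 0 ∧
      MvPolynomial.aeval x h * (x i - algebraMap K F (p i))
        = (x 0 - algebraMap K F (p 0)) * MvPolynomial.aeval x g) (f : MvPolynomial (Fin 3) K)
    (n : ℕ) :
    ∃ (k : ℕ) (h g : MvPolynomial (Fin 3) K), MvPolynomial.eval p h ≠ 0 ∧
      MvPolynomial.aeval x h * MvPolynomial.aeval x f
        = (x 0 - algebraMap K F (p 0)) ^ k * MvPolynomial.aeval x g ∧
      (MvPolynomial.eval p g ≠ 0 ∨ k = n) := by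
  induction n with
  | zero => exact ⟨0, 1, f, by simp, by simp, Or.inr rfl⟩
  | succ n ih =>
    obtain ⟨k, h, g, hh, hg, hor⟩ := ih
    by_cases hpg : MvPolynomial.eval p g = 0
    · obtain rfl := hor.resolve_left (not_not.2 hpg)
      obtain ⟨h', g', hh', hg'⟩ := exists_mul_sub_eval_eq hX g
      rw [hpg, map_zero, sub_zero] at hg'
      refine ⟨k + 1, h' * h, g', by simp [hh, hh'], ?_, Or.inr rfl⟩
      rw [map_mul]
      linear_combination MvPolynomial.aeval x h' * hg
        + (x 0 - algebraMap K F (p 0)) ^ k * hg'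
    · exact ⟨k, h, g, hh, hg, Or.inl hpg⟩

end LocalRing

/-! ### Places above `S` and points of the tower equations. -/

namespace IsGSTower

open FFPlace

variable {K : Type*} [Field K] {q : ℕ} {F : Type*} [Field F] [Algebra K F]
  [Algebra (RatFunc K) F] [IsScalarTower K (RatFunc K) F] {x₁ x₂ : F}

/-- The coordinates `x₀, x₁, x₂`. -/
noncomputable def coords (K : Type*) [Field K] {F : Type*} [Field F] [Algebra (RatFunc K) F]
    (x₁ x₂ : F) : Fin 3 → F := ![algebraMap (RatFunc K) F RatFunc.X, x₁, x₂]

omit [IsScalarTower K (RatFunc K) F] in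
theorem atPoint_iff {Q : FFPlace K F} {p : K × K × K} :
    Q.AtPoint (coords K x₁ x₂) p ↔ Q.HasValue (algebraMap (RatFunc K) F RatFunc.X) p.1 ∧
      Q.HasValue x₁ p.2.1 ∧ Q.HasValue x₂ p.2.2 := by
  simp [AtPoint, coords, Fin.forall_fin_succ]

omit [IsScalarTower K (RatFunc K) F] in
theorem atPoint_unique {Q : FFPlace K F} {p p' : K × K × K}
    (h : Q.AtPoint (coords K x₁ x₂) p) (h' : Q.AtPoint (coords K x₁ x₂) p') : p = p' := by
  rw [atPoint_iff] at h h'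
  exact Prod.ext (h.1.unique h'.1) (Prod.ext (h.2.1.unique h'.2.1) (h.2.2.unique h'.2.2))

omit [IsScalarTower K (RatFunc K) F] in
theorem hasValue_towerFun {Q : FFPlace K F} {p : K × K × K}
    (h : Q.AtPoint (coords K x₁ x₂) p) (a : Fin (q + 1) × Fin q × Fin (q - 1) → K) :
    Q.HasValue (towerFun q a (algebraMap (RatFunc K) F RatFunc.X) x₁ x₂)
      (towerFun q a p.1 p.2.1 p.2.2) := by
  have h1 := HasValue.aeval h (∑ i, MvPolynomial.C (a i) *
    (MvPolynomial.X 0 ^ (i.1 : ℕ) * MvPolynomial.X 1 ^ (i.2.1 : ℕ) *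
      MvPolynomial.X 2 ^ (i.2.2 : ℕ)))
  simpa [towerFun, coords] using h1

variable [Finite K]

/-- Complete splitting: once `x₀` has a residue of nonzero trace, the equations force residues of
`x₁` and `x₂` in `K`. -/
theorem mem_placesAbove_iff_exists_atPoint (H : IsGSTower K q x₁ x₂) (Q : FFPlace K F) :
    Q ∈ (placesAbove (placesS K q) : Set (FFPlace K F)) ↔
      ∃ p ∈ towerPoints K q, Q.AtPoint (coords K x₁ x₂) p := by
  rw [mem_placesAbove_iff]
  constructor
  · rintro ⟨c, hc, hQ⟩
    have hK := Q.valuation_algebraMap_le_one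
    have h0 := (Q.hasValue_iff _ _).1 hQ
    obtain ⟨b₁, hb₁, h1⟩ := exists_residue_of_tower_eq Q.ring.valuation hK H.two_le H.card_eq hc
      H.eq₁ h0
    obtain ⟨b₂, hb₂, h2⟩ := exists_residue_of_tower_eq Q.ring.valuation hK H.two_le H.card_eq
      (trq_ne_zero_of_tower_eq H.two_le hc hb₁) H.eq₂ h1
    exact ⟨(c, b₁, b₂), ⟨hc, hb₁, hb₂⟩, atPoint_iff.2
      ⟨hQ, (Q.hasValue_iff _ _).2 h1, (Q.hasValue_iff _ _).2 h2⟩⟩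
  · rintro ⟨p, hp, hQ⟩
    exact ⟨p.1, hp.1, (atPoint_iff.1 hQ).1⟩

-- A valuation ring of the algebraic closure centred at `x₀ = p.1` is pulled back along an embedding
-- that reduces to `p`.
open Polynomial in
theorem exists_place_atPoint (H : IsGSTower K q x₁ x₂) {p : K × K × K}
    (hp : p ∈ towerPoints K q) : ∃ Q : FFPlace K F, Q.AtPoint (coords K x₁ x₂) p := by
  let L := AlgebraicClosure (RatFunc K)
  have hxt : Transcendental K (algebraMap (RatFunc K) L RatFunc.X) :=
    transcendental_algebraMap_ratFunc_X
  obtain ⟨W, hK, -, hlt⟩ := exists_valuationSubring_of_not_isUnit hxt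
    (p := X - C p.1) (not_isUnit_X_sub_C p.1)
  have h0 : W.valuation (algebraMap (RatFunc K) L RatFunc.X - algebraMap K L p.1) < 1 := by
    simpa using hlt
  obtain ⟨σ, h1, h2⟩ := H.exists_algHom_near W.valuation hK hp h0
  have hσK : ∀ c : K, σ (algebraMap K F c) = algebraMap K L c := fun c => by
    rw [IsScalarTower.algebraMap_apply K (RatFunc K) F, AlgHom.commutes,
      ← IsScalarTower.algebraMap_apply]
  have hval : ∀ (f : F) (c : K), W.valuation (σ f - algebraMap K L c) < 1 →
      f - algebraMap K F c ∈ (W.comap (σ : F →+* L)).nonunits := fun f c h => by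
    rw [ValuationSubring.mem_nonunits_comap, ValuationSubring.mem_nonunits_iff]
    simpa [hσK] using h
  have h0' := hval (algebraMap (RatFunc K) F RatFunc.X) p.1 (by rwa [AlgHom.commutes])
  refine ⟨⟨W.comap (σ : F →+* L), fun a => ?_, fun h => ?_⟩,
    atPoint_iff.2 ⟨h0', hval _ _ h1, hval _ _ h2⟩⟩
  · rw [ValuationSubring.mem_comap]
    change σ (algebraMap K F a) ∈ W
    rw [hσK, ← ValuationSubring.valuation_le_one_iff]
    exact hK a
  · rw [h, ValuationSubring.mem_nonunits_iff_or] at h0'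
    refine h0'.elim (fun h' => ?_) fun h' => h' (ValuationSubring.mem_top _)
    refine (transcendental_algebraMap_ratFunc_X (K := K) (E := F)) ?_
    rw [sub_eq_zero.1 h']
    exact isAlgebraic_algebraMap _

/-! ### A place is determined by its point -/

-- As `z⁻¹` is algebraic over `K[x₀]`, some nonzero `r` in `K[x₀]` makes `r * z⁻¹` integral, so `r`
-- has value at most that of `z`; and `r` is a power of `x₀ - c` times a unit at `Q`. This bounds
-- the order of vanishing of `z`.
omit [Finite K] in
open Polynomial in
theorem exists_pow_le_valuation (H : IsGSTower K q x₁ x₂) {Q : FFPlace K F} {c : K}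
    (hQ : Q.HasValue (algebraMap (RatFunc K) F RatFunc.X) c) {z : F} (hz : z ≠ 0) :
    ∃ m : ℕ, Q.ring.valuation (algebraMap (RatFunc K) F RatFunc.X - algebraMap K F c) ^ m
      ≤ Q.ring.valuation z := by
  have := H.finiteDimensional
  set v := Q.ring.valuation with hv
  set x := algebraMap (RatFunc K) F RatFunc.X
  have hK := Q.valuation_algebraMap_le_one
  have hx1 : v x ≤ 1 := hQ.valuation_le_one
  let _ : Algebra K[X] F :=
    ((algebraMap (RatFunc K) F).comp (algebraMap K[X] (RatFunc K))).toAlgebra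
  have : IsScalarTower K[X] (RatFunc K) F := IsScalarTower.of_algebraMap_eq fun _ => rfl
  have hmap : ∀ r : K[X], algebraMap K[X] F r = aeval x r := fun r =>
    (aeval_algebraMap_ratFunc_X r).symm
  have halg : IsAlgebraic K[X] z⁻¹ :=
    (IsFractionRing.isAlgebraic_iff K[X] (RatFunc K) F).2
      (Algebra.IsAlgebraic.isAlgebraic (R := RatFunc K) z⁻¹)
  obtain ⟨r, hr0, hint⟩ := halg.exists_integral_multiple
  have hle : v (r • z⁻¹) ≤ 1 := by
    obtain ⟨P, hP, hPz⟩ := hint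
    have hmem : ∀ r : K[X], algebraMap K[X] F r ∈ Q.ring := fun r => by
      rw [← ValuationSubring.valuation_le_one_iff, hmap]
      exact valuation_aeval_le_one v hK hx1 r
    have hint' : IsIntegral Q.ring (r • z⁻¹) :=
      ⟨P.map ((algebraMap K[X] F).codRestrict Q.ring hmem), hP.map _, by
        rw [eval₂_map]; exact hPz⟩
    obtain ⟨y, hy⟩ := IsIntegrallyClosed.isIntegral_iff.1 hint'
    rw [hv, ValuationSubring.valuation_le_one_iff, ← hy]
    exact y.2
  obtain ⟨P, hP, hdvd⟩ := exists_eq_pow_rootMultiplicity_mul_and_not_dvd r hr0 c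
  have hlt : v (aeval x (X - C c)) < 1 := by simpa [hv] using (Q.hasValue_iff _ _).1 hQ
  have h1 := congrArg (fun r => v (aeval x r)) hP
  simp only [map_mul, map_pow] at h1
  rw [valuation_aeval_eq_one_of_isCoprime v hK hx1
    (((irreducible_X_sub_C c).coprime_iff_not_dvd).2 hdvd) hlt, mul_one] at h1
  refine ⟨r.rootMultiplicity c, ?_⟩
  have h4 : aeval x (X - C c) = x - algebraMap K F c := by simp
  rw [← h4, ← map_pow, ← map_pow, map_pow, map_pow, ← h1]
  rw [Algebra.smul_def, hmap, map_mul, map_inv₀] at hle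
  exact ((mul_inv_le_iff₀ (zero_lt_iff.2 ((Valuation.ne_zero_iff v).2 hz))).1 hle).trans_eq
    (one_mul _)

omit [Finite K] in
theorem exists_eq_div (H : IsGSTower K q x₁ x₂) (z : F) :
    ∃ g h : MvPolynomial (Fin 3) K, MvPolynomial.aeval (coords K x₁ x₂) h ≠ 0 ∧
      z * MvPolynomial.aeval (coords K x₁ x₂) h = MvPolynomial.aeval (coords K x₁ x₂) g := by
  have hz : z ∈ IntermediateField.adjoin (RatFunc K) {x₁, x₂} := by
    rw [H.adjoin_eq]; exact IntermediateField.mem_top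
  induction hz using IntermediateField.adjoin_induction with
  | mem y hy =>
    rcases hy with rfl | rfl
    · exact ⟨MvPolynomial.X 1, 1, by simp, by simp [coords]⟩
    · exact ⟨MvPolynomial.X 2, 1, by simp, by simp [coords]⟩
  | algebraMap f =>
    have hp : ∀ r : Polynomial K, MvPolynomial.aeval (coords K x₁ x₂)
        (Polynomial.aeval (MvPolynomial.X 0 : MvPolynomial (Fin 3) K) r)
        = algebraMap (RatFunc K) F (algebraMap (Polynomial K) (RatFunc K) r) := fun r => by
      rw [← Polynomial.aeval_algHom_apply, MvPolynomial.aeval_X, ← aeval_algebraMap_ratFunc_X]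
      rfl
    have h0 := (map_ne_zero_iff _ (RatFunc.algebraMap_injective K)).2 (RatFunc.denom_ne_zero f)
    refine ⟨Polynomial.aeval (MvPolynomial.X 0) f.num, Polynomial.aeval (MvPolynomial.X 0) f.denom,
      ?_, ?_⟩
    · rw [hp]; exact (map_ne_zero _).2 h0
    · rw [hp, hp, ← map_mul]
      congr 1
      rw [← eq_div_iff h0, RatFunc.num_div_denom]
  | add y z _ _ hy hz =>
    obtain ⟨g, h, hh, e⟩ := hy
    obtain ⟨g', h', hh', e'⟩ := hz
    refine ⟨g * h' + g' * h, h * h', by rw [map_mul]; exact mul_ne_zero hh hh', ?_⟩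
    simp only [map_mul, map_add]
    linear_combination MvPolynomial.aeval (coords K x₁ x₂) h' * e
      + MvPolynomial.aeval (coords K x₁ x₂) h * e'
  | inv y _ hy =>
    obtain ⟨g, h, hh, e⟩ := hy
    by_cases hy0 : y = 0
    · exact ⟨0, 1, by simp, by simp [hy0]⟩
    · refine ⟨h, g, by rw [← e]; exact mul_ne_zero hy0 hh, ?_⟩
      rw [← e, inv_mul_cancel_left₀ hy0]
  | mul y z _ _ hy hz =>
    obtain ⟨g, h, hh, e⟩ := hy
    obtain ⟨g', h', hh', e'⟩ := hz
    refine ⟨g * g', h * h', by rw [map_mul]; exact mul_ne_zero hh hh', ?_⟩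
    simp only [map_mul]
    linear_combination z * MvPolynomial.aeval (coords K x₁ x₂) h' * e
      + MvPolynomial.aeval (coords K x₁ x₂) g * e'

/-- Each polynomial in the coordinates that is nonzero in `F` is a power of `π = x₀ - p.1` times a
function that is a unit at all places over `p`. The exponent is thus common to `Q` and `Q'`, and so
is integrality of quotients. -/
theorem place_le_of_atPoint (H : IsGSTower K q x₁ x₂) {p : K × K × K} (hp : p ∈ towerPoints K q)
    {Q Q' : FFPlace K F} (hQ : Q.AtPoint (coords K x₁ x₂) p)
    (hQ' : Q'.AtPoint (coords K x₁ x₂) p) : Q.ring ≤ Q'.ring := by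
  have hq := H.two_le
  set x := coords K x₁ x₂ with hx
  set P : Fin 3 → K := ![p.1, p.2.1, p.2.2] with hP
  obtain ⟨h0, h1, h2⟩ := hp
  have h1' := trq_ne_zero_of_tower_eq hq h0 h1
  have hu : ∀ i, trq q (P i) ≠ 0 → x i ^ (q - 1) + 1 ≠ 0 := fun i hi h => by
    have h3 := (HasValue.aeval hQ (MvPolynomial.X i ^ (q - 1) + 1)).valuation_eq_one
      (by simpa using (gsMap_ne_zero hq hi).2.1)
    simp [h] at h3
  have hX : ∀ i, ∃ h g : MvPolynomial (Fin 3) K, MvPolynomial.eval P h ≠ 0 ∧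
      MvPolynomial.aeval x h * (x i - algebraMap K F (P i))
        = (x 0 - algebraMap K F (P 0)) * MvPolynomial.aeval x g := by
    have hX1 := exists_mul_sub_eq_of_tower_eq hq H.card_eq (x := x) (p := P) (i := 0) (j := 1)
      (hu 0 h0) h0 H.eq₁ h1
    have hX2 := exists_mul_sub_eq_of_tower_eq hq H.card_eq (x := x) (p := P) (i := 1) (j := 2)
      (hu 1 h1') h1' H.eq₂ h2
    intro i
    fin_cases i
    · exact ⟨1, 1, by simp, by simp⟩
    · exact hX1
    · obtain ⟨h, g, hh, hg⟩ := hX1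
      obtain ⟨h', g', hh', hg'⟩ := hX2
      refine ⟨h * h', g * g', by simp [hh, hh'], ?_⟩
      simp only [map_mul]
      change _ * (x 2 - algebraMap K F (P 2)) = _
      linear_combination MvPolynomial.aeval x h * hg' + MvPolynomial.aeval x g' * hg
  set π := x 0 - algebraMap K F (P 0) with hπ
  have hπ0 : π ≠ 0 := by
    intro h
    refine (transcendental_algebraMap_ratFunc_X (K := K) (E := F)) ?_
    change IsAlgebraic K (x 0)
    rw [sub_eq_zero.1 h]
    exact isAlgebraic_algebraMap _
  have hπQ : Q.ring.valuation π < 1 := (Q.hasValue_iff _ _).1 (hQ 0)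
  have hπQ' : Q'.ring.valuation π < 1 := (Q'.hasValue_iff _ _).1 (hQ' 0)
  have key : ∀ f : MvPolynomial (Fin 3) K, MvPolynomial.aeval x f ≠ 0 → ∃ k : ℕ,
      Q.ring.valuation (MvPolynomial.aeval x f) = Q.ring.valuation π ^ k ∧
      Q'.ring.valuation (MvPolynomial.aeval x f) = Q'.ring.valuation π ^ k := by
    intro f hf
    obtain ⟨m, hm⟩ := H.exists_pow_le_valuation (hQ 0) hf
    -- Extracting `m + 1` factors would contradict `hm`, so the extraction must have ended with a
    -- unit.
    obtain ⟨k, h, g, hh, hg, hor⟩ := exists_eq_pow_mul_or hX f (m + 1)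
    have e := congrArg Q.ring.valuation hg
    have e' := congrArg Q'.ring.valuation hg
    rw [map_mul, map_mul, map_pow, (HasValue.aeval hQ h).valuation_eq_one hh, one_mul] at e
    rw [map_mul, map_mul, map_pow, (HasValue.aeval hQ' h).valuation_eq_one hh, one_mul] at e'
    rcases hor with hor | rfl
    · rw [(HasValue.aeval hQ g).valuation_eq_one hor, mul_one] at e
      rw [(HasValue.aeval hQ' g).valuation_eq_one hor, mul_one] at e'
      exact ⟨k, e, e'⟩
    · exfalso
      rw [e] at hm
      have h3 := hm.trans (mul_le_of_le_one_right' (HasValue.aeval hQ g).valuation_le_one)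
      refine absurd h3 (not_le.2 ?_)
      exact pow_lt_pow_right_of_lt_one₀
        (zero_lt_iff.2 ((Valuation.ne_zero_iff _).2 hπ0)) hπQ (Nat.lt_succ_self m)
  intro z hz
  by_cases hz0 : z = 0
  · rw [hz0]; exact zero_mem _
  obtain ⟨g, h, hh, e⟩ := H.exists_eq_div z
  obtain ⟨k, hk, hk'⟩ := key h hh
  obtain ⟨l, hl, hl'⟩ := key g (by rw [← e]; exact mul_ne_zero hz0 hh)
  have e1 := congrArg Q.ring.valuation e
  have e2 := congrArg Q'.ring.valuation e
  rw [map_mul, hk, hl] at e1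
  rw [map_mul, hk', hl'] at e2
  rw [← ValuationSubring.valuation_le_one_iff] at hz ⊢
  have hlk : k ≤ l := by
    have h3 : Q.ring.valuation π ^ l ≤ Q.ring.valuation π ^ k := by
      rw [← e1]; exact mul_le_of_le_one_left' hz
    exact (pow_le_pow_iff_right_of_lt_one₀
      (zero_lt_iff.2 ((Valuation.ne_zero_iff _).2 hπ0)) hπQ).1 h3
  have h4 : Q'.ring.valuation π ^ l ≤ Q'.ring.valuation π ^ k :=
    _root_.pow_le_pow_of_le_one zero_le hπQ'.le hlk
  rw [← e2] at h4
  have h5 : 0 < Q'.ring.valuation π ^ k :=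
    zero_lt_iff.2 (pow_ne_zero _ ((Valuation.ne_zero_iff _).2 hπ0))
  exact le_of_mul_le_mul_right (by rwa [one_mul]) h5

theorem place_eq_of_atPoint (H : IsGSTower K q x₁ x₂) {p : K × K × K} (hp : p ∈ towerPoints K q)
    {Q Q' : FFPlace K F} (hQ : Q.AtPoint (coords K x₁ x₂) p)
    (hQ' : Q'.AtPoint (coords K x₁ x₂) p) : Q = Q' :=
  FFPlace.ext (le_antisymm (H.place_le_of_atPoint hp hQ hQ') (H.place_le_of_atPoint hp hQ' hQ))

/-- The places of the evaluation set correspond to the points of the tower equations. -/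
theorem exists_equiv_towerPoints (H : IsGSTower K q x₁ x₂) :
    ∃ e : (placesAbove (placesS K q) : Set (FFPlace K F)) ≃ towerPoints K q,
      ∀ Q : (placesAbove (placesS K q) : Set (FFPlace K F)),
        Q.1.AtPoint (coords K x₁ x₂) (e Q).1 := by
  have hex : ∀ Q : (placesAbove (placesS K q) : Set (FFPlace K F)), ∃ p : towerPoints K q,
      Q.1.AtPoint (coords K x₁ x₂) p.1 := fun Q => by
    obtain ⟨p, hp, h⟩ := (H.mem_placesAbove_iff_exists_atPoint Q.1).1 Q.2
    exact ⟨⟨p, hp⟩, h⟩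
  choose e he using hex
  refine ⟨Equiv.ofBijective e ⟨fun Q Q' h => ?_, fun p => ?_⟩, he⟩
  · exact Subtype.ext (H.place_eq_of_atPoint (e Q).2 (he Q) (h ▸ he Q'))
  · obtain ⟨Q, hQ⟩ := H.exists_place_atPoint p.2
    have hQ' := (H.mem_placesAbove_iff_exists_atPoint Q).2 ⟨p.1, p.2, hQ⟩
    exact ⟨⟨Q, hQ'⟩, Subtype.ext (atPoint_unique (he ⟨Q, hQ'⟩) hQ)⟩

end IsGSTower

/-! ## The Riemann-Roch space of a multiple of the pole of `x₀` -/

section RiemannRoch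

open Polynomial FFPlace

variable {K : Type*} [Field K]

theorem RatFunc.mul_denom_eq_num (f : RatFunc K) :
    f * algebraMap K[X] (RatFunc K) f.denom = algebraMap K[X] (RatFunc K) f.num := by
  rw [← eq_div_iff ((map_ne_zero_iff _ (RatFunc.algebraMap_injective K)).2
    (RatFunc.denom_ne_zero f)), RatFunc.num_div_denom]

theorem aeval_ratFunc_X (p : K[X]) :
    aeval (RatFunc.X : RatFunc K) p = algebraMap K[X] (RatFunc K) p :=
  aeval_algebraMap_ratFunc_X (E := RatFunc K) p

theorem X_notMem_placeInfty : (RatFunc.X : RatFunc K) ∉ (placeInfty K).ring := by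
  intro h
  have h' := (Valuation.mem_valuationSubring_iff _ _).1 h
  rw [RatFunc.inftyValuation.X] at h'
  exact absurd h' (by decide)

namespace FFPlace

theorem one_lt_valuation_X {P : FFPlace K (RatFunc K)} (hX : (RatFunc.X : RatFunc K) ∉ P.ring) :
    1 < P.ring.valuation (RatFunc.X : RatFunc K) := by
  rw [← not_le, ValuationSubring.valuation_le_one_iff]; exact hX

/-- The valuation of a rational function at the pole of `X`. -/
theorem valuation_mul_pow_of_X_notMem {P : FFPlace K (RatFunc K)}
    (hX : (RatFunc.X : RatFunc K) ∉ P.ring) {f : RatFunc K} (hf : f ≠ 0) :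
    P.ring.valuation f * P.ring.valuation (RatFunc.X : RatFunc K) ^ f.denom.natDegree
      = P.ring.valuation (RatFunc.X : RatFunc K) ^ f.num.natDegree := by
  have hK := P.valuation_algebraMap_le_one
  have h := congrArg P.ring.valuation (RatFunc.mul_denom_eq_num f)
  rwa [map_mul, ← aeval_ratFunc_X, ← aeval_ratFunc_X,
    valuation_aeval_of_one_lt _ hK (one_lt_valuation_X hX) (RatFunc.denom_ne_zero f),
    valuation_aeval_of_one_lt _ hK (one_lt_valuation_X hX) (RatFunc.num_ne_zero hf)] at h

theorem mem_ring_iff_of_X_notMem {P : FFPlace K (RatFunc K)}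
    (hX : (RatFunc.X : RatFunc K) ∉ P.ring) {f : RatFunc K} (hf : f ≠ 0) :
    f ∈ P.ring ↔ f.num.natDegree ≤ f.denom.natDegree := by
  have h1 := one_lt_valuation_X hX
  have h := valuation_mul_pow_of_X_notMem hX hf
  have hpos : 0 < P.ring.valuation (RatFunc.X : RatFunc K) ^ f.denom.natDegree :=
    pow_pos (zero_lt_one.trans h1) _
  rw [← ValuationSubring.valuation_le_one_iff, ← pow_le_pow_iff_right₀ h1, ← h]
  constructor
  · exact fun h' => mul_le_of_le_one_left' h'
  · exact fun h' => le_of_mul_le_mul_right (by rwa [one_mul]) hpos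

/-- Where `X` is not integral, membership of a nonzero function depends only on the degrees of
numerator and denominator. -/
theorem eq_placeInfty {P : FFPlace K (RatFunc K)} (hX : (RatFunc.X : RatFunc K) ∉ P.ring) :
    P = placeInfty K := by
  refine FFPlace.ext (SetLike.ext fun f => ?_)
  by_cases hf : f = 0
  · simp [hf, zero_mem]
  · rw [mem_ring_iff_of_X_notMem hX hf, mem_ring_iff_of_X_notMem X_notMem_placeInfty hf]

theorem isUniformizer_X_inv {P : FFPlace K (RatFunc K)}
    (hX : (RatFunc.X : RatFunc K) ∉ P.ring) : P.IsUniformizer (RatFunc.X : RatFunc K)⁻¹ := by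
  have h1 := one_lt_valuation_X hX
  have h0 := zero_lt_one.trans h1
  constructor
  · rw [ValuationSubring.mem_nonunits_iff, map_inv₀]
    exact (inv_lt_one₀ h0).2 h1
  · intro z hz
    rw [ValuationSubring.mem_nonunits_iff] at hz
    refine ⟨RatFunc.X * z, ?_, by rw [inv_mul_cancel_left₀ RatFunc.X_ne_zero]⟩
    rw [← ValuationSubring.valuation_le_one_iff, map_mul]
    by_cases hz0 : z = 0
    · simp [hz0]
    have h := valuation_mul_pow_of_X_notMem hX hz0
    have hlt : z.num.natDegree < z.denom.natDegree := by
      rw [← pow_lt_pow_iff_right₀ h1, ← h]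
      exact mul_lt_of_lt_one_left (pow_pos h0 _) hz
    refine le_of_mul_le_mul_right ?_ (pow_pos h0 z.denom.natDegree)
    rw [one_mul, mul_assoc, h, ← pow_succ']
    exact pow_le_pow_right₀ h1.le hlt

/-- At the pole of `X` a polynomial has order minus its degree. -/
theorem hasOrd_of_X_notMem {P : FFPlace K (RatFunc K)} (hX : (RatFunc.X : RatFunc K) ∉ P.ring)
    {p : K[X]} (hp : p ≠ 0) : P.HasOrd (algebraMap K[X] (RatFunc K) p) (-p.natDegree) := by
  have h0 := (zero_lt_one.trans (one_lt_valuation_X hX)).ne'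
  have hv : P.ring.valuation (algebraMap K[X] (RatFunc K) p * RatFunc.X⁻¹ ^ p.natDegree) = 1 := by
    rw [map_mul, ← aeval_ratFunc_X, valuation_aeval_of_one_lt _ P.valuation_algebraMap_le_one
      (one_lt_valuation_X hX) hp, map_pow, map_inv₀, ← mul_pow, mul_inv_cancel₀ h0, one_pow]
  refine ⟨_, algebraMap K[X] (RatFunc K) p * RatFunc.X⁻¹ ^ p.natDegree, isUniformizer_X_inv hX,
    ?_, ?_, ?_, ?_⟩
  · rw [← ValuationSubring.valuation_le_one_iff, hv]
  · rw [← ValuationSubring.valuation_le_one_iff, map_inv₀, hv, inv_one]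
  · rw [← Valuation.ne_zero_iff P.ring.valuation, hv]; exact one_ne_zero
  · rw [zpow_neg, zpow_natCast, mul_comm (algebraMap _ _ p), ← mul_assoc,
      inv_mul_cancel₀ (pow_ne_zero _ (inv_ne_zero RatFunc.X_ne_zero)), one_mul]

/-- At a place that is not the pole of `X`, the polynomials vanishing at the place are the
multiples of one of them. -/
theorem exists_dvd_iff {P : FFPlace K (RatFunc K)} (hX : (RatFunc.X : RatFunc K) ∈ P.ring) :
    ∃ π : K[X], π ≠ 0 ∧ ∀ g : K[X],
      P.ring.valuation (algebraMap K[X] (RatFunc K) g) < 1 ↔ π ∣ g := by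
  have hK := P.valuation_algebraMap_le_one
  have hX' := (ValuationSubring.valuation_le_one_iff _ _).2 hX
  have hle : ∀ g : K[X], P.ring.valuation (algebraMap K[X] (RatFunc K) g) ≤ 1 := fun g => by
    rw [← aeval_ratFunc_X]; exact valuation_aeval_le_one _ hK hX' g
  let I : Ideal K[X] :=
    { carrier := {g | P.ring.valuation (algebraMap K[X] (RatFunc K) g) < 1}
      zero_mem' := by simp
      add_mem' := fun {a b} ha hb => by
        change P.ring.valuation _ < 1
        rw [map_add]
        exact Valuation.map_add_lt _ ha hb
      smul_mem' := fun c g hg => by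
        change P.ring.valuation _ < 1
        rw [smul_eq_mul, map_mul, map_mul]
        exact (mul_le_of_le_one_left' (hle c)).trans_lt hg }
  have hI : ∀ g, g ∈ I ↔ P.ring.valuation (algebraMap K[X] (RatFunc K) g) < 1 := fun _ => Iff.rfl
  refine ⟨Submodule.IsPrincipal.generator I, ?_, fun g => ?_⟩
  -- If the ideal were zero, every denominator would be a unit and `P.ring` would be the whole
  -- field.
  · intro h
    rw [← Submodule.IsPrincipal.eq_bot_iff_generator_eq_zero] at h
    refine P.ne_top (eq_top_iff.2 fun f _ => ?_)
    have h1 : P.ring.valuation (algebraMap K[X] (RatFunc K) f.denom) = 1 := by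
      refine (hle _).antisymm (not_lt.1 fun hlt => RatFunc.denom_ne_zero f ?_)
      rwa [← hI, h, Ideal.mem_bot] at hlt
    have h2 := congrArg P.ring.valuation (RatFunc.mul_denom_eq_num f)
    rw [map_mul, h1, mul_one] at h2
    rw [← ValuationSubring.valuation_le_one_iff, h2]
    exact hle _
  · rw [← hI, ← Submodule.IsPrincipal.mem_iff_generator_dvd]

/-- At a place that is not the pole of `X`, a nonzero polynomial has nonnegative order. -/
theorem exists_hasOrd_of_X_mem {P : FFPlace K (RatFunc K)}
    (hX : (RatFunc.X : RatFunc K) ∈ P.ring) {p : K[X]} (hp : p ≠ 0) :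
    ∃ n : ℕ, P.HasOrd (algebraMap K[X] (RatFunc K) p) n := by
  have hK := P.valuation_algebraMap_le_one
  have hX' := (ValuationSubring.valuation_le_one_iff _ _).2 hX
  have hle : ∀ g : K[X], P.ring.valuation (algebraMap K[X] (RatFunc K) g) ≤ 1 := fun g => by
    rw [← aeval_ratFunc_X]; exact valuation_aeval_le_one _ hK hX' g
  obtain ⟨π, hπ0, hπ⟩ := exists_dvd_iff hX
  have hunit : ∀ g : K[X], ¬π ∣ g → P.ring.valuation (algebraMap K[X] (RatFunc K) g) = 1 :=
    fun g hg => (hle g).antisymm (not_lt.1 fun h => hg ((hπ g).1 h))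
  have hπlt := (hπ π).2 dvd_rfl
  have hπu : ¬IsUnit π := fun h => by
    have h1 := (hπ 1).2 h.dvd
    simp at h1
  obtain ⟨u, hu, hndvd⟩ :=
    (FiniteMultiplicity.of_not_isUnit hπu hp).exists_eq_pow_mul_and_not_dvd
  refine ⟨multiplicity π p, algebraMap K[X] (RatFunc K) π, algebraMap K[X] (RatFunc K) u,
    ⟨(ValuationSubring.mem_nonunits_iff _).2 hπlt, fun z hz => ?_⟩, ?_, ?_, ?_, ?_⟩
  · rw [ValuationSubring.mem_nonunits_iff] at hz
    have h1 := congrArg P.ring.valuation (RatFunc.mul_denom_eq_num z)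
    rw [map_mul] at h1
    have hnum : π ∣ z.num := by
      rw [← hπ, ← h1]
      exact (mul_le_of_le_one_right' (hle _)).trans_lt hz
    have hden : ¬π ∣ z.denom := fun h =>
      hπu ((RatFunc.isCoprime_num_denom z).isUnit_of_dvd' hnum h)
    obtain ⟨w, hw⟩ := hnum
    have h0 := (map_ne_zero_iff _ (RatFunc.algebraMap_injective K)).2 (RatFunc.denom_ne_zero z)
    refine ⟨algebraMap K[X] (RatFunc K) w / algebraMap K[X] (RatFunc K) z.denom, ?_, ?_⟩
    · rw [← ValuationSubring.valuation_le_one_iff, map_div₀, hunit _ hden, div_one]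
      exact hle w
    · rw [← mul_div_assoc, ← map_mul, ← hw, RatFunc.num_div_denom]
  · rw [← ValuationSubring.valuation_le_one_iff]; exact hle u
  · rw [← ValuationSubring.valuation_le_one_iff, map_inv₀, hunit u hndvd, inv_one]
  · rw [← Valuation.ne_zero_iff P.ring.valuation, hunit u hndvd]; exact one_ne_zero
  · rw [zpow_natCast, ← map_pow, ← map_mul, ← hu]

theorem HasOrd.mem_ring {F : Type*} [Field F] [Algebra K F] {P : FFPlace K F} {f : F} {n : ℤ}
    (h : P.HasOrd f n) (hn : 0 ≤ n) : f ∈ P.ring := by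
  obtain ⟨t, u, ht, hu, -, -, rfl⟩ := h
  obtain ⟨m, rfl⟩ := Int.eq_ofNat_of_zero_le hn
  rw [zpow_natCast]
  exact mul_mem (pow_mem (ValuationSubring.nonunits_subset ht.1) _) hu

/-- The parameter `t` witnessing the order is arbitrary, but `X⁻¹` is an integral multiple of it, so
`t` has value at least that of `X⁻¹`; integrality of `p * t ^ q` then bounds the degree. -/
theorem natDegree_le_of_hasOrd {P : FFPlace K (RatFunc K)}
    (hX : (RatFunc.X : RatFunc K) ∉ P.ring) {p : K[X]} (hp : p ≠ 0) {n : ℤ} {q : ℕ}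
    (h : P.HasOrd (algebraMap K[X] (RatFunc K) p) n) (hn : -(q : ℤ) ≤ n) :
    p.natDegree ≤ q := by
  have h1 := one_lt_valuation_X hX
  have h0 := zero_lt_one.trans h1
  obtain ⟨t, u, ht, hu, -, -, he⟩ := h
  obtain ⟨w, hw, htw⟩ := ht.2 _ (isUniformizer_X_inv hX).1
  have ht0 : t ≠ 0 := by
    rintro rfl
    rw [zero_mul] at htw
    exact inv_ne_zero RatFunc.X_ne_zero htw
  obtain ⟨m, hm⟩ := Int.eq_ofNat_of_zero_le (by omega : 0 ≤ n + q)
  have he' : algebraMap K[X] (RatFunc K) p * t ^ q = t ^ m * u := by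
    rw [he, mul_right_comm, ← zpow_natCast t q, ← zpow_add₀ ht0, hm, zpow_natCast]
  have hmem : P.ring.valuation (algebraMap K[X] (RatFunc K) p * t ^ q) ≤ 1 := by
    rw [he', ValuationSubring.valuation_le_one_iff]
    exact mul_mem (pow_mem (ValuationSubring.nonunits_subset ht.1) _) hu
  rw [map_mul, map_pow, ← aeval_ratFunc_X,
    valuation_aeval_of_one_lt _ P.valuation_algebraMap_le_one h1 hp] at hmem
  have hle : (P.ring.valuation (RatFunc.X : RatFunc K))⁻¹ ≤ P.ring.valuation t := by
    rw [← map_inv₀, htw, map_mul]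
    exact mul_le_of_le_one_right' ((ValuationSubring.valuation_le_one_iff _ _).2 hw)
  rw [← pow_le_pow_iff_right₀ h1]
  have h2 := (mul_le_mul_right (pow_le_pow_left₀ zero_le hle q)
    (P.ring.valuation (RatFunc.X : RatFunc K) ^ p.natDegree)).trans hmem
  rw [inv_pow] at h2
  exact ((mul_inv_le_iff₀ (pow_pos h0 _)).1 h2).trans_eq (one_mul _)

end FFPlace

/-- The Riemann-Roch space of `q P_∞` consists of the polynomials of degree at most `q`. -/
theorem mem_riemannRoch_iff (q : ℕ) (f : RatFunc K) :
    f ∈ riemannRoch (Finsupp.single (placeInfty K) (q : ℤ)) ↔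
      ∃ p : K[X], p.natDegree ≤ q ∧ f = algebraMap K[X] (RatFunc K) p := by
  classical
  constructor
  · rintro (rfl | h)
    · exact ⟨0, by simp, by simp⟩
    · obtain ⟨p, rfl⟩ := ratFunc_eq_polynomial_of_valuation_le_one (E := RatFunc K) f (by
        intro W hK hX
        rw [Algebra.algebraMap_self_apply] at hX ⊢
        rw [ValuationSubring.valuation_le_one_iff] at hX ⊢
        -- The trivial valuation ring is not a place and is treated apart.
        by_cases hW : W = ⊤
        · rw [hW]; exact ValuationSubring.mem_top _
        obtain ⟨n, hn, hle⟩ := h ⟨W, fun c => by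
          rw [← ValuationSubring.valuation_le_one_iff]; exact hK c, hW⟩
        refine hn.mem_ring (?_ : 0 ≤ n)
        rw [Finsupp.single_apply, if_neg] at hle
        · simpa using hle
        · intro heq
          have hW' : W = (placeInfty K).ring := (congrArg FFPlace.ring heq).symm
          exact X_notMem_placeInfty (hW' ▸ hX))
      by_cases hp : p = 0
      · exact ⟨0, by simp, by simp [hp]⟩
      obtain ⟨n, hn, hle⟩ := h (placeInfty K)
      rw [Finsupp.single_eq_same] at hle
      exact ⟨p, natDegree_le_of_hasOrd X_notMem_placeInfty hp hn hle, rfl⟩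
  · rintro ⟨p, hp, rfl⟩
    by_cases hp0 : p = 0
    · exact Or.inl (by simp [hp0])
    refine Or.inr fun P => ?_
    by_cases hX : (RatFunc.X : RatFunc K) ∈ P.ring
    · obtain ⟨n, hn⟩ := exists_hasOrd_of_X_mem hX hp0
      refine ⟨n, hn, ?_⟩
      rw [Finsupp.single_apply]
      split_ifs <;> omega
    · refine ⟨_, hasOrd_of_X_notMem hX hp0, ?_⟩
      rw [eq_placeInfty hX, Finsupp.single_eq_same]
      omega

variable {F : Type*} [Field F] [Algebra K F] [Algebra (RatFunc K) F]
  [IsScalarTower K (RatFunc K) F]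

/-- The evaluation of a coefficient vector, as a linear map. -/
def towerLin (K : Type*) [Field K] {E : Type*} [Field E] [Algebra K E] (q : ℕ) (x₀ x₁ x₂ : E) :
    (Fin (q + 1) × Fin q × Fin (q - 1) → K) →ₗ[K] E where
  toFun a := towerFun q a x₀ x₁ x₂
  map_add' a b := by simp [towerFun, add_mul, Finset.sum_add_distrib]
  map_smul' c a := by simp [towerFun, mul_assoc, Finset.mul_sum, Algebra.smul_def]

theorem towerFun_single {E : Type*} [Field E] [Algebra K E] {q : ℕ}
    (i : Fin (q + 1) × Fin q × Fin (q - 1)) (c : K) (x₀ x₁ x₂ : E) :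
    towerFun q (Pi.single i c) x₀ x₁ x₂
      = algebraMap K E c * (x₀ ^ (i.1 : ℕ) * x₁ ^ (i.2.1 : ℕ) * x₂ ^ (i.2.2 : ℕ)) := by
  rw [towerFun, Finset.sum_eq_single i]
  · simp
  · intro j _ hj
    simp [hj]
  · simp

/-- The space `V` consists of the functions `towerFun q a`. -/
theorem spaceV_eq_range (q : ℕ) (x₁ x₂ : F) :
    spaceV (Finsupp.single (placeInfty K) (q : ℤ)) q q x₁ x₂
      = LinearMap.range (towerLin K q (algebraMap (RatFunc K) F RatFunc.X) x₁ x₂) := by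
  apply le_antisymm
  · refine Submodule.span_le.2 ?_
    rintro _ ⟨f, hf, e₁, e₂, h₁, h₂, rfl⟩
    obtain ⟨p, hp, rfl⟩ := (mem_riemannRoch_iff q f).1 hf
    rw [← aeval_algebraMap_ratFunc_X, aeval_eq_sum_range' (n := q + 1) (by omega),
      Finset.sum_mul, Finset.sum_mul]
    refine Submodule.sum_mem _ fun i hi => ⟨Pi.single (⟨i, Finset.mem_range.1 hi⟩, ⟨e₁, by omega⟩,
      ⟨e₂, by omega⟩) (p.coeff i), ?_⟩
    change towerFun q _ _ _ _ = _
    rw [towerFun_single, Algebra.smul_def]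
    ring
  · rintro _ ⟨a, rfl⟩
    refine Submodule.sum_mem _ fun i _ => ?_
    rw [← Algebra.smul_def]
    refine Submodule.smul_mem _ _ (Submodule.subset_span ⟨RatFunc.X ^ (i.1 : ℕ), ?_, i.2.1, i.2.2,
      by omega, by omega, by rw [map_pow]⟩)
    refine (mem_riemannRoch_iff q _).2 ⟨X ^ (i.1 : ℕ), ?_, by simp⟩
    rw [natDegree_X_pow]
    omega

end RiemannRoch

/-! ## Counting points -/

theorem Set.ncard_eq_mul_of_fibers {A B : Type*} [Finite A] [Finite B] {s : Set A} {t : Set B}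
    (f : A → B) {m : ℕ} (hf : ∀ a ∈ s, f a ∈ t) (hm : ∀ b ∈ t, {a ∈ s | f a = b}.ncard = m) :
    s.ncard = t.ncard * m := by
  classical
  have := Fintype.ofFinite A
  have := Fintype.ofFinite B
  rw [Set.ncard_eq_toFinset_card' s, Set.ncard_eq_toFinset_card' t,
    Finset.card_eq_sum_card_fiberwise (f := f) (t := t.toFinset) (fun a ha => by
      simpa using hf a (by simpa using ha))]
  refine Finset.sum_const_nat fun b hb => ?_
  rw [← hm b (by simpa using hb), Set.ncard_eq_toFinset_card']
  congr 1
  ext a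
  simp

section PointCount

variable {K : Type*} [Field K] [Finite K] {q : ℕ}

theorem ncard_towerPoints_fst_snd (hq : 2 ≤ q) (hK : Nat.card K = q ^ 2) {c₀ c₁ : K}
    (h₀ : trq q c₀ ≠ 0) (h₁ : trq q c₁ = gsMap q c₀) :
    {p ∈ towerPoints K q | p.1 = c₀ ∧ p.2.1 = c₁}.ncard = q := by
  refine Eq.trans ?_ (ncard_trq_eq hq hK (gsMap_pow hq hK c₁))
  rw [← Set.ncard_image_of_injective
    {y : K | trq q y = gsMap q c₁} (f := fun y => (c₀, c₁, y)) (fun a b h => by simpa using h)]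
  congr 1
  ext ⟨a, b, c⟩
  simp only [towerPoints, Set.mem_ofPred_eq, Set.mem_image, Prod.mk.injEq]
  constructor
  · rintro ⟨⟨-, -, h⟩, rfl, rfl⟩
    exact ⟨c, h, rfl, rfl, rfl⟩
  · rintro ⟨y, h, rfl, rfl, rfl⟩
    exact ⟨⟨h₀, h₁, h⟩, rfl, rfl⟩

theorem ncard_towerPoints_fst (hq : 2 ≤ q) (hK : Nat.card K = q ^ 2) {c₀ : K}
    (h₀ : trq q c₀ ≠ 0) : {p ∈ towerPoints K q | p.1 = c₀}.ncard = q * q := by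
  rw [Set.ncard_eq_mul_of_fibers (t := {y : K | trq q y = gsMap q c₀}) (m := q)
    (fun p : K × K × K => p.2.1), ncard_trq_eq hq hK (gsMap_pow hq hK c₀)]
  · rintro p ⟨hp, rfl⟩
    exact hp.2.1
  · intro b hb
    refine Eq.trans ?_ (ncard_towerPoints_fst_snd hq hK h₀ hb)
    congr 1
    ext p
    simp only [Set.mem_ofPred_eq, and_assoc]

theorem ncard_towerPoints_snd (hq : 2 ≤ q) (hK : Nat.card K = q ^ 2) {c₁ : K}
    (h₁ : trq q c₁ ≠ 0) : {p ∈ towerPoints K q | p.2.1 = c₁}.ncard = q * q := by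
  rw [Set.ncard_eq_mul_of_fibers (t := {y : K | gsMap q y = trq q c₁}) (m := q)
    (fun p : K × K × K => p.1), ncard_gsMap_eq hq hK (trq_pow hq hK c₁) h₁]
  · rintro p ⟨hp, rfl⟩
    exact hp.2.1.symm
  · intro b hb
    refine Eq.trans ?_ (ncard_towerPoints_fst_snd hq hK (trq_ne_zero_of_gsMap_ne_zero hq
      ((show gsMap q b = trq q c₁ from hb) ▸ h₁)) hb.symm)
    congr 1
    ext p
    simp only [Set.mem_ofPred_eq]
    tauto

/-- Going down the tower, each step has `q` preimages under `gsMap`, and nonvanishing of the traces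
is inherited. -/
theorem ncard_towerPoints_thd (hq : 2 ≤ q) (hK : Nat.card K = q ^ 2) {c₂ : K}
    (h₂ : trq q c₂ ≠ 0) : {p ∈ towerPoints K q | p.2.2 = c₂}.ncard = q * q := by
  rw [Set.ncard_eq_mul_of_fibers (t := {y : K | gsMap q y = trq q c₂}) (m := q)
    (fun p : K × K × K => p.2.1), ncard_gsMap_eq hq hK (trq_pow hq hK c₂) h₂]
  · rintro p ⟨hp, rfl⟩
    exact hp.2.2.symm
  · intro b hb
    have hb' : gsMap q b = trq q c₂ := hb
    have hb0 : trq q b ≠ 0 := trq_ne_zero_of_gsMap_ne_zero hq (hb' ▸ h₂)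
    refine Eq.trans ?_ (ncard_gsMap_eq hq hK (trq_pow hq hK b) hb0)
    rw [← Set.ncard_image_of_injective
      {y : K | gsMap q y = trq q b} (f := fun y => (y, b, c₂)) (fun a b h => by simpa using h)]
    congr 1
    ext ⟨x, y, z⟩
    simp only [towerPoints, Set.mem_ofPred_eq, Set.mem_image, Prod.mk.injEq]
    constructor
    · rintro ⟨⟨⟨-, h, -⟩, rfl⟩, rfl⟩
      exact ⟨x, h.symm, rfl, rfl, rfl⟩
    · rintro ⟨x, h, rfl, rfl, rfl⟩
      exact ⟨⟨⟨trq_ne_zero_of_gsMap_ne_zero hq (h ▸ hb0), h.symm, hb'.symm⟩, rfl⟩, rfl⟩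

theorem ncard_towerPoints_of_mem {A : Set K} (f : K × K × K → K)
    (hf : ∀ c ∈ A, {p ∈ towerPoints K q | f p = c}.ncard = q * q) :
    {p ∈ towerPoints K q | f p ∈ A}.ncard = A.ncard * (q * q) := by
  refine Set.ncard_eq_mul_of_fibers f (fun p hp => hp.2) fun c hc => ?_
  rw [← hf c hc]
  congr 1
  ext p
  simp only [Set.mem_ofPred_eq]
  constructor
  · rintro ⟨⟨h, -⟩, rfl⟩
    exact ⟨h, rfl⟩
  · rintro ⟨h, rfl⟩
    exact ⟨⟨h, hc⟩, rfl⟩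

theorem ncard_trq_ne_zero (hq : 2 ≤ q) (hK : Nat.card K = q ^ 2) :
    {c : K | trq q c ≠ 0}.ncard = q ^ 2 - q := by
  have h : {c : K | trq q c ≠ 0} = {c : K | trq q c = 0}ᶜ := rfl
  rw [h, Set.ncard_compl, hK, (trq_range_and_ker hq hK).2.2]

theorem ncard_towerPoints (hq : 2 ≤ q) (hK : Nat.card K = q ^ 2) :
    (towerPoints K q).ncard = q ^ 2 * (q ^ 2 - q) := by
  rw [Set.ncard_eq_mul_of_fibers (t := {c : K | trq q c ≠ 0}) (m := q * q)
    (fun p : K × K × K => p.1) (fun p hp => hp.1)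
    (fun b hb => ncard_towerPoints_fst hq hK hb), ncard_trq_ne_zero hq hK]
  ring

/-! ### A product function attaining the zero bound. -/

omit [Finite K] in
open Polynomial in
/-- A product of polynomials in the three coordinates. -/
theorem exists_towerFun_eq_mul {f₀ f₁ f₂ : K[X]} (h₀ : f₀.natDegree < q + 1)
    (h₁ : f₁.natDegree < q) (h₂ : f₂.natDegree < q - 1) (hne₀ : f₀ ≠ 0) (hne₁ : f₁ ≠ 0)
    (hne₂ : f₂ ≠ 0) :
    ∃ a : Fin (q + 1) × Fin q × Fin (q - 1) → K, a ≠ 0 ∧ ∀ x y z : K,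
      towerFun q a x y z = f₀.eval x * f₁.eval y * f₂.eval z := by
  refine ⟨fun i => f₀.coeff i.1 * f₁.coeff i.2.1 * f₂.coeff i.2.2, fun h => ?_, fun x y z => ?_⟩
  · have h' := congrFun h (⟨_, h₀⟩, ⟨_, h₁⟩, ⟨_, h₂⟩)
    simp [hne₀, hne₁, hne₂] at h'
  · rw [eval_eq_sum_range' h₀, eval_eq_sum_range' h₁, eval_eq_sum_range' h₂, Finset.sum_range,
      Finset.sum_range, Finset.sum_range, Finset.sum_mul_sum, Finset.sum_mul, towerFun,
      Fintype.sum_prod_type]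
    refine Finset.sum_congr rfl fun i _ => ?_
    rw [Fintype.sum_prod_type, Finset.sum_mul]
    refine Finset.sum_congr rfl fun j _ => ?_
    rw [Finset.mul_sum]
    refine Finset.sum_congr rfl fun k _ => ?_
    rw [Algebra.algebraMap_self_apply]
    ring

open Polynomial in
theorem exists_polynomial_of_set (A : Set K) :
    ∃ f : K[X], f ≠ 0 ∧ f.natDegree = A.ncard ∧ ∀ c ∈ A, f.eval c = 0 := by
  classical
  have := Fintype.ofFinite K
  refine ⟨∏ c ∈ A.toFinset, (X - C c), (monic_prod_X_sub_C _ _).ne_zero, ?_, fun c hc => ?_⟩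
  · rw [natDegree_finsetProd_X_sub_C_eq_card, Set.ncard_eq_toFinset_card']
  · rw [eval_prod]
    exact Finset.prod_eq_zero (Set.mem_toFinset.2 hc) (by simp)

/-- A nonzero function whose number of zeros on the evaluation set attains the bound. -/
theorem exists_towerFun_many_zeros (hq : 4 ≤ q) (hK : Nat.card K = q ^ 2) :
    ∃ a : Fin (q + 1) × Fin q × Fin (q - 1) → K, a ≠ 0 ∧
      q * q * q + q * q * (q - 1) + q * q * (q - 2)
        ≤ {p ∈ towerPoints K q | towerFun q a p.1 p.2.1 p.2.2 = 0}.ncard := by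
  have hq2 : 2 ≤ q := by omega
  -- Zeros on `A₀` force `x₁` to have trace `c`, and zeros on `A₂` force `gsMap q x₁ = 1`. The
  -- choice of `c` makes these incompatible, and `A₁` is chosen to avoid both, so the three zero
  -- sets are disjoint.
  obtain ⟨c, hcq, hc0, hc⟩ := exists_trq_ne_of_gsMap_eq_one hq hK
  obtain ⟨A₀, hA₀, hA₀'⟩ : ∃ A : Set K, A.ncard = q ∧ ∀ x ∈ A, gsMap q x = c :=
    ⟨{x | gsMap q x = c}, ncard_gsMap_eq hq2 hK hcq hc0, fun _ h => h⟩
  obtain ⟨A₁, hA₁', hA₁⟩ : ∃ A ⊆ {x : K | trq q x ≠ 0} \ ({x | trq q x = c} ∪ {x | gsMap q x = 1}),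
      A.ncard = q - 1 := by
    refine Set.exists_subset_card_eq ?_
    have h1 := Set.le_ncard_sdiff ({x : K | trq q x = c} ∪ {x | gsMap q x = 1})
      {x : K | trq q x ≠ 0} (Set.toFinite _)
    have h2 := Set.ncard_union_le {x : K | trq q x = c} {x | gsMap q x = 1}
    rw [ncard_trq_eq hq2 hK hcq, ncard_gsMap_eq hq2 hK (one_pow q) one_ne_zero] at h2
    rw [ncard_trq_ne_zero hq2 hK] at h1
    -- Removing two sets of size `q` from the `q ^ 2 - q` elements of nonzero trace must leave at
    -- least `q - 1`.
    have h3 : 4 * q ≤ q ^ 2 := by nlinarith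
    omega
  obtain ⟨A₂, hA₂', hA₂⟩ : ∃ A ⊆ {x : K | trq q x = 1}, A.ncard = q - 2 := by
    refine Set.exists_subset_card_eq ?_
    rw [ncard_trq_eq hq2 hK (one_pow q)]
    omega
  obtain ⟨f₀, hf₀, hd₀, hz₀⟩ := exists_polynomial_of_set A₀
  obtain ⟨f₁, hf₁, hd₁, hz₁⟩ := exists_polynomial_of_set A₁
  obtain ⟨f₂, hf₂, hd₂, hz₂⟩ := exists_polynomial_of_set A₂
  obtain ⟨a, ha, hv⟩ := exists_towerFun_eq_mul (q := q) (f₀ := f₀) (f₁ := f₁) (f₂ := f₂)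
    (by omega) (by omega) (by omega) hf₀ hf₁ hf₂
  refine ⟨a, ha, ?_⟩
  have hn₀ := ncard_towerPoints_of_mem (q := q) (A := A₀) (fun p => p.1) fun x hx =>
    ncard_towerPoints_fst hq2 hK (trq_ne_zero_of_gsMap_ne_zero hq2 (hA₀' x hx ▸ hc0))
  have hn₁ := ncard_towerPoints_of_mem (q := q) (A := A₁) (fun p => p.2.1) fun x hx =>
    ncard_towerPoints_snd hq2 hK (hA₁' hx).1
  have hn₂ := ncard_towerPoints_of_mem (q := q) (A := A₂) (fun p => p.2.2) fun x hx =>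
    ncard_towerPoints_thd hq2 hK ((hA₂' hx : trq q x = 1) ▸ one_ne_zero)
  have hdisj₁ : Disjoint {p ∈ towerPoints K q | p.1 ∈ A₀} {p ∈ towerPoints K q | p.2.1 ∈ A₁} := by
    rw [Set.disjoint_left]
    rintro p ⟨hp, h⟩ ⟨-, h'⟩
    exact (hA₁' h').2 (Or.inl (hp.2.1.trans (hA₀' _ h)))
  have hdisj₂ : Disjoint ({p ∈ towerPoints K q | p.1 ∈ A₀} ∪ {p ∈ towerPoints K q | p.2.1 ∈ A₁})
      {p ∈ towerPoints K q | p.2.2 ∈ A₂} := by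
    rw [Set.disjoint_left]
    rintro p h ⟨hp, h'⟩
    have h1 : gsMap q p.2.1 = 1 := hp.2.2.symm.trans (hA₂' h')
    rcases h with ⟨-, h⟩ | ⟨-, h⟩
    · exact hc _ h1 (hp.2.1.trans (hA₀' _ h))
    · exact (hA₁' h).2 (Or.inr h1)
  have hsub : ({p ∈ towerPoints K q | p.1 ∈ A₀} ∪ {p ∈ towerPoints K q | p.2.1 ∈ A₁})
      ∪ {p ∈ towerPoints K q | p.2.2 ∈ A₂}
        ⊆ {p ∈ towerPoints K q | towerFun q a p.1 p.2.1 p.2.2 = 0} := by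
    rintro p ((⟨hp, h⟩ | ⟨hp, h⟩) | ⟨hp, h⟩) <;> refine ⟨hp, ?_⟩ <;> rw [hv]
    · rw [hz₀ _ h, zero_mul, zero_mul]
    · rw [hz₁ _ h, mul_zero, zero_mul]
    · rw [hz₂ _ h, mul_zero]
  refine le_trans (le_of_eq ?_) (Set.ncard_le_ncard hsub (Set.toFinite _))
  rw [Set.ncard_union_eq hdisj₂, Set.ncard_union_eq hdisj₁, hn₀, hn₁, hn₂, hA₀, hA₁, hA₂]
  ring

end PointCount

/-! ## The code `C₂(S, q P_∞)` -/

/-- By linearity, codewords agreeing on `R` agree at `i`; so `φ` may use any codeword with the given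
entries, with the default `0` when there is none. -/
theorem IsLocallyRecoverable.of_eq_zero {K ι : Type*} [Field K] {C : Submodule K (ι → K)} {r : ℕ}
    (h : ∀ i : ι, ∃ R : Finset ι, i ∉ R ∧ R.card ≤ r ∧
      ∀ c ∈ C, (∀ j ∈ R, c j = 0) → c i = 0) : IsLocallyRecoverable C r := by
  classical
  intro i
  obtain ⟨R, hi, hR, hz⟩ := h i
  refine ⟨R, hi, hR, fun g => if hg : ∃ c ∈ C, ∀ j : R, c j = g j then hg.choose i else 0, ?_⟩
  intro c hc
  have hg : ∃ c' ∈ C, ∀ j : R, c' j = c j := ⟨c, hc, fun _ => rfl⟩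
  beta_reduce
  rw [dif_pos hg]
  have h1 := hz (c - hg.choose) (C.sub_mem hc hg.choose_spec.1) fun j hj => by
    rw [Pi.sub_apply, hg.choose_spec.2 ⟨j, hj⟩, sub_self]
  exact sub_eq_zero.1 h1

namespace IsGSTower

open FFPlace

variable {K : Type*} [Field K] {q : ℕ} {F : Type*} [Field F] [Algebra K F]
  [Algebra (RatFunc K) F] [IsScalarTower K (RatFunc K) F] {x₁ x₂ : F}

open Polynomial in
/-- The monomials spanning the space `V` are linearly independent. -/
theorem eq_zero_of_towerFun_eq_zero (H : IsGSTower K q x₁ x₂)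
    {a : Fin (q + 1) × Fin q × Fin (q - 1) → K}
    (ha : towerFun q a (algebraMap (RatFunc K) F RatFunc.X) x₁ x₂ = 0) : a = 0 := by
  classical
  let f : Fin q × Fin (q - 1) → K[X] := fun j => ∑ i : Fin (q + 1), monomial (i : ℕ) (a (i, j))
  let ι : Fin q × Fin (q - 1) → Fin q × Fin q := fun j => (j.1, j.2.castLE (Nat.sub_le q 1))
  have hι : Function.Injective ι := fun j k h => by
    simp only [ι, Prod.mk.injEq] at h
    exact Prod.ext h.1 (Fin.castLE_injective _ h.2)
  have hli : LinearIndependent (RatFunc K)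
      (fun i : Fin q × Fin q => x₁ ^ (i.1 : ℕ) * x₂ ^ (i.2 : ℕ)) := by
    rw [Fintype.linearIndependent_iff]
    intro c hc
    exact H.eq_zero_of_sum_eq_zero c (by simpa only [Algebra.smul_def] using hc)
  have hsum : ∑ j, algebraMap K[X] (RatFunc K) (f j) •
      (x₁ ^ ((ι j).1 : ℕ) * x₂ ^ ((ι j).2 : ℕ)) = 0 := by
    refine Eq.trans ?_ ha
    conv_rhs => rw [towerFun, Fintype.sum_prod_type_right]
    refine Finset.sum_congr rfl fun j _ => ?_
    rw [Algebra.smul_def, ← aeval_algebraMap_ratFunc_X, map_sum, Finset.sum_mul]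
    refine Finset.sum_congr rfl fun i _ => ?_
    rw [aeval_monomial]
    simp only [ι, Fin.val_castLE]
    ring
  have h := Fintype.linearIndependent_iff.1 (hli.comp ι hι) _ hsum
  funext ⟨i, j⟩
  have hj : f j = 0 := (map_eq_zero_iff _ (RatFunc.algebraMap_injective K)).1 (h j)
  have hc := congrArg (fun p => p.coeff (i : ℕ)) hj
  simpa [f, finsetSum_coeff, coeff_monomial, Fin.val_inj] using hc

variable [Finite K]

/-- A description of the code in terms of the points of the tower equations. -/
theorem exists_equiv_and_mem_code_iff (H : IsGSTower K q x₁ x₂) :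
    ∃ e : (placesAbove (placesS K q) : Set (FFPlace K F)) ≃ towerPoints K q,
      (∀ (a : Fin (q + 1) × Fin q × Fin (q - 1) → K)
        (Q : (placesAbove (placesS K q) : Set (FFPlace K F))),
        Q.1.HasValue (towerFun q a (algebraMap (RatFunc K) F RatFunc.X) x₁ x₂)
          (towerFun q a (e Q).1.1 (e Q).1.2.1 (e Q).1.2.2)) ∧
      ∀ c, c ∈ codeC2 (F := F) (placesS K q) (Finsupp.single (placeInfty K) (q : ℤ)) q q x₁ x₂ ↔
        ∃ a : Fin (q + 1) × Fin q × Fin (q - 1) → K,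
          c = fun Q => towerFun q a (e Q).1.1 (e Q).1.2.1 (e Q).1.2.2 := by
  obtain ⟨e, he⟩ := H.exists_equiv_towerPoints
  have hval := fun (a : Fin (q + 1) × Fin q × Fin (q - 1) → K)
    (Q : (placesAbove (placesS K q) : Set (FFPlace K F))) => hasValue_towerFun (he Q) a
  refine ⟨e, hval, fun c => ?_⟩
  constructor
  · rintro ⟨f, hf, hc⟩
    rw [spaceV_eq_range] at hf
    obtain ⟨a, rfl⟩ := hf
    exact ⟨a, funext fun Q => (hc Q).unique (hval a Q)⟩
  · rintro ⟨a, rfl⟩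
    refine ⟨_, ?_, hval a⟩
    rw [spaceV_eq_range]
    exact ⟨a, rfl⟩

theorem ncard_zeros_le_of_ne_zero (H : IsGSTower K q x₁ x₂)
    {a : Fin (q + 1) × Fin q × Fin (q - 1) → K} (ha : a ≠ 0) :
    {p ∈ towerPoints K q | towerFun q a p.1 p.2.1 p.2.2 = 0}.ncard
      ≤ q * q * q + q * q * (q - 1) + q * q * (q - 2) :=
  H.ncard_zeros_le a fun h => ha (H.eq_zero_of_towerFun_eq_zero h)

/-- Distance plus maximal number of zeros is the length; since `4 * q ≤ q ^ 2`, the truncated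
subtraction is a true one. -/
theorem weight_identity (hq : 5 ≤ q) :
    q ^ 2 * (q ^ 2 - 4 * q + 3) + (q * q * q + q * q * (q - 1) + q * q * (q - 2))
      = q ^ 2 * (q ^ 2 - q) := by
  obtain ⟨m, rfl⟩ := Nat.exists_eq_add_of_le' hq
  have h1 : (m + 5) ^ 2 - 4 * (m + 5) = m ^ 2 + 6 * m + 5 := by
    rw [Nat.sub_eq_iff_eq_add (by nlinarith)]; ring
  have h2 : (m + 5) ^ 2 - (m + 5) = m ^ 2 + 9 * m + 20 := by
    rw [Nat.sub_eq_iff_eq_add (by nlinarith)]; ring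
  rw [h1, h2, show m + 5 - 1 = m + 4 by omega, show m + 5 - 2 = m + 3 by omega]
  ring

theorem weight_add_zeros {B : Type*} (hq : 2 ≤ q) (hK : Nat.card K = q ^ 2)
    (e : B ≃ towerPoints K q) (a : Fin (q + 1) × Fin q × Fin (q - 1) → K) :
    {Q : B | towerFun q a (e Q).1.1 (e Q).1.2.1 (e Q).1.2.2 ≠ 0}.ncard
      + {p ∈ towerPoints K q | towerFun q a p.1 p.2.1 p.2.2 = 0}.ncard
      = q ^ 2 * (q ^ 2 - q) := by
  have himg : (fun Q => (e Q).1) '' {Q : B | towerFun q a (e Q).1.1 (e Q).1.2.1 (e Q).1.2.2 ≠ 0}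
      = {p ∈ towerPoints K q | towerFun q a p.1 p.2.1 p.2.2 ≠ 0} := by
    ext p
    constructor
    · rintro ⟨Q, hQ, rfl⟩
      exact ⟨(e Q).2, hQ⟩
    · rintro ⟨hp, h⟩
      exact ⟨e.symm ⟨p, hp⟩, by simpa using h, by simp⟩
  rw [← Set.ncard_image_of_injective _ (Subtype.val_injective.comp e.injective),
    ← ncard_towerPoints hq hK]
  change ((fun Q => (e Q).1) '' _).ncard + _ = _
  rw [himg, ← Set.ncard_union_eq]
  · congr 1
    ext p
    simp only [Set.mem_union, Set.mem_ofPred_eq]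
    tauto
  · rw [Set.disjoint_left]
    exact fun p h h' => h.2 h'.2

open Polynomial in
/-- A function of the space `V` is determined on a fibre of `x₂` by its values at all but one
points of the fibre. -/
theorem towerFun_eq_zero_of_fibre (hq : 2 ≤ q) (hK : Nat.card K = q ^ 2)
    (a : Fin (q + 1) × Fin q × Fin (q - 1) → K) {α β γ : K}
    (hz : ∀ c, trq q c = gsMap q β → c ≠ γ → towerFun q a α β c = 0)
    (hγ : trq q γ = gsMap q β) : towerFun q a α β γ = 0 := by
  classical
  let f : K[X] := ∑ i, monomial (i.2.2 : ℕ) (a i * α ^ (i.1 : ℕ) * β ^ (i.2.1 : ℕ))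
  have hf : ∀ c, f.eval c = towerFun q a α β c := fun c => by
    rw [eval_finsetSum, towerFun]
    refine Finset.sum_congr rfl fun i _ => ?_
    rw [eval_monomial, Algebra.algebraMap_self_apply]
    ring
  have hd : f.natDegree < q - 1 := by
    -- Degree at most `q - 2` in `x₂` is what lets the `q - 1` remaining points of the fibre
    -- determine the polynomial.
    refine lt_of_le_of_lt (natDegree_sum_le_of_forall_le (n := q - 2) _ _ fun i _ =>
      (natDegree_monomial_le _).trans ?_) (by omega)
    omega
  have hcard : ((Set.toFinite {c : K | trq q c = gsMap q β}).toFinset.erase γ).card = q - 1 := by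
    rw [Finset.card_erase_of_mem (by simpa using hγ), ← Set.ncard_eq_toFinset_card,
      ncard_trq_eq hq hK (gsMap_pow hq hK β)]
  have h0 : f = 0 := by
    refine eq_zero_of_natDegree_lt_card_of_eval_eq_zero' f _ (fun c hc => ?_) (hcard ▸ hd)
    rw [Finset.mem_erase, Set.Finite.mem_toFinset] at hc
    rw [hf]
    exact hz c hc.2 hc.1
  rw [← hf, h0, eval_zero]

theorem isLocallyRecoverable_code (H : IsGSTower K q x₁ x₂) :
    IsLocallyRecoverable (codeC2 (F := F) (placesS K q) (Finsupp.single (placeInfty K) (q : ℤ))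
      q q x₁ x₂) (q - 1) := by
  classical
  obtain ⟨e, -, hC⟩ := H.exists_equiv_and_mem_code_iff
  have hq := H.two_le
  refine IsLocallyRecoverable.of_eq_zero fun Q => ?_
  obtain ⟨⟨⟨α, β, γ⟩, hp⟩, rfl⟩ := e.symm.surjective Q
  obtain ⟨h0, h1, h2⟩ := hp
  simp only at h0 h1 h2
  let G := (Set.toFinite {c : K | trq q c = gsMap q β}).toFinset.erase γ
  have hG : ∀ c, c ∈ G ↔ c ≠ γ ∧ trq q c = gsMap q β := fun c => by simp [G]
  have hcard : G.card = q - 1 := by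
    rw [Finset.card_erase_of_mem (by simpa using h2), ← Set.ncard_eq_toFinset_card,
      ncard_trq_eq hq H.card_eq (gsMap_pow hq H.card_eq β)]
  refine ⟨G.attach.image fun c : {c // c ∈ G} => e.symm ⟨(α, β, c), h0, h1, ((hG _).1 c.2).2⟩,
    ?_, ?_, ?_⟩
  · intro h
    obtain ⟨c, -, hc⟩ := Finset.mem_image.1 h
    have hc' := congrArg (fun p => p.1.2.2) (e.symm.injective hc)
    exact ((hG _).1 c.2).1 hc'
  · exact Finset.card_image_le.trans (by rw [Finset.card_attach, hcard])
  · intro c hc hz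
    obtain ⟨a, rfl⟩ := (hC c).1 hc
    simp only [Equiv.apply_symm_apply]
    refine towerFun_eq_zero_of_fibre hq H.card_eq a (fun c hc hne => ?_) h2
    have h3 := hz _ (Finset.mem_image.2 ⟨⟨c, (hG c).2 ⟨hne, hc⟩⟩, Finset.mem_attach _ _, rfl⟩)
    simpa only [Equiv.apply_symm_apply] using h3

/-- A nonzero coefficient vector has fewer zeros than there are points, so evaluation is injective
and the dimension is the number `(q + 1) * q * (q - 1)` of monomials. -/
theorem finrank_code (H : IsGSTower K q x₁ x₂) (hq : 5 ≤ q) :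
    Module.finrank K (codeC2 (F := F) (placesS K q) (Finsupp.single (placeInfty K) (q : ℤ))
      q q x₁ x₂) = q ^ 3 - q := by
  obtain ⟨e, -, hC⟩ := H.exists_equiv_and_mem_code_iff
  let ev : (Fin (q + 1) × Fin q × Fin (q - 1) → K) →ₗ[K]
      ((placesAbove (placesS K q) : Set (FFPlace K F)) → K) :=
    LinearMap.pi fun Q => towerLin K q (e Q).1.1 (e Q).1.2.1 (e Q).1.2.2
  have hrange : codeC2 (F := F) (placesS K q) (Finsupp.single (placeInfty K) (q : ℤ)) q q x₁ x₂
      = LinearMap.range ev := by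
    ext c
    rw [hC]
    exact exists_congr fun a => eq_comm
  have hinj : Function.Injective ev := by
    rw [← LinearMap.ker_eq_bot, LinearMap.ker_eq_bot']
    intro a ha
    by_contra hne
    have h1 := H.ncard_zeros_le_of_ne_zero hne
    have h2 := weight_add_zeros H.two_le H.card_eq e a
    have h3 : {Q : (placesAbove (placesS K q) : Set (FFPlace K F)) |
        towerFun q a (e Q).1.1 (e Q).1.2.1 (e Q).1.2.2 ≠ 0} = ∅ := by
      rw [Set.eq_empty_iff_forall_notMem]
      exact fun Q hQ => hQ (congrFun ha Q)
    rw [h3, Set.ncard_empty, ← weight_identity hq] at h2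
    have h4 : 0 < q ^ 2 * (q ^ 2 - 4 * q + 3) := by positivity
    omega
  rw [hrange, LinearMap.finrank_range_of_inj hinj, Module.finrank_fintype_fun_eq_card]
  simp only [Fintype.card_prod, Fintype.card_fin]
  obtain ⟨m, rfl⟩ := Nat.exists_eq_add_of_le' hq
  rw [show m + 5 - 1 = m + 4 by omega, eq_comm, Nat.sub_eq_iff_eq_add (by nlinarith [sq_nonneg m])]
  ring

theorem isMinDistance_code (H : IsGSTower K q x₁ x₂) (hq : 5 ≤ q) :
    IsMinDistance (codeC2 (F := F) (placesS K q) (Finsupp.single (placeInfty K) (q : ℤ))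
      q q x₁ x₂) (q ^ 2 * (q ^ 2 - 4 * q + 3)) := by
  obtain ⟨e, -, hC⟩ := H.exists_equiv_and_mem_code_iff
  have hw := weight_identity hq
  have hpos : 0 < q ^ 2 * (q ^ 2 - 4 * q + 3) := by positivity
  constructor
  · obtain ⟨a, ha, hz⟩ := exists_towerFun_many_zeros (by omega) H.card_eq
    have h1 := H.ncard_zeros_le_of_ne_zero ha
    have h2 := weight_add_zeros H.two_le H.card_eq e a
    refine ⟨_, (hC _).2 ⟨a, rfl⟩, fun h => ?_, by omega⟩
    have h3 : {Q : (placesAbove (placesS K q) : Set (FFPlace K F)) |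
        towerFun q a (e Q).1.1 (e Q).1.2.1 (e Q).1.2.2 ≠ 0} = ∅ := by
      rw [Set.eq_empty_iff_forall_notMem]
      exact fun Q hQ => hQ (congrFun h Q)
    rw [h3, Set.ncard_empty] at h2
    omega
  · rintro _ ⟨c, hc, hne, rfl⟩
    obtain ⟨a, rfl⟩ := (hC c).1 hc
    have ha : a ≠ 0 := by
      rintro rfl
      exact hne (funext fun Q => by simp [towerFun])
    have h1 := H.ncard_zeros_le_of_ne_zero ha
    have h2 := weight_add_zeros H.two_le H.card_eq e a
    beta_reduce
    omega

end IsGSTower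

theorem proposition4p1 (q : ℕ) (hq : 5 ≤ q)
    (K : Type*) [Field K] [Finite K] (hK : Nat.card K = q ^ 2)
    (F : Type*) [Field F] [Algebra K F] [Algebra (RatFunc K) F] [IsScalarTower K (RatFunc K) F]
    (x₀ x₁ x₂ : F) (hx₀ : x₀ = algebraMap (RatFunc K) F RatFunc.X)
    (hx₁ : x₁ ^ q + x₁ = x₀ ^ q / (x₀ ^ (q - 1) + 1))
    (hx₂ : x₂ ^ q + x₂ = x₁ ^ q / (x₁ ^ (q - 1) + 1))
    (hF : IntermediateField.adjoin (RatFunc K) {x₁, x₂} = ⊤)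
    (S : Set (FFPlace K (RatFunc K))) (hS : S = placesS K q)
    (D : FFPlace K (RatFunc K) →₀ ℤ) (hD : D = Finsupp.single (placeInfty K) (q : ℤ)) :
    -- the evaluation of the functions in `V` at the evaluation set is well defined
    (∀ f ∈ spaceV D q q x₁ x₂, ∀ Q ∈ (placesAbove S : Set (FFPlace K F)),
      ∃ c : K, Q.HasValue f c) ∧
    -- length
    Nat.card (placesAbove S : Set (FFPlace K F)) = q ^ 2 * (q ^ 2 - q) ∧
    -- locality
    IsLocallyRecoverable (codeC2 S D q q x₁ x₂) (q - 1) ∧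
    -- dimension
    Module.finrank K (codeC2 S D q q x₁ x₂) = q ^ 3 - q ∧
    -- minimum distance
    IsMinDistance (codeC2 S D q q x₁ x₂) (q ^ 2 * (q ^ 2 - 4 * q + 3)) := by
  subst hx₀ hS hD
  have H : IsGSTower K q x₁ x₂ := ⟨by omega, hK, hx₁, hx₂, hF⟩
  obtain ⟨e, hval, -⟩ := H.exists_equiv_and_mem_code_iff
  refine ⟨fun f hf Q hQ => ?_, ?_, H.isLocallyRecoverable_code, H.finrank_code hq,
    H.isMinDistance_code hq⟩
  · rw [spaceV_eq_range] at hf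
    obtain ⟨a, rfl⟩ := hf
    exact ⟨_, hval a ⟨Q, hQ⟩⟩
  · rw [Nat.card_congr e, Nat.card_coe_set_eq, ncard_towerPoints H.two_le hK]
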